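/- Let $n\ge 1$ and let $\Omega\subset\mathbb C^n$ be a nonempty, smoothly bounded, pseudoconvex open set which is balanced ($\lambda z\in\Omega$ whenever $z\in\Omega$, $\lambda\in\mathbb C$, $|\lambda|\le 1$). Let $u_\Omega$ be the logarithm of the Minkowski functional of $\Omega$, so that $u_\Omega(\lambda z)=\log|\lambda|+u_\Omega(z)$ and $\Omega=\{u_\Omega<0\}$. Let $f:(-\infty,0)\to\mathbb R$ be convex and increasing (not necessarily strictly) with $\lim_{t\to0^-}f(t)=0$, and let $\phi=f(u_\Omega)$ on $\Omega$, where $f(-\infty):=\lim_{t\to-\infty}f(t)\in[-\infty,0]$ is the value of $\phi$ at the origin. Let $dd^c=\frac{i}{2\pi}\partial\bar\partial$ (so that $(dd^c\log|z|)^n=2^{-n}\delta_0$). Then the complex Monge-Ampère measure $(dd^c\phi)^n$ is well defined on $\Omega$ (in the sense of Bedford-Taylor and Demailly: $(dd^c\phi)^{k+1}=dd^c\big(\phi\,(dd^c\phi)^k\big)$, $(dd^c\phi)^0=1$, as currents with measure coefficients), and, as an identity in $[0,\infty]$, $$\int_\Omega(-\phi)\,(dd^c\phi)^n=2^{-n}\int_{-\infty}^0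 f'(t)^{n+1}\,dt .$$ In particular, let $\hat\phi$ be a Schwarz symmetrization of $\phi$, that is, an extended-real-valued function of the form $\hat\phi(z)=g(|z|)$ with $g$ increasing, on the ball $B$ about the origin with the same volume as $\Omega$, such that $|\{\hat\phi<t\}|=|\{\phi<t\}|$ for every real $t$. Such a $\hat\phi$ exists, and for each one $(dd^c\hat\phi)^n$ is well defined on $B$ and the Monge-Ampère energies agree: $$\frac1{n+1}\int_B(-\hat\phi)\,(dd^c\hat\phi)^n=\frac1{n+1}\int_\Omega(-\phi)\,(dd^c\phi)^n .$$ -/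

import Mathlib

open MeasureTheory Filter Topology
open scoped ContDiff ENNReal

noncomputable section

namespace Pluripotential

/-- The space `ℂⁿ` with its Euclidean norm; `volume` on it is Lebesgue measure on `ℝ²ⁿ`. -/
abbrev Cn (n : ℕ) : Type := EuclideanSpace ℂ (Fin n)

variable {n : ℕ}

/-! ### Wirtinger derivatives -/

/-- `∂χ/∂z_j = (∂χ/∂x_j - i ∂χ/∂y_j) / 2`. -/
def dz (j : Fin n) (χ : Cn n → ℂ) (z : Cn n) : ℂ :=
  (fderiv ℝ χ z (EuclideanSpace.single j 1)
    - Complex.I * fderiv ℝ χ z (EuclideanSpace.single j Complex.I)) / 2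

/-- `∂χ/∂z̄_j = (∂χ/∂x_j + i ∂χ/∂y_j) / 2`. -/
def dzbar (j : Fin n) (χ : Cn n → ℂ) (z : Cn n) : ℂ :=
  (fderiv ℝ χ z (EuclideanSpace.single j 1)
    + Complex.I * fderiv ℝ χ z (EuclideanSpace.single j Complex.I)) / 2

/-! ### Smoothly bounded pseudoconvex domains -/

/-- `ρ` is a (local, smooth) defining function of `Ω` at the boundary point `p`. -/
def IsLocalDefiningFunction (Ω : Set (Cn n)) (p : Cn n) (ρ : Cn n → ℝ) : Prop :=
  ∃ U : Set (Cn n), IsOpen U ∧ p ∈ U ∧ ContDiffOn ℝ ∞ ρ U ∧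
    Ω ∩ U = {z | z ∈ U ∧ ρ z < 0} ∧ fderiv ℝ ρ p ≠ 0

/-- `Ω` is bounded and open, with smooth boundary. -/
structure IsSmoothlyBounded (Ω : Set (Cn n)) : Prop where
  isOpen : IsOpen Ω
  bounded : Bornology.IsBounded Ω
  smooth_boundary : ∀ p ∈ frontier Ω, ∃ ρ, IsLocalDefiningFunction Ω p ρ

/-- (Levi) pseudoconvexity of a smoothly bounded open set: at every boundary point the Levi form
of a defining function is positive semidefinite on the complex tangent space of the boundary. -/
def IsLeviPseudoconvex (Ω : Set (Cn n)) : Prop :=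
  ∀ p ∈ frontier Ω, ∀ ρ : Cn n → ℝ, IsLocalDefiningFunction Ω p ρ →
    ∀ w : Fin n → ℂ, ∑ j, dz j (fun z => (ρ z : ℂ)) p * w j = 0 →
      0 ≤ (∑ j, ∑ k, dz j (dzbar k (fun z => (ρ z : ℂ))) p * w j * star (w k)).re

/-! ### The logarithmically homogeneous function of a balanced domain -/

/-- `u_Ω`, the logarithm of the Minkowski functional of `Ω`, with value `-∞` where the latter
vanishes. -/
def logMinkowski (Ω : Set (Cn n)) (z : Cn n) : EReal :=
  ENNReal.log (ENNReal.ofReal (gauge Ω z))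

/-- The extension to `-∞` of an increasing function `f` on `(-∞, 0)`, by
`f (-∞) = lim_{t → -∞} f t = inf f`. -/
def extendBot (f : ℝ → ℝ) (s : EReal) : EReal :=
  if s = ⊥ then ⨅ t : Set.Iio (0 : ℝ), ((f t : ℝ) : EReal) else ((f s.toReal : ℝ) : EReal)

/-! ### The complex Monge-Ampère operator -/

/-- Complex-valued smooth functions with compact support in `Ω`. -/
def IsTestFunction (Ω : Set (Cn n)) (χ : Cn n → ℂ) : Prop :=
  ContDiff ℝ ∞ χ ∧ HasCompactSupport χ ∧ tsupport χ ⊆ Ω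

/-- A complex Radon measure `θ ν`, presented by a density `θ` and a positive measure `ν`. -/
structure Coeff (n : ℕ) where
  ν : Measure (Cn n)
  θ : Cn n → ℂ

/-- `θ ν` is of locally finite mass in `Ω`. -/
def Coeff.LocallyFinite (Ω : Set (Cn n)) (c : Coeff n) : Prop :=
  ∀ K ⊆ Ω, IsCompact K → IntegrableOn c.θ K c.ν

/-- `∫ g d(θ ν)`. -/
def Coeff.pair (c : Coeff n) (g : Cn n → ℂ) : ℂ := ∫ z, g z * c.θ z ∂c.ν

/-- `φ θ ν` is of locally finite mass in `Ω`; in particular `|θ| ν` does not charge the set where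
`φ` is infinite. -/
def Coeff.MulLocallyFinite (Ω : Set (Cn n)) (φ : Cn n → EReal) (c : Coeff n) : Prop :=
  ∀ K ⊆ Ω, IsCompact K →
    (∀ᵐ z ∂(c.ν.restrict K), c.θ z ≠ 0 → φ z ≠ ⊥ ∧ φ z ≠ ⊤) ∧
    IntegrableOn (fun z => ((φ z).toReal : ℂ) * c.θ z) K c.ν

/-- A current of bidegree `(k, k)` with measure coefficients,
`T = (1 / k!)² ∑_{I, J} T_{I J} (dz_{I 0} ∧ dz̄_{J 0}) ∧ ⋯ ∧ (dz_{I (k-1)} ∧ dz̄_{J (k-1)})`,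
where `I` and `J` run over all `k`-tuples of indices, and `T_{I J}` is antisymmetric in the
entries of `I` and in those of `J`. -/
abbrev Current (n k : ℕ) : Type := (Fin k → Fin n) → (Fin k → Fin n) → Coeff n

/-- `S = ∂∂̄ (φ T)` on `Ω` in the sense of currents: the coefficient of `dz_I ∧ dz̄_J` is
`S_{I J} = ∑_{a, b} (-1)^(a+b) ∂_{I a} ∂̄_{J b} (φ T_{I ∖ a, J ∖ b})` as a distribution. -/
def IsDDbarMul (Ω : Set (Cn n)) (φ : Cn n → EReal) {k : ℕ} (T : Current n k)
    (S : Current n (k + 1)) : Prop :=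
  ∀ (I J : Fin (k + 1) → Fin n) (χ : Cn n → ℂ), IsTestFunction Ω χ →
    (S I J).pair χ = ∑ a : Fin (k + 1), ∑ b : Fin (k + 1), (-1 : ℂ) ^ ((a : ℕ) + (b : ℕ)) *
      (T (I ∘ a.succAbove) (J ∘ b.succAbove)).pair
        (fun z => ((φ z).toReal : ℂ) * dz (I a) (dzbar (J b) χ) z)

/-- The powers `T k = (∂∂̄φ)^k`, `k ≤ n`, in `Ω`, in the sense of Bedford, Taylor and Demailly:
`T 0 = 1`, and inductively `T (k + 1) = ∂∂̄ (φ T k)`, where it is part of the definition that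
`T k` has measure coefficients and that `φ T k` has locally finite mass. -/
structure IsDDbarPowers (Ω : Set (Cn n)) (φ : Cn n → EReal) (T : (k : ℕ) → Current n k) :
    Prop where
  zero : ∀ I J, T 0 I J = ⟨volume, fun _ => 1⟩
  locallyFinite : ∀ k ≤ n, ∀ I J, (T k I J).LocallyFinite Ω
  mulLocallyFinite : ∀ k < n, ∀ I J, (T k I J).MulLocallyFinite Ω φ
  succ : ∀ k < n, IsDDbarMul Ω φ (T k) (T (k + 1))

/-- `μ = (dd^c φ)^n` on `Ω`, with the normalization `dd^c = (i / 2π) ∂∂̄`, for which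
`(dd^c log |z|)^n = 2^{-n} δ_0`. As `(i/2) dz_j ∧ dz̄_j` is Lebesgue measure in the variable `z_j`,
`μ` is `π^{-n}` times the coefficient of `(∂∂̄φ)^n`; for smooth `φ` it is
`n! π^{-n} det (∂²φ / ∂z_j ∂z̄_k)` times Lebesgue measure. The measure `μ` lives on `Ω`. -/
def IsMongeAmpereMeasure (Ω : Set (Cn n)) (φ : Cn n → EReal) (μ : Measure (Cn n)) : Prop :=
  μ Ωᶜ = 0 ∧ (∀ K ⊆ Ω, IsCompact K → μ K < ⊤) ∧
    ∃ T : (k : ℕ) → Current n k, IsDDbarPowers Ω φ T ∧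
      ∀ χ : Cn n → ℂ, IsTestFunction Ω χ →
        ∫ z, χ z ∂μ = ((Real.pi : ℂ) ^ n)⁻¹ * (T n id id).pair χ

open Classical in
/-- The Monge-Ampère measure `(dd^c φ)^n` on `Ω` (zero if it is not defined). -/
def mongeAmpere (Ω : Set (Cn n)) (φ : Cn n → EReal) : Measure (Cn n) :=
  if h : ∃ μ, IsMongeAmpereMeasure Ω φ μ then h.choose else 0

/-- The Monge-Ampère energy `(n + 1)⁻¹ ∫_Ω (-φ) (dd^c φ)^n` of a function `φ ≤ 0`. -/
def energy (Ω : Set (Cn n)) (φ : Cn n → EReal) : ℝ≥0∞ :=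
  ((n : ℝ≥0∞) + 1)⁻¹ * ∫⁻ z in Ω, (-φ z).toENNReal ∂(mongeAmpere Ω φ)

/-! ### Schwarz symmetrization -/

/-- `ψ`, on the ball of radius `R` about the origin, is a Schwarz symmetrization of `φ` on `Ω`:
it is a radial increasing function, equidistributed with `φ`, and the ball has the volume
of `Ω`. -/
def IsSchwarzSymmetrization (Ω : Set (Cn n)) (φ : Cn n → EReal) (R : ℝ) (ψ : Cn n → EReal) :
    Prop :=
  0 < R ∧ volume (Metric.ball (0 : Cn n) R) = volume Ω ∧
    (∃ g : ℝ → EReal, MonotoneOn g (Set.Ico 0 R) ∧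
      ∀ z ∈ Metric.ball (0 : Cn n) R, ψ z = g ‖z‖) ∧
    ∀ t : ℝ, volume {z | z ∈ Metric.ball (0 : Cn n) R ∧ ψ z < t} = volume {z | z ∈ Ω ∧ φ z < t}

end Pluripotential

end

open Pluripotential

/-!
Write `u = u_Ω`, so that `φ = f(u)` and `Ω = {0} ∪ {u < 0}`. The argument has three parts.

**The radial calculus.** Suppose that `u` is smooth away from the origin and logarithmically
homogeneous (`LogHom`). Formally `∂∂̄ f(u) = f'(u) ∂∂̄u + f''(u) ∂u ∧ ∂̄u`, whence
`(∂∂̄φ)^k = (f')^k(u) (∂∂̄u)^k + d((f')^k)(u) ∂u ∧ ∂̄u ∧ (∂∂̄u)^(k-1)`, where for a merely convex `f`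
one reads `f'` as the right derivative and `d((f')^k)` as a Stieltjes measure on the line, lifted
to `ℂⁿ` along `u` (`liftMeas`). In top degree `(∂∂̄u)^n = 0` away from the origin
(`LogHom.formD_eq_zero`), and instead a point mass at the origin appears, proportional to the limit
of `(f')^n` at `-∞`. These currents are the `powers`. That they satisfy the defining recursion
(`RadialData.isDDbarMul`) is checked on test functions by integrating over the level sets of `u`
first: the level means satisfy the first-order relations `LogHom.hasDerivAt_formB`,
`LogHom.hasDerivAt_formC` and `LogHom.levelMean_formC_eq`, all of which are instances of the
divergence theorem `hasDerivAt_levelMean`, and two integrations by parts on the line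
(`parts_formC`, `parts_formB`) conclude. The means of `h (∂∂̄u)^k` for `k < n` decay at the origin,
which gives the local finiteness of the masses and removes the boundary terms at `-∞`, except for
the one that is the point mass.

The mean of `∂u ∧ ∂̄u ∧ (∂∂̄u)^(n-1)` over a level set does not depend on `u`: in top degree only the
values on the radial field count for `∂u` and `∂̄u`, and exchanging one factor `∂∂̄u` for another
changes the form by an exact one. The explicit case `u = log |z|` gives the value `(π/2)^n`
(`integral_formB`). If moreover `u` is plurisubharmonic, the form is nonnegative, and
`(dd^c φ)^n` is a positive measure; it is unique, since by induction on the degree the currents in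
the recursion are unique as distributions, and a complex Radon measure is determined by test
functions (`Coeff.pair_eq_of_test`). The energy is then `2^{-n} ∫ (-f) d((f')^n)`, with the point
`-∞` included, and Tonelli's theorem turns it into `2^{-n} ∫ (f')^(n+1) dt`
(`Profile.lintegral_neg`). If the point mass is not zero then `f` is unbounded below and both sides
are infinite.

**The geometry.** It has to be shown that `u_Ω` is smooth away from the origin and
plurisubharmonic. By the implicit function theorem smoothness follows if the dilations are
transversal to the boundary, that is, if `dρ(p) p > 0` for a defining function `ρ`. As `Ω` is
balanced, `G(p) = dρ(p) p ≥ 0`, and `dρ(p) (ip) = 0`. If `G(p) = 0` at a boundary point, follow the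
orbit `e^s p` by a curve `c(s)` in the boundary. Pseudoconvexity, applied to the projection of
`c(s)` to the complex tangent space, gives `(G ∘ c)' ≥ -C (G ∘ c)`, hence `G ∘ c = 0` for `s ≤ 0`
near `0`, and this forces `c(s) = e^s p` there. So the orbit remains in the boundary, by
continuation all the way to the origin, which is absurd (`DefinedBy.fderiv_self_pos`). Once `u_Ω` is
smooth it is itself a defining function, so its Levi form is nonnegative on complex tangent vectors;
the radial direction lies in the kernel of the Levi form, and the rest follows by homogeneity
(`posSemidef_hess_logGauge`).

**Symmetrization.** The volume of `{u_Ω < s}` is `e^{2ns}` times that of `Ω`, exactly as for the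
function `log (|z| / R)` on the ball. As `f` is continuous and increasing, a Schwarz symmetrization
has to be `f (log (|z| / R))` off the origin, and its value at the origin is at most `f(-∞)`
(`RadialData.of_isSchwarzSymmetrization`). The radial calculus applies to it with the same `f`, and
the energy depends on `f` and `n` only.
-/

noncomputable section

namespace Pluripotential

variable {n : ℕ}

/-! ### Wirtinger calculus -/

/-- The first-order operator `h ↦ (∂h/∂x_j + c ∂h/∂y_j) / 2`, of which `∂/∂z_j` and `∂/∂z̄_j` are
the cases `c = -i` and `c = i`. -/
def wirt (c : ℂ) (j : Fin n) (h : Cn n → ℂ) (z : Cn n) : ℂ :=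
  (fderiv ℝ h z (EuclideanSpace.single j 1)
    + c * fderiv ℝ h z (EuclideanSpace.single j Complex.I)) / 2

theorem dz_eq_wirt (j : Fin n) (h : Cn n → ℂ) : dz j h = wirt (-Complex.I) j h := by
  funext z; simp [dz, wirt, sub_eq_add_neg]

theorem dzbar_eq_wirt (j : Fin n) (h : Cn n → ℂ) : dzbar j h = wirt Complex.I j h := by
  funext z; simp [dzbar, wirt]

theorem wirt_congr {c : ℂ} {j : Fin n} {h k : Cn n → ℂ} {z : Cn n} (e : h =ᶠ[𝓝 z] k) :
    wirt c j h z = wirt c j k z := by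
  simp only [wirt, e.fderiv_eq]

theorem wirt_const (c : ℂ) (j : Fin n) (a : ℂ) (z : Cn n) : wirt c j (fun _ => a) z = 0 := by
  simp [wirt]

theorem wirt_mul {c : ℂ} {j : Fin n} {h k : Cn n → ℂ} {z : Cn n}
    (hh : DifferentiableAt ℝ h z) (hk : DifferentiableAt ℝ k z) :
    wirt c j (fun z => h z * k z) z = wirt c j h z * k z + h z * wirt c j k z := by
  simp only [wirt, fderiv_fun_mul hh hk, add_apply,
    smul_apply, smul_eq_mul]
  ring

theorem wirt_sum {ι : Type*} {s : Finset ι} {c : ℂ} {j : Fin n} {h : ι → Cn n → ℂ} {z : Cn n}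
    (hh : ∀ i ∈ s, DifferentiableAt ℝ (h i) z) :
    wirt c j (fun z => ∑ i ∈ s, h i z) z = ∑ i ∈ s, wirt c j (h i) z := by
  simp only [wirt, fderiv_fun_sum hh, sum_apply]
  rw [Finset.mul_sum, ← Finset.sum_add_distrib, Finset.sum_div]

theorem wirt_prod {ι : Type*} [DecidableEq ι] {s : Finset ι} {c : ℂ} {j : Fin n}
    {h : ι → Cn n → ℂ} {z : Cn n} (hh : ∀ i ∈ s, DifferentiableAt ℝ (h i) z) :
    wirt c j (fun z => ∏ i ∈ s, h i z) z
      = ∑ i ∈ s, wirt c j (h i) z * ∏ l ∈ s.erase i, h l z := by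
  have := (HasFDerivAt.finsetProd (u := s) (g := h) (x := z)
    (g' := fun i => fderiv ℝ (h i) z) (fun i hi => (hh i hi).hasFDerivAt)).fderiv
  simp only [wirt, this, sum_apply, smul_apply,
    smul_eq_mul]
  rw [Finset.mul_sum, ← Finset.sum_add_distrib, Finset.sum_div]
  refine Finset.sum_congr rfl fun i _ => ?_
  ring

theorem contDiffAt_wirt {c : ℂ} {j : Fin n} {h : Cn n → ℂ} {z : Cn n} (hh : ContDiffAt ℝ ∞ h z) :
    ContDiffAt ℝ ∞ (wirt c j h) z := by
  have := hh.fderiv_right (m := ∞) (by simp)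
  unfold wirt
  fun_prop

theorem wirt_comm {c c' : ℂ} {i j : Fin n} {h : Cn n → ℂ} {z : Cn n} (hh : ContDiffAt ℝ ∞ h z) :
    wirt c i (wirt c' j h) z = wirt c' j (wirt c i h) z := by
  have hd : DifferentiableAt ℝ (fderiv ℝ h) z :=
    (hh.fderiv_right (m := ∞) (by simp)).differentiableAt (by simp)
  have hs : IsSymmSndFDerivAt ℝ h z :=
    hh.isSymmSndFDerivAt (by
      rw [minSmoothness_of_isRCLikeNormedField]; exact WithTop.coe_le_coe.2 le_top)
  have key : ∀ (c : ℂ) (j : Fin n) (v : Cn n), fderiv ℝ (wirt c j h) z v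
      = (fderiv ℝ (fderiv ℝ h) z v (EuclideanSpace.single j 1)
        + c * fderiv ℝ (fderiv ℝ h) z v (EuclideanSpace.single j Complex.I)) / 2 := by
    intro c j v
    have h1 : ∀ w : Cn n, HasFDerivAt (fun x => fderiv ℝ h x w)
        ((fderiv ℝ (fderiv ℝ h) z).flip w) z := fun w => by
      simpa using hd.hasFDerivAt.clm_apply (hasFDerivAt_const w z)
    have h2 := ((h1 (EuclideanSpace.single j 1)).add
      ((h1 (EuclideanSpace.single j Complex.I)).const_mul c)).mul_const (1 / 2 : ℂ)
    have e : wirt c j h = fun x => (fderiv ℝ h x (EuclideanSpace.single j 1)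
      + c * fderiv ℝ h x (EuclideanSpace.single j Complex.I)) * (1 / 2 : ℂ) := by
      funext x; simp only [wirt]; ring
    rw [e]
    erw [h2.fderiv]
    simp
    ring
  have hw : ∀ (c : ℂ) (j : Fin n) (k : Cn n → ℂ), wirt c j k z = (fderiv ℝ k z
    (EuclideanSpace.single j 1) + c * fderiv ℝ k z (EuclideanSpace.single j Complex.I)) / 2 :=
    fun _ _ _ => rfl
  rw [hw c i (wirt c' j h), hw c' j (wirt c i h)]
  simp only [key]
  rw [hs.eq (EuclideanSpace.single i 1), hs.eq (EuclideanSpace.single i 1),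
    hs.eq (EuclideanSpace.single i Complex.I) (EuclideanSpace.single j 1),
    hs.eq (EuclideanSpace.single i Complex.I) (EuclideanSpace.single j Complex.I)]
  ring

theorem conj_wirt {c : ℂ} {j : Fin n} {h : Cn n → ℂ} {z : Cn n} :
    (starRingEnd ℂ) (wirt c j h z)
      = wirt ((starRingEnd ℂ) c) j (fun z => (starRingEnd ℂ) (h z)) z := by
  have key : ∀ v, fderiv ℝ (fun z => (starRingEnd ℂ) (h z)) z v
      = (starRingEnd ℂ) (fderiv ℝ h z v) := by
    intro v
    have := (Complex.conjCLE).comp_fderiv (f := h) (x := z)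
    have e : (Complex.conjCLE ∘ h) = fun z => (starRingEnd ℂ) (h z) := by ext; simp
    rw [e] at this
    rw [this]; simp
  simp [wirt, key, map_ofNat]

/-- The `ℂ`-linear part of an `ℝ`-linear map in the direction `w`, in terms of its Wirtinger
coefficients. -/
theorem sum_mul_wirt (h : Cn n → ℂ) (z w : Cn n) :
    ∑ j, w j * wirt (-Complex.I) j h z
      = (fderiv ℝ h z w - Complex.I * fderiv ℝ h z (Complex.I • w)) / 2 := by
  set L := fderiv ℝ h z
  have hw : w = ∑ j, ((w j).re • EuclideanSpace.single j (1 : ℂ)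
      + (w j).im • EuclideanSpace.single j Complex.I) := by
    ext i
    simp [Pi.single_apply, Finset.sum_add_distrib, Complex.re_add_im]
  have hIw : Complex.I • w = ∑ j, ((w j).re • EuclideanSpace.single j Complex.I
      - (w j).im • EuclideanSpace.single j (1 : ℂ)) := by
    ext i
    simp [Pi.single_apply]
    apply Complex.ext <;> simp
  have h1 : L w = ∑ j, ((w j).re * L (EuclideanSpace.single j (1 : ℂ))
      + (w j).im * L (EuclideanSpace.single j Complex.I)) := by
    conv_lhs => rw [hw]
    simp
  have h2 : L (Complex.I • w) = ∑ j, ((w j).re * L (EuclideanSpace.single j Complex.I)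
      - (w j).im * L (EuclideanSpace.single j (1 : ℂ))) := by
    rw [hIw]
    simp
  rw [h1, h2, Finset.mul_sum, ← Finset.sum_sub_distrib, Finset.sum_div]
  refine Finset.sum_congr rfl fun j _ => ?_
  simp only [wirt]
  conv_lhs => rw [← Complex.re_add_im (w j)]
  linear_combination (-(w j).im * L (EuclideanSpace.single j Complex.I) / 2) * Complex.I_mul_I

theorem sum_conj_mul_wirt (h : Cn n → ℂ) (z w : Cn n) :
    ∑ j, (starRingEnd ℂ) (w j) * wirt Complex.I j h z
      = (fderiv ℝ h z w + Complex.I * fderiv ℝ h z (Complex.I • w)) / 2 := by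
  have key := congrArg (starRingEnd ℂ) (sum_mul_wirt (fun z => (starRingEnd ℂ) (h z)) z w)
  have e : ∀ v, (starRingEnd ℂ) (fderiv ℝ (fun z => (starRingEnd ℂ) (h z)) z v)
      = fderiv ℝ h z v := by
    intro v
    have := (Complex.conjCLE).comp_fderiv (f := h) (x := z)
    have e : (Complex.conjCLE ∘ h) = fun z => (starRingEnd ℂ) (h z) := by ext; simp
    rw [e] at this
    rw [this]; simp
  simp only [map_sum, map_mul, conj_wirt, map_neg, Complex.conj_I, neg_neg, Complex.conj_conj,
    map_div₀, map_sub, e, map_ofNat, sub_neg_eq_add, neg_mul] at key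
  rw [key]

/-! ### Antisymmetrization -/

open Equiv

theorem sum_sign_mul_eq_zero {k : ℕ} {a b : Fin k} (hab : a ≠ b) {E : Perm (Fin k) → ℂ}
    (hE : ∀ σ, E (σ * swap a b) = E σ) : ∑ σ : Perm (Fin k), ((Perm.sign σ : ℤ) : ℂ) * E σ = 0 := by
  have h := Equiv.sum_comp (Equiv.mulRight (swap a b))
    (fun σ : Perm (Fin k) => ((Perm.sign σ : ℤ) : ℂ) * E σ)
  simp only [Equiv.coe_mulRight, hE, Perm.sign_mul, Perm.sign_swap hab] at h
  have h2 : ∑ σ : Perm (Fin k), ((Perm.sign σ : ℤ) : ℂ) * E σ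
      = -∑ σ : Perm (Fin k), ((Perm.sign σ : ℤ) : ℂ) * E σ := by
    conv_lhs => rw [← h]
    rw [← Finset.sum_neg_distrib]
    refine Finset.sum_congr rfl fun σ _ => ?_
    push_cast; ring
  exact self_eq_neg.mp h2

/-- The double antisymmetrization `∑_{σ, τ} sgn σ sgn τ E(σ, τ)`; with `E` the coefficient
`E(I ∘ σ, J ∘ τ)`, it is the coefficient of a form of bidegree `(k, k)` at `dz_I ∧ dz̄_J`. -/
def altSum {k : ℕ} (E : Perm (Fin k) → Perm (Fin k) → ℂ) : ℂ :=
  ∑ σ : Perm (Fin k), ∑ τ : Perm (Fin k),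
    ((Perm.sign σ : ℤ) : ℂ) * (((Perm.sign τ : ℤ) : ℂ) * E σ τ)

theorem altSum_comm {k : ℕ} (E : Perm (Fin k) → Perm (Fin k) → ℂ) :
    altSum E = altSum (fun σ τ => E τ σ) := by
  unfold altSum
  rw [Finset.sum_comm]
  refine Finset.sum_congr rfl fun σ _ => Finset.sum_congr rfl fun τ _ => ?_
  ring

theorem altSum_eq_sum_right {k : ℕ} (E : Perm (Fin k) → Perm (Fin k) → ℂ) :
    altSum E = ∑ σ : Perm (Fin k), ((Perm.sign σ : ℤ) : ℂ) *
      ∑ τ : Perm (Fin k), ((Perm.sign τ : ℤ) : ℂ) * E σ τ := by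
  simp only [altSum, Finset.mul_sum]

theorem altSum_eq_zero_right {k : ℕ} {E : Perm (Fin k) → Perm (Fin k) → ℂ}
    (h : ∀ σ, ∑ τ : Perm (Fin k), ((Perm.sign τ : ℤ) : ℂ) * E σ τ = 0) : altSum E = 0 := by
  simp [altSum_eq_sum_right, h]

theorem altSum_eq_zero_left {k : ℕ} {E : Perm (Fin k) → Perm (Fin k) → ℂ}
    (h : ∀ τ, ∑ σ : Perm (Fin k), ((Perm.sign σ : ℤ) : ℂ) * E σ τ = 0) : altSum E = 0 := by
  rw [altSum_comm]; exact altSum_eq_zero_right h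

theorem altSum_add {k : ℕ} (E E' : Perm (Fin k) → Perm (Fin k) → ℂ) :
    altSum (fun σ τ => E σ τ + E' σ τ) = altSum E + altSum E' := by
  simp only [altSum, mul_add, Finset.sum_add_distrib]

theorem altSum_sub {k : ℕ} (E E' : Perm (Fin k) → Perm (Fin k) → ℂ) :
    altSum (fun σ τ => E σ τ - E' σ τ) = altSum E - altSum E' := by
  simp only [altSum, mul_sub, Finset.sum_sub_distrib]

theorem altSum_const_mul {k : ℕ} (a : ℂ) (E : Perm (Fin k) → Perm (Fin k) → ℂ) :
    altSum (fun σ τ => a * E σ τ) = a * altSum E := by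
  simp only [altSum, Finset.mul_sum]
  refine Finset.sum_congr rfl fun σ _ => Finset.sum_congr rfl fun τ _ => ?_
  ring

theorem altSum_swap_right {k : ℕ} {a b : Fin k} (hab : a ≠ b)
    (E : Perm (Fin k) → Perm (Fin k) → ℂ) :
    altSum (fun σ τ => E σ (τ * swap a b)) = -altSum E := by
  rw [altSum_eq_sum_right, altSum_eq_sum_right, ← Finset.sum_neg_distrib]
  refine Finset.sum_congr rfl fun σ _ => ?_
  rw [← mul_neg, ← Finset.sum_neg_distrib]
  congr 1
  have h := Equiv.sum_comp (Equiv.mulRight (swap a b))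
    (fun τ : Perm (Fin k) => ((Perm.sign τ : ℤ) : ℂ) * E σ τ)
  rw [Finset.sum_neg_distrib, ← h, ← Finset.sum_neg_distrib]
  refine Finset.sum_congr rfl fun τ _ => ?_
  simp only [Equiv.coe_mulRight, Perm.sign_mul, Perm.sign_swap hab]
  push_cast; ring

/-- Laplace expansion of a signed sum over permutations of `{0, …, k}` by the value at `0`. -/
theorem sum_sign_succ {k : ℕ} (Y : Perm (Fin (k + 1)) → ℂ) :
    ∑ σ : Perm (Fin (k + 1)), ((Perm.sign σ : ℤ) : ℂ) * Y σ
      = ∑ a : Fin (k + 1), (-1 : ℂ) ^ (a : ℕ) * ∑ e : Perm (Fin k), ((Perm.sign e : ℤ) : ℂ) *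
        Y (a.cycleRange.symm * Perm.decomposeFin.symm (0, e)) := by
  have hb : Function.Bijective (fun x : Fin (k + 1) × Perm (Fin k) =>
      (x.1.cycleRange.symm * Perm.decomposeFin.symm (0, x.2) : Perm (Fin (k + 1)))) := by
    rw [Fintype.bijective_iff_injective_and_card]
    refine ⟨?_, by simp [Fintype.card_perm, Nat.factorial_succ]⟩
    rintro ⟨a, e⟩ ⟨a', e'⟩ h
    have h0 := congrArg (fun σ : Perm (Fin (k + 1)) => σ 0) h
    simp at h0
    subst h0
    simpa using h
  rw [← hb.sum_comp (fun σ => ((Perm.sign σ : ℤ) : ℂ) * Y σ), Fintype.sum_prod_type]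
  refine Finset.sum_congr rfl fun a _ => ?_
  rw [Finset.mul_sum]
  refine Finset.sum_congr rfl fun e _ => ?_
  simp only [Perm.sign_mul, Perm.sign_symm, Fin.sign_cycleRange,
    Perm.decomposeFin.symm_sign]
  push_cast
  simp
  ring

theorem cycleRange_symm_mul_zero {k : ℕ} (a : Fin (k + 1)) (e : Perm (Fin k)) :
    (a.cycleRange.symm * Perm.decomposeFin.symm (0, e) : Perm (Fin (k + 1))) 0 = a := by
  simp

theorem cycleRange_symm_mul_succ {k : ℕ} (a : Fin (k + 1)) (e : Perm (Fin k)) (i : Fin k) :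
    (a.cycleRange.symm * Perm.decomposeFin.symm (0, e) : Perm (Fin (k + 1))) i.succ
      = a.succAbove (e i) := by
  simp [Fin.cycleRange_symm_succ]

/-- The coefficients of `∂∂̄χ ∧ X` in terms of those of `X`. -/
theorem sum_sum_altSum {k : ℕ} (I J : Fin (k + 1) → Fin n) (c : Fin n → Fin n → ℂ)
    (X : (Fin k → Fin n) → (Fin k → Fin n) → ℂ) :
    ∑ a : Fin (k + 1), ∑ b : Fin (k + 1), (-1 : ℂ) ^ ((a : ℕ) + (b : ℕ)) *
      (c (I a) (J b) * altSum (fun σ τ => X (fun i => I (a.succAbove (σ i)))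
        (fun i => J (b.succAbove (τ i)))))
      = altSum (fun σ τ => c (I (σ 0)) (J (τ 0)) * X (fun i => I (σ i.succ))
        (fun i => J (τ i.succ))) := by
  rw [altSum_eq_sum_right, sum_sign_succ]
  refine Finset.sum_congr rfl fun a _ => ?_
  simp only [sum_sign_succ (k := k) (Y := fun τ => _), cycleRange_symm_mul_zero,
    cycleRange_symm_mul_succ, altSum_eq_sum_right, Finset.mul_sum]
  rw [Finset.sum_comm]
  refine Finset.sum_congr rfl fun σ _ => Finset.sum_congr rfl fun b _ =>
    Finset.sum_congr rfl fun τ _ => ?_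
  ring

/-- The product of second derivatives, one factor of which is differentiated once more, vanishes
after antisymmetrization in the derivatives of the same type. This is the closedness of
`(∂∂̄u)^k`, and of its polarizations. -/
theorem sum_sign_mul_wirt_prod {k K : ℕ} (c : ℂ) (I : Fin K → Fin n) (a : Fin K)
    (s : Finset (Fin k)) (e : Fin k → Fin K) (he : Function.Injective e) (hea : ∀ i ∈ s, e i ≠ a)
    (v : Fin k → Cn n → ℂ) (z : Cn n) (hv : ∀ i ∈ s, ContDiffAt ℝ ∞ (v i) z)
    (X : Perm (Fin K) → ℂ) (hX : ∀ i ∈ s, ∀ σ, X (σ * swap a (e i)) = X σ) :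
    ∑ σ : Perm (Fin K), ((Perm.sign σ : ℤ) : ℂ) * (X σ * wirt c (I (σ a))
      (fun z => ∏ i ∈ s, wirt c (I (σ (e i))) (v i) z) z) = 0 := by
  have h1 : ∀ σ : Perm (Fin K), wirt c (I (σ a))
      (fun z => ∏ i ∈ s, wirt c (I (σ (e i))) (v i) z) z
      = ∑ i ∈ s, wirt c (I (σ a)) (wirt c (I (σ (e i))) (v i)) z
        * ∏ l ∈ s.erase i, wirt c (I (σ (e l))) (v l) z := fun σ =>
    wirt_prod fun i hi => (contDiffAt_wirt (hv i hi)).differentiableAt (by simp)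
  simp only [h1, Finset.mul_sum]
  rw [Finset.sum_comm]
  refine Finset.sum_eq_zero fun i hi => ?_
  refine sum_sign_mul_eq_zero (Ne.symm (hea i hi)) fun σ => ?_
  simp only [hX i hi, Perm.mul_apply, swap_apply_left, swap_apply_right]
  rw [wirt_comm (hv i hi)]
  congr 2
  refine Finset.prod_congr rfl fun l hl => ?_
  rw [swap_apply_of_ne_of_ne (hea l (Finset.mem_of_mem_erase hl))
    (fun h => (Finset.ne_of_mem_erase hl) (he h))]

/-! ### Polar coordinates adapted to a logarithmically homogeneous function -/

instance instNontrivialCn [NeZero n] : Nontrivial (Cn n) := by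
  refine ⟨EuclideanSpace.single 0 1, 0, fun h => ?_⟩
  simpa using congrArg (fun z : Cn n => z 0) h

theorem finrank_Cn (n : ℕ) : Module.finrank ℝ (Cn n) = 2 * n := by
  have := Module.finrank_mul_finrank ℝ ℂ (Cn n)
  simp at this
  omega

/-- `u` is smooth away from the origin and logarithmically homogeneous there. -/
structure LogHom (u : Cn n → ℝ) : Prop where
  smooth : ContDiffOn ℝ ∞ u {0}ᶜ
  hom : ∀ (a : ℂ) (z : Cn n), a ≠ 0 → z ≠ 0 → u (a • z) = Real.log ‖a‖ + u z

/-- The unit sphere of `ℂⁿ`. -/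
abbrev Sph (n : ℕ) : Type := Metric.sphere (0 : Cn n) 1

/-- The point of the ray through `ζ` at which `u` takes the value `t`. -/
def polarPt (u : Cn n → ℝ) (t : ℝ) (ζ : Sph n) : Cn n := Real.exp (t - u ζ) • (ζ : Cn n)

/-- The surface measure of the unit sphere. -/
abbrev sphMeas (n : ℕ) : Measure (Sph n) := (volume : Measure (Cn n)).toSphere

theorem sph_ne_zero (ζ : Sph n) : (ζ : Cn n) ≠ 0 := fun h => by
  have := ζ.2
  simp [h] at this

theorem polarPt_ne_zero (u : Cn n → ℝ) (t : ℝ) (ζ : Sph n) : polarPt u t ζ ≠ 0 :=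
  smul_ne_zero (Real.exp_pos _).ne' (sph_ne_zero ζ)

/-- The derivative in `t` of `∫_{u < t} h`, that is, the integral of `h` over the level set
`{u = t}` against the measure `dλ / du`. -/
def levelMean (u : Cn n → ℝ) (h : Cn n → ℂ) (t : ℝ) : ℂ :=
  ∫ ζ, (Real.exp (2 * n * (t - u ζ)) : ℂ) * h (polarPt u t ζ) ∂(sphMeas n)

/-- The lift `u^*M` to `ℂⁿ ∖ {0}` of a measure `M` on the line, normalized so that Lebesgue measure
lifts to Lebesgue measure. -/
def liftMeas (u : Cn n → ℝ) (M : Measure ℝ) : Measure (Cn n) :=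
  Measure.map (fun x : ℝ × Sph n => polarPt u x.1 x.2)
    ((M.prod (sphMeas n)).withDensity fun x => ENNReal.ofReal (Real.exp (2 * n * (x.1 - u x.2))))

namespace LogHom

variable {u : Cn n → ℝ}

theorem hom_real (hu : LogHom u) {r : ℝ} (hr : 0 < r) {z : Cn n} (hz : z ≠ 0) :
    u (r • z) = Real.log r + u z := by
  have := hu.hom (r : ℂ) z (by exact_mod_cast hr.ne') hz
  rw [Complex.norm_real, Real.norm_of_nonneg hr.le] at this
  rw [← this]
  congr 1

theorem continuousOn (hu : LogHom u) : ContinuousOn u {0}ᶜ := hu.smooth.continuousOn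

theorem continuous_sph (hu : LogHom u) : Continuous fun ζ : Sph n => u ζ :=
  hu.continuousOn.comp_continuous continuous_subtype_val fun ζ => sph_ne_zero ζ

theorem apply_polarPt (hu : LogHom u) (t : ℝ) (ζ : Sph n) : u (polarPt u t ζ) = t := by
  rw [polarPt, hu.hom_real (Real.exp_pos _) (sph_ne_zero ζ), Real.log_exp]; ring

theorem continuous_polarPt (hu : LogHom u) :
    Continuous fun x : ℝ × Sph n => polarPt u x.1 x.2 := by
  have h3 : Continuous fun x : ℝ × Sph n => u x.2 := hu.continuous_sph.comp continuous_snd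
  exact (Real.continuous_exp.comp (continuous_fst.sub h3)).smul
    (continuous_subtype_val.comp continuous_snd)

theorem contDiffAt (hu : LogHom u) {z : Cn n} (hz : z ≠ 0) : ContDiffAt ℝ ∞ u z :=
  hu.smooth.contDiffAt (isOpen_compl_singleton.mem_nhds hz)

theorem exists_bound (hu : LogHom u) : ∃ R, ∀ z, z ≠ 0 → |u z - Real.log ‖z‖| ≤ R := by
  obtain ⟨R, hR⟩ := (isCompact_univ (X := Sph n)).exists_bound_of_continuousOn
    hu.continuous_sph.continuousOn
  refine ⟨R, fun z hz => ?_⟩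
  have hz' : 0 < ‖z‖ := norm_pos_iff.2 hz
  have h1 : ‖z‖⁻¹ • z ∈ Metric.sphere (0 : Cn n) 1 := by
    simp [norm_smul, hz'.ne']
  have h2 := hR ⟨_, h1⟩ (Set.mem_univ _)
  have h3 := hu.hom_real (inv_pos.2 hz') hz
  rw [Real.log_inv] at h3
  simp only at h2
  rw [h3] at h2
  rw [Real.norm_eq_abs] at h2
  convert h2 using 2
  ring

theorem continuous_integrand (hu : LogHom u) {h : Cn n → ℂ} (hh : ContinuousOn h {0}ᶜ) :
    Continuous fun x : ℝ × Sph n =>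
      (Real.exp (2 * n * (x.1 - u x.2)) : ℂ) * h (polarPt u x.1 x.2) := by
  have h1 := hu.continuous_sph
  have h2 : Continuous fun x : ℝ × Sph n => h (polarPt u x.1 x.2) :=
    hh.comp_continuous hu.continuous_polarPt fun x => polarPt_ne_zero u _ _
  have h3 : Continuous fun x : ℝ × Sph n => u x.2 := h1.comp continuous_snd
  exact (Complex.continuous_ofReal.comp
    (Real.continuous_exp.comp (continuous_const.mul (continuous_fst.sub h3)))).mul h2

theorem continuous_levelMean (hu : LogHom u) {h : Cn n → ℂ} (hh : ContinuousOn h {0}ᶜ) :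
    Continuous (levelMean u h) := by
  have := continuous_parametric_integral_of_continuous (μ := sphMeas n)
    (f := fun t (ζ : Sph n) => (Real.exp (2 * n * (t - u ζ)) : ℂ) * h (polarPt u t ζ))
    (hu.continuous_integrand hh) isCompact_univ
  simp only [Measure.restrict_univ] at this
  exact this

theorem integrable_sph (hu : LogHom u) {h : Cn n → ℂ} (hh : ContinuousOn h {0}ᶜ) (t : ℝ) :
    Integrable (fun ζ : Sph n => (Real.exp (2 * n * (t - u ζ)) : ℂ) * h (polarPt u t ζ))
      (sphMeas n) := by
  have : Continuous (fun ζ : Sph n => (Real.exp (2 * n * (t - u ζ)) : ℂ) * h (polarPt u t ζ)) :=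
    (hu.continuous_integrand hh).comp (f := fun ζ : Sph n => (t, ζ)) (by fun_prop)
  exact this.integrable_of_hasCompactSupport (HasCompactSupport.of_compactSpace _)

theorem measurable_dens (hu : LogHom u) :
    Measurable fun x : ℝ × Sph n => ENNReal.ofReal (Real.exp (2 * n * (x.1 - u x.2))) := by
  have h3 : Continuous fun x : ℝ × Sph n => u x.2 := hu.continuous_sph.comp continuous_snd
  exact ENNReal.measurable_ofReal.comp
    (Real.continuous_exp.comp (continuous_const.mul (continuous_fst.sub h3))).measurable

theorem lintegral_liftMeas (hu : LogHom u) (M : Measure ℝ) [SFinite M] {h : Cn n → ℝ≥0∞}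
    (hh : Measurable h) : ∫⁻ z, h z ∂(liftMeas u M)
      = ∫⁻ t, ∫⁻ ζ, ENNReal.ofReal (Real.exp (2 * n * (t - u ζ))) * h (polarPt u t ζ)
        ∂(sphMeas n) ∂M := by
  rw [liftMeas, lintegral_map hh hu.continuous_polarPt.measurable,
    lintegral_withDensity_eq_lintegral_mul _ hu.measurable_dens
      (g := fun x => h (polarPt u x.1 x.2)) (hh.comp hu.continuous_polarPt.measurable),
    lintegral_prod]
  · rfl
  · exact (hu.measurable_dens.mul (hh.comp hu.continuous_polarPt.measurable)).aemeasurable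

theorem integral_liftMeas (hu : LogHom u) (M : Measure ℝ) [SFinite M] {h : Cn n → ℂ}
    (hh : Integrable h (liftMeas u M)) :
    ∫ z, h z ∂(liftMeas u M) = ∫ t, levelMean u h t ∂M := by
  have hm := hu.continuous_polarPt.measurable
  have hh' := hh
  rw [liftMeas, integrable_map_measure hh.1 hm.aemeasurable,
    integrable_withDensity_iff_integrable_smul' hu.measurable_dens (by simp)] at hh'
  rw [liftMeas, integral_map hm.aemeasurable hh.1,
    integral_withDensity_eq_integral_toReal_smul hu.measurable_dens (by simp), integral_prod]
  · simp only [levelMean, ENNReal.toReal_ofReal (Real.exp_pos _).le, Complex.real_smul]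
  · exact hh'

theorem integrable_liftMeas_iff (hu : LogHom u) (M : Measure ℝ) {h : Cn n → ℂ}
    (hh : AEStronglyMeasurable h (liftMeas u M)) : Integrable h (liftMeas u M) ↔
    Integrable (fun x : ℝ × Sph n => (Real.exp (2 * n * (x.1 - u x.2)) : ℂ) *
      h (polarPt u x.1 x.2)) (M.prod (sphMeas n)) := by
  have hm := hu.continuous_polarPt.measurable
  rw [liftMeas, integrable_map_measure hh hm.aemeasurable,
    integrable_withDensity_iff_integrable_smul' hu.measurable_dens (by simp)]
  simp only [ENNReal.toReal_ofReal (Real.exp_pos _).le, Complex.real_smul, Function.comp]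

theorem lintegral_polar [NeZero n] {h : Cn n → ℝ≥0∞} (hh : Measurable h) :
    ∫⁻ z, h z = ∫⁻ ζ : Sph n, (∫⁻ r in Set.Ioi (0 : ℝ),
      ENNReal.ofReal (r ^ (2 * n - 1)) * h (r • (ζ : Cn n))) ∂(sphMeas n) := by
  have hp := (volume : Measure (Cn n)).measurePreserving_homeomorphUnitSphereProd
  rw [← setLIntegral_univ, ← Set.union_compl_self {(0 : Cn n)}, lintegral_union
    (MeasurableSet.singleton _).compl disjoint_compl_right]
  have h0 : ∫⁻ z in {(0 : Cn n)}, h z = 0 := by simp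
  rw [h0, zero_add, ← lintegral_subtype_comap (MeasurableSet.singleton _).compl]
  have h1 := hp.lintegral_comp_emb (Homeomorph.measurableEmbedding _)
    (fun x => h (((homeomorphUnitSphereProd (Cn n)).symm x : ({0}ᶜ : Set (Cn n))) : Cn n))
  simp only [Homeomorph.symm_apply_apply] at h1
  simp only [homeomorphUnitSphereProd_symm_apply_coe] at h1
  have hm : Measurable fun x : Sph n × Set.Ioi (0 : ℝ) => h ((x.2 : ℝ) • (x.1 : Cn n)) :=
    hh.comp (by fun_prop)
  rw [h1, lintegral_prod _ hm.aemeasurable]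
  refine lintegral_congr fun ζ => ?_
  rw [Measure.volumeIoiPow, lintegral_withDensity_eq_lintegral_mul _ (by fun_prop)
    (g := fun r : Set.Ioi (0 : ℝ) => h ((r : ℝ) • (ζ : Cn n))) (hh.comp (by fun_prop)), finrank_Cn,
    ← lintegral_subtype_comap measurableSet_Ioi]
  rfl

theorem lintegral_Ioi_exp (a : ℝ) (h : ℝ → ℝ≥0∞) : ∫⁻ r in Set.Ioi (0 : ℝ), h r
    = ∫⁻ t, ENNReal.ofReal (Real.exp (t - a)) * h (Real.exp (t - a)) := by
  have := lintegral_image_eq_lintegral_abs_deriv_mul (s := Set.univ)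
    (f := fun t => Real.exp (t - a)) (f' := fun t => Real.exp (t - a)) MeasurableSet.univ
    (fun x _ => by
      have := ((hasDerivAt_id x).sub_const a).exp
      simpa using this)
    (fun x _ y _ hxy => by simpa using hxy) h
  have e : (fun t => Real.exp (t - a)) '' Set.univ = Set.Ioi 0 := by
    ext y
    constructor
    · rintro ⟨t, _, rfl⟩; exact Real.exp_pos _
    · intro hy
      exact ⟨Real.log y + a, trivial, by simp [Real.exp_log hy]⟩
  rw [e] at this
  simpa [abs_of_pos (Real.exp_pos _)] using this

theorem liftMeas_volume [NeZero n] (hu : LogHom u) : liftMeas u volume = volume := by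
  have hn : 1 ≤ n := NeZero.one_le
  refine Measure.ext fun s hs => ?_
  have hi : Measurable (s.indicator (1 : Cn n → ℝ≥0∞)) := measurable_one.indicator hs
  rw [← lintegral_indicator_one hs, ← lintegral_indicator_one hs, hu.lintegral_liftMeas _ hi,
    lintegral_polar hi, lintegral_lintegral_swap]
  · refine lintegral_congr fun ζ => ?_
    rw [lintegral_Ioi_exp (u ζ)]
    refine lintegral_congr fun t => ?_
    rw [← mul_assoc, ← ENNReal.ofReal_mul (Real.exp_pos _).le, polarPt]
    congr 2
    rw [← Real.exp_nat_mul, ← Real.exp_add]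
    congr 1
    push_cast [Nat.cast_sub (show 1 ≤ 2 * n by omega)]
    ring
  · exact (hu.measurable_dens.mul (hi.comp hu.continuous_polarPt.measurable)).aemeasurable

end LogHom

/-! ### Differentiation of level means -/

theorem integral_wirt_eq_zero {k : Cn n → ℂ} (hk : ContDiff ℝ 1 k) (hs : HasCompactSupport k)
    (c : ℂ) (j : Fin n) : ∫ z, wirt c j k z = 0 := by
  have hi : ∀ v, Integrable fun z => fderiv ℝ k z v := fun v =>
    ((hk.continuous_fderiv (by simp)).clm_apply continuous_const).integrable_of_hasCompactSupport
      (hs.fderiv_apply ℝ v)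
  have h0 : ∀ v, ∫ z, fderiv ℝ k z v = 0 := by
    intro v
    have := integral_mul_fderiv_eq_neg_fderiv_mul_of_integrable (μ := (volume : Measure (Cn n)))
      (f := fun _ => (1 : ℂ)) (g := k) (v := v) (by simp) (by simpa using hi v)
      (by simpa using hk.continuous.integrable_of_hasCompactSupport hs)
      (fun _ _ => by fun_prop) (fun _ _ => (hk.differentiable (by simp)).differentiableAt)
    simpa using this
  simp only [wirt]
  rw [integral_div, integral_add (hi _) ((hi _).const_mul c), integral_const_mul, h0, h0]
  simp

/-- The lemma of du Bois-Reymond: if `Q` is the weak derivative of `P`, and both are continuous,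
it is the derivative. -/
theorem hasDerivAt_of_weak {P Q : ℝ → ℂ} (hP : Continuous P) (hQ : Continuous Q)
    (h : ∀ g : ℝ → ℝ, ContDiff ℝ ∞ g → HasCompactSupport g →
      ∫ t, (((deriv g t : ℝ) : ℂ) * P t + (g t : ℂ) * Q t) = 0) (t : ℝ) : HasDerivAt P (Q t) t := by
  set R : ℝ → ℂ := fun x => ∫ y in (0 : ℝ)..x, Q y
  have hR : ∀ x, HasDerivAt R (Q x) x := fun x =>
    intervalIntegral.integral_hasDerivAt_right (hQ.intervalIntegrable _ _)
      hQ.stronglyMeasurable.stronglyMeasurableAtFilter hQ.continuousAt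
  have hRc : Continuous R := continuous_iff_continuousAt.2 fun x => (hR x).continuousAt
  have hW : Continuous fun x => P x - R x := hP.sub hRc
  -- `P - R` is orthogonal to every derivative of a test function
  have h1 : ∀ g : ℝ → ℝ, ContDiff ℝ ∞ g → HasCompactSupport g →
      ∫ x, ((deriv g x : ℝ) : ℂ) * (P x - R x) = 0 := by
    intro g hg hgs
    have hg' : ∀ x, HasDerivAt (fun x => (g x : ℂ)) ((deriv g x : ℝ) : ℂ) x := fun x =>
      ((hg.differentiable (by simp)).differentiableAt.hasDerivAt).ofReal_comp
    have hdc : Continuous (deriv g) := hg.continuous_deriv (by simp)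
    have i1 : Integrable fun x => ((deriv g x : ℝ) : ℂ) * P x :=
      ((Complex.continuous_ofReal.comp hdc).mul hP).integrable_of_hasCompactSupport
        ((hgs.deriv.comp_left (g := ((↑) : ℝ → ℂ)) rfl).mul_right)
    have i2 : Integrable fun x => ((deriv g x : ℝ) : ℂ) * R x :=
      ((Complex.continuous_ofReal.comp hdc).mul hRc).integrable_of_hasCompactSupport
        ((hgs.deriv.comp_left (g := ((↑) : ℝ → ℂ)) rfl).mul_right)
    have i3 : Integrable fun x => (g x : ℂ) * Q x :=
      ((Complex.continuous_ofReal.comp hg.continuous).mul hQ).integrable_of_hasCompactSupport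
        ((hgs.comp_left (g := ((↑) : ℝ → ℂ)) rfl).mul_right)
    have i4 : Integrable fun x => (g x : ℂ) * R x :=
      ((Complex.continuous_ofReal.comp hg.continuous).mul hRc).integrable_of_hasCompactSupport
        ((hgs.comp_left (g := ((↑) : ℝ → ℂ)) rfl).mul_right)
    have e1 := h g hg hgs
    have e2 : ∫ x, (((deriv g x : ℝ) : ℂ) * R x + (g x : ℂ) * Q x) = 0 :=
      integral_eq_zero_of_hasDerivAt_of_integrable (fun x => (hg' x).mul (hR x)) (i2.add i3) i4
    rw [integral_add i1 i3] at e1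
    rw [integral_add i2 i3] at e2
    simp only [mul_sub]
    rw [integral_sub i1 i2]
    linear_combination e1 - e2
  -- the test functions `x ↦ ∫_{x - s}^x η` show that `P - R` is invariant under translations
  have h2 : ∀ s x, P (x + s) - R (x + s) = P x - R x := by
    intro s
    have key : ∀ η : ℝ → ℝ, ContDiff ℝ ∞ η → HasCompactSupport η →
        ∫ x, η x • ((P (x + s) - R (x + s)) - (P x - R x)) = 0 := by
      intro η hη hηs
      set H : ℝ → ℝ := fun x => ∫ y in (0 : ℝ)..x, η y
      have hH : ∀ x, HasDerivAt H (η x) x := fun x =>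
        intervalIntegral.integral_hasDerivAt_right (hη.continuous.intervalIntegrable _ _)
          hη.continuous.stronglyMeasurable.stronglyMeasurableAtFilter hη.continuous.continuousAt
      have hHd : deriv H = η := funext fun x => (hH x).deriv
      have hHs : ContDiff ℝ ∞ H := by
        refine contDiff_infty_iff_deriv.2 ⟨fun x => (hH x).differentiableAt, ?_⟩
        rw [hHd]; exact hη
      have hgd : ∀ x, deriv (fun x => H x - H (x - s)) x = η x - η (x - s) := fun x =>
        ((hH x).sub ((hH (x - s)).comp_sub_const x s)).deriv
      obtain ⟨r, hr⟩ := hηs.isCompact.isBounded.subset_closedBall 0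
      have hη0 : ∀ x, r < |x| → η x = 0 := by
        intro x hx
        by_contra hne
        have := hr (subset_tsupport _ hne)
        simp at this
        linarith
      have hgc : HasCompactSupport (fun x => H x - H (x - s)) := by
        refine HasCompactSupport.intro (isCompact_closedBall (0 : ℝ) (r + |s|)) fun x hx => ?_
        have hx' : r + |s| < |x| := by simpa using hx
        show (∫ y in (0 : ℝ)..x, η y) - (∫ y in (0 : ℝ)..(x - s), η y) = 0
        rw [intervalIntegral.integral_interval_sub_left (hη.continuous.intervalIntegrable _ _)
          (hη.continuous.intervalIntegrable _ _)]
        refine intervalIntegral.integral_zero_ae (ae_of_all _ fun y hy => hη0 y ?_)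
        have : |y - x| ≤ |s| := by
          have h5 := Set.abs_sub_le_of_uIcc_subset_uIcc
            (Set.uIcc_subset_uIcc (Set.uIoc_subset_uIcc hy) Set.right_mem_uIcc)
          rw [abs_sub_comm] at h5
          simpa using h5
        have h6 : |x| - |y| ≤ |y - x| := by rw [abs_sub_comm]; exact abs_sub_abs_le_abs_sub x y
        linarith
      have e : ∫ x, ((deriv (fun x => H x - H (x - s)) x : ℝ) : ℂ) * (P x - R x) = 0 :=
        h1 _ (hHs.sub (hHs.comp (contDiff_id.sub contDiff_const))) hgc
      simp only [hgd] at e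
      have i1 : Integrable fun x => (η x : ℂ) * (P x - R x) :=
        ((Complex.continuous_ofReal.comp hη.continuous).mul hW).integrable_of_hasCompactSupport
          ((hηs.comp_left (g := ((↑) : ℝ → ℂ)) rfl).mul_right)
      have i2 : Integrable fun x => (η x : ℂ) * (P (x + s) - R (x + s)) :=
        ((Complex.continuous_ofReal.comp hη.continuous).mul
          (hW.comp (continuous_id.add continuous_const))).integrable_of_hasCompactSupport
          ((hηs.comp_left (g := ((↑) : ℝ → ℂ)) rfl).mul_right)
      have i3 : Integrable fun x => (η (x - s) : ℂ) * (P x - R x) := by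
        simpa using i2.comp_sub_right s
      have e3 : ∫ x, (η (x - s) : ℂ) * (P x - R x)
          = ∫ x, (η x : ℂ) * (P (x + s) - R (x + s)) := by
        rw [← integral_sub_right_eq_self
          (fun x => (η x : ℂ) * (P (x + s) - R (x + s))) s]
        simp
      simp only [Complex.ofReal_sub, sub_mul] at e
      rw [integral_sub i1 i3, e3] at e
      have e4 : ∀ x, η x • ((P (x + s) - R (x + s)) - (P x - R x))
          = (η x : ℂ) * (P (x + s) - R (x + s)) - (η x : ℂ) * (P x - R x) := fun x => by
        rw [Complex.real_smul, mul_sub]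
      rw [integral_congr_ae (ae_of_all _ e4), integral_sub i2 i1]
      linear_combination -e
    have hc : Continuous fun x => (P (x + s) - R (x + s)) - (P x - R x) :=
      (hW.comp (continuous_id.add continuous_const)).sub hW
    have h0 := ae_eq_zero_of_integral_contDiff_smul_eq_zero (μ := volume)
      hc.locallyIntegrable key
    have h7 := (Continuous.ae_eq_iff_eq volume hc continuous_const).1
      (show _ =ᵐ[volume] fun _ => (0 : ℂ) from h0)
    intro x
    exact sub_eq_zero.1 (congrFun h7 x)
  have h3 : P = fun x => R x + (P 0 - R 0) := by
    funext x
    have := h2 x 0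
    rw [zero_add] at this
    linear_combination this
  rw [h3]
  exact (hR t).add_const _

namespace LogHom

variable {u : Cn n → ℝ}

theorem smooth_ofReal (hu : LogHom u) {z : Cn n} (hz : z ≠ 0) :
    ContDiffAt ℝ ∞ (fun z => (u z : ℂ)) z :=
  Complex.ofRealCLM.contDiff.contDiffAt.comp z (hu.contDiffAt hz)

theorem wirt_comp (hu : LogHom u) {g : ℝ → ℝ} (hg : ContDiff ℝ ∞ g) {z : Cn n} (hz : z ≠ 0)
    (c : ℂ) (j : Fin n) : wirt c j (fun z => (g (u z) : ℂ)) z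
      = ((deriv g (u z) : ℝ) : ℂ) * wirt c j (fun z => (u z : ℂ)) z := by
  have hd : HasFDerivAt u (fderiv ℝ u z) z :=
    ((hu.contDiffAt hz).differentiableAt (by simp)).hasFDerivAt
  have h1 : HasFDerivAt (fun z => (u z : ℂ)) _ z := Complex.ofRealCLM.hasFDerivAt.comp z hd
  have h2 : HasFDerivAt (fun z => (g (u z) : ℂ)) _ z := Complex.ofRealCLM.hasFDerivAt.comp z
    (((hg.differentiable (by simp)).differentiableAt (x := u z)).hasDerivAt.comp_hasFDerivAt z hd)
  simp only [wirt, h1.fderiv, h2.fderiv]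
  simp
  ring

/-- The divergence theorem on the level sets of `u`. -/
theorem hasDerivAt_levelMean [NeZero n] (hu : LogHom u) {h : Cn n → ℂ}
    (hh : ContDiffOn ℝ ∞ h {0}ᶜ) (c : ℂ) (j : Fin n) (t : ℝ) :
    HasDerivAt (levelMean u fun z => h z * wirt c j (fun z => (u z : ℂ)) z)
      (levelMean u (wirt c j h) t) t := by
  have hhA : ∀ z, z ≠ 0 → ContDiffAt ℝ ∞ h z := fun z hz =>
    hh.contDiffAt (isOpen_compl_singleton.mem_nhds hz)
  have c1 : ContinuousOn (fun z => h z * wirt c j (fun z => (u z : ℂ)) z) {0}ᶜ := fun z hz =>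
    ((hhA z hz).continuousAt.mul
      (contDiffAt_wirt (hu.smooth_ofReal hz)).continuousAt).continuousWithinAt
  have c2 : ContinuousOn (wirt c j h) {0}ᶜ := fun z hz =>
    (contDiffAt_wirt (hhA z hz)).continuousAt.continuousWithinAt
  refine hasDerivAt_of_weak (hu.continuous_levelMean c1) (hu.continuous_levelMean c2) ?_ t
  intro g hg hgs
  obtain ⟨R, hR⟩ := hu.exists_bound
  obtain ⟨r, hr⟩ := hgs.isCompact.isBounded.subset_closedBall 0
  have hg0 : ∀ x, r < |x| → x ∉ tsupport g := by
    intro x hx hmem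
    have := hr hmem
    simp at this
    linarith
  classical
  set k : Cn n → ℂ := fun z => if z = 0 then 0 else (g (u z) : ℂ) * h z with hk
  have hkev : ∀ z, z ≠ 0 → k =ᶠ[𝓝 z] fun z => (g (u z) : ℂ) * h z := fun z hz => by
    filter_upwards [isOpen_compl_singleton.mem_nhds (show z ∈ ({0}ᶜ : Set (Cn n)) from hz)]
      with w hw
    simp [hk, show w ≠ 0 from hw]
  have hk0 : ∀ z, ‖z‖ < Real.exp (-r - R) ∨ Real.exp (r + R) < ‖z‖ → k z = 0 := by
    intro z hz
    by_cases h0 : z = 0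
    · simp [hk, h0]
    have hlt : r < |u z| := by
      have h5 := abs_le.1 (hR z h0)
      rcases hz with hz | hz
      · have := Real.log_lt_log (norm_pos_iff.2 h0) hz
        rw [Real.log_exp] at this
        rw [lt_abs]; right; linarith
      · have := Real.log_lt_log (Real.exp_pos _) hz
        rw [Real.log_exp] at this
        rw [lt_abs]; left; linarith
    simp [hk, image_eq_zero_of_notMem_tsupport (hg0 _ hlt)]
  have hkc : HasCompactSupport k := by
    refine HasCompactSupport.intro (isCompact_closedBall (0 : Cn n) (Real.exp (r + R)))
      fun z hz => hk0 z (Or.inr ?_)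
    simpa using hz
  have hks : ContDiff ℝ ∞ k := by
    refine contDiff_iff_contDiffAt.2 fun z => ?_
    by_cases h0 : z = 0
    · have : k =ᶠ[𝓝 z] fun _ => 0 := by
        filter_upwards [Metric.ball_mem_nhds z (Real.exp_pos (-r - R))] with w hw
        refine hk0 w (Or.inl ?_)
        simpa [h0] using hw
      exact contDiffAt_const.congr_of_eventuallyEq this
    · refine ContDiffAt.congr_of_eventuallyEq ?_ (hkev z h0)
      have : ContDiffAt ℝ ∞ (fun z => (g (u z) : ℂ)) z :=
        Complex.ofRealCLM.contDiff.contDiffAt.comp z (hg.contDiffAt.comp z (hu.contDiffAt h0))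
      exact this.mul (hhA z h0)
  have hwk : ∀ z, z ≠ 0 → wirt c j k z = ((deriv g (u z) : ℝ) : ℂ) *
      (h z * wirt c j (fun z => (u z : ℂ)) z) + (g (u z) : ℂ) * wirt c j h z := by
    intro z h0
    have hgd : DifferentiableAt ℝ (fun z => (g (u z) : ℂ)) z :=
      (Complex.ofRealCLM.contDiff.contDiffAt.comp z
        (hg.contDiffAt.comp z (hu.contDiffAt h0))).differentiableAt (n := ∞) (by simp)
    rw [wirt_congr (hkev z h0), wirt_mul hgd ((hhA z h0).differentiableAt (by simp)),
      hu.wirt_comp hg h0]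
    ring
  have hwi : Integrable (wirt c j k) (liftMeas u volume) := by
    rw [hu.liftMeas_volume]
    have h1 : Continuous (fderiv ℝ k) := hks.continuous_fderiv (by simp)
    have h2 : Continuous (wirt c j k) := by unfold wirt; fun_prop
    refine h2.integrable_of_hasCompactSupport ?_
    refine HasCompactSupport.intro hkc.isCompact fun z hz => ?_
    have : fderiv ℝ k z = 0 := by
      have := support_fderiv_subset ℝ (f := k)
      by_contra hne
      exact hz (this hne)
    simp [wirt, this]
  have e := hu.integral_liftMeas volume hwi
  rw [hu.liftMeas_volume, integral_wirt_eq_zero (hks.of_le (by simp)) hkc] at e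
  rw [e]
  refine integral_congr_ae (ae_of_all _ fun s => ?_)
  have i1 := (hu.integrable_sph c1 s).const_mul ((deriv g s : ℝ) : ℂ)
  have i2 := (hu.integrable_sph c2 s).const_mul (g s : ℂ)
  simp only [levelMean]
  rw [← integral_const_mul, ← integral_const_mul, ← integral_add i1 i2]
  refine integral_congr_ae (ae_of_all _ fun ζ => ?_)
  simp only [hwk _ (polarPt_ne_zero u s ζ), hu.apply_polarPt]
  ring

end LogHom

/-! ### Euler relations and homogeneity -/

theorem wirt_coord (c : ℂ) (q p : Fin n) (z : Cn n) :
    wirt c q (fun w : Cn n => w p) z = if p = q then (1 + c * Complex.I) / 2 else 0 := by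
  have h : HasFDerivAt (fun w : Cn n => w p) ((EuclideanSpace.proj p : Cn n →L[ℂ] ℂ).restrictScalars ℝ) z :=
    ((EuclideanSpace.proj p : Cn n →L[ℂ] ℂ).restrictScalars ℝ).hasFDerivAt
  simp only [wirt, h.fderiv]
  by_cases hpq : p = q <;> simp [hpq]

theorem wirt_conj_coord (c : ℂ) (q p : Fin n) (z : Cn n) :
    wirt c q (fun w : Cn n => (starRingEnd ℂ) (w p)) z
      = if p = q then (1 - c * Complex.I) / 2 else 0 := by
  have h := congrArg (starRingEnd ℂ) (wirt_coord ((starRingEnd ℂ) c) q p z)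
  rw [conj_wirt, Complex.conj_conj] at h
  rw [h]
  split_ifs <;> simp [map_ofNat, sub_eq_add_neg]

theorem differentiable_coord (p : Fin n) : Differentiable ℝ fun w : Cn n => w p :=
  ((EuclideanSpace.proj p : Cn n →L[ℂ] ℂ).restrictScalars ℝ).differentiable

theorem differentiable_conj_coord (p : Fin n) :
    Differentiable ℝ fun w : Cn n => (starRingEnd ℂ) (w p) :=
  Complex.conjCLE.differentiable.comp (differentiable_coord p)

/-- `h` is homogeneous of degree `-d` under positive dilations. -/
def HomDeg (h : Cn n → ℂ) (d : ℕ) : Prop :=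
  ∀ (r : ℝ), 0 < r → ∀ z, z ≠ 0 → h (r • z) * (r : ℂ) ^ d = h z

theorem HomDeg.mul {h k : Cn n → ℂ} {d e : ℕ} (hh : HomDeg h d) (hk : HomDeg k e) :
    HomDeg (fun z => h z * k z) (d + e) := fun r hr z hz => by
  simp only
  rw [← hh r hr z hz, ← hk r hr z hz]; ring

theorem HomDeg.prod {k : ℕ} {h : Fin k → Cn n → ℂ} {d : ℕ} (hh : ∀ i, HomDeg (h i) d) :
    HomDeg (fun z => ∏ i, h i z) (d * k) := fun r hr z hz => by
  simp only
  rw [← Finset.prod_congr rfl fun i _ => hh i r hr z hz, Finset.prod_mul_distrib]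
  simp [pow_mul]

theorem HomDeg.altSum {k : ℕ} {h : Perm (Fin k) → Perm (Fin k) → Cn n → ℂ} {d : ℕ}
    (hh : ∀ σ τ, HomDeg (h σ τ) d) : HomDeg (fun z => altSum fun σ τ => h σ τ z) d :=
  fun r hr z hz => by
    have : (fun σ τ => h σ τ z) = fun σ τ => (r : ℂ) ^ d * h σ τ (r • z) := by
      funext σ τ; rw [← hh σ τ r hr z hz]; ring
    simp only [this, altSum_const_mul]
    ring

theorem fderiv_eq_of_dilation {h : Cn n → ℂ} {r : ℝ} {a b : ℂ}
    (H : ∀ z, z ≠ 0 → h (r • z) * a = b + h z) {z : Cn n} (hz : z ≠ 0)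
    (hd : DifferentiableAt ℝ h (r • z)) (v : Cn n) :
    fderiv ℝ h (r • z) v * (r * a) = fderiv ℝ h z v := by
  have h1 : HasFDerivAt (fun w : Cn n => r • w) (r • ContinuousLinearMap.id ℝ (Cn n)) z :=
    (hasFDerivAt_id z).const_smul r
  have h2 : HasFDerivAt (fun w => h (r • w) * a - b) _ z :=
    ((hd.hasFDerivAt.comp z h1).mul_const a).sub_const b
  have h3 : h =ᶠ[𝓝 z] fun w => h (r • w) * a - b := by
    filter_upwards [isOpen_compl_singleton.mem_nhds (show z ∈ ({0}ᶜ : Set (Cn n)) from hz)]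
      with w hw
    rw [H w hw]; ring
  rw [h3.fderiv_eq, h2.fderiv]
  simp
  ring

theorem wirt_eq_of_dilation {h : Cn n → ℂ} {r : ℝ} {a b : ℂ}
    (H : ∀ z, z ≠ 0 → h (r • z) * a = b + h z) {z : Cn n} (hz : z ≠ 0)
    (hd : DifferentiableAt ℝ h (r • z)) (c : ℂ) (j : Fin n) :
    wirt c j h (r • z) * (r * a) = wirt c j h z := by
  simp only [wirt]
  rw [← fderiv_eq_of_dilation H hz hd, ← fderiv_eq_of_dilation H hz hd]
  ring

theorem HomDeg.wirt {h : Cn n → ℂ} {d : ℕ} (hh : HomDeg h d)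
    (hd : ∀ z, z ≠ 0 → DifferentiableAt ℝ h z) (c : ℂ) (j : Fin n) :
    HomDeg (wirt c j h) (d + 1) := fun r hr z hz => by
  rw [← wirt_eq_of_dilation (a := (r : ℂ) ^ d) (b := 0)
    (fun w hw => by rw [hh r hr w hw, zero_add]) hz (hd _ (smul_ne_zero hr.ne' hz)), pow_succ]
  ring

/-- `h` is continuous away from the origin, and `O(|z|^{-d})`. -/
def OrdBound (h : Cn n → ℂ) (d : ℕ) : Prop :=
  ContinuousOn h {0}ᶜ ∧ ∃ C, ∀ z, z ≠ 0 → ‖h z‖ * ‖z‖ ^ d ≤ C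

theorem HomDeg.ordBound {h : Cn n → ℂ} {d : ℕ} (hh : HomDeg h d) (hc : ContinuousOn h {0}ᶜ) :
    OrdBound h d := by
  refine ⟨hc, ?_⟩
  obtain ⟨C, hC⟩ := (isCompact_sphere (0 : Cn n) 1).exists_bound_of_continuousOn
    (hc.mono fun z hz => by
      rintro rfl
      simp at hz)
  refine ⟨C, fun z hz => ?_⟩
  have hz' : 0 < ‖z‖ := norm_pos_iff.2 hz
  have h1 : ‖z‖⁻¹ • z ∈ Metric.sphere (0 : Cn n) 1 := by
    simp [norm_smul, hz'.ne']
  have h2 := hh ‖z‖ hz' (‖z‖⁻¹ • z) (smul_ne_zero (inv_pos.2 hz').ne' hz)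
  rw [smul_inv_smul₀ hz'.ne'] at h2
  have h3 := hC _ h1
  rw [← h2] at h3
  simpa using h3

theorem OrdBound.mul {h k : Cn n → ℂ} {d e : ℕ} (hh : OrdBound h d) (hk : OrdBound k e) :
    OrdBound (fun z => h z * k z) (d + e) := by
  obtain ⟨C, hC⟩ := hh.2
  obtain ⟨D, hD⟩ := hk.2
  refine ⟨hh.1.mul hk.1, C * D, fun z hz => ?_⟩
  have h0 : 0 ≤ C := le_trans (by positivity) (hC z hz)
  calc ‖h z * k z‖ * ‖z‖ ^ (d + e) = (‖h z‖ * ‖z‖ ^ d) * (‖k z‖ * ‖z‖ ^ e) := by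
        rw [norm_mul, pow_add]; ring
    _ ≤ C * D := mul_le_mul (hC z hz) (hD z hz) (by positivity) h0

theorem OrdBound.altSum {k : ℕ} {h : Perm (Fin k) → Perm (Fin k) → Cn n → ℂ} {d : ℕ}
    (hh : ∀ σ τ, OrdBound (h σ τ) d) : OrdBound (fun z => altSum fun σ τ => h σ τ z) d := by
  choose hc C hC using hh
  refine ⟨?_, ∑ σ, ∑ τ, C σ τ, fun z hz => ?_⟩
  · unfold Pluripotential.altSum
    exact continuousOn_finsetSum _ fun σ _ => continuousOn_finsetSum _ fun τ _ =>
      continuousOn_const.mul (continuousOn_const.mul (hc σ τ))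
  · unfold Pluripotential.altSum
    rw [← sub_nonneg]
    have h1 : ‖∑ σ : Perm (Fin k), ∑ τ : Perm (Fin k),
        ((Perm.sign σ : ℤ) : ℂ) * (((Perm.sign τ : ℤ) : ℂ) * h σ τ z)‖
        ≤ ∑ σ : Perm (Fin k), ∑ τ : Perm (Fin k), ‖h σ τ z‖ := by
      refine (norm_sum_le _ _).trans (Finset.sum_le_sum fun σ _ =>
        (norm_sum_le _ _).trans (Finset.sum_le_sum fun τ _ => ?_))
      have hs : ∀ σ : Perm (Fin k), ‖((Perm.sign σ : ℤ) : ℂ)‖ = 1 := fun σ => by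
        rcases Int.units_eq_one_or (Perm.sign σ) with h | h <;> simp [h]
      rw [norm_mul, norm_mul, hs, hs, one_mul, one_mul]
    have h2 := mul_le_mul_of_nonneg_right h1 (pow_nonneg (norm_nonneg z) d)
    rw [sub_nonneg]
    refine h2.trans ?_
    rw [Finset.sum_mul]
    refine Finset.sum_le_sum fun σ _ => ?_
    rw [Finset.sum_mul]
    exact Finset.sum_le_sum fun τ _ => hC σ τ z hz

theorem ordBound_of_compactSupport {χ : Cn n → ℂ} (hc : Continuous χ) (hs : HasCompactSupport χ) :
    OrdBound χ 0 := by
  obtain ⟨C, hC⟩ := hs.exists_bound_of_continuous hc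
  exact ⟨hc.continuousOn, C, fun z _ => by simpa using hC z⟩

/-- `∂u/∂z_p`. -/
def gradL (u : Cn n → ℝ) (p : Fin n) : Cn n → ℂ := wirt (-Complex.I) p fun z => (u z : ℂ)

/-- `∂u/∂z̄_q`. -/
def gradR (u : Cn n → ℝ) (q : Fin n) : Cn n → ℂ := wirt Complex.I q fun z => (u z : ℂ)

/-- `∂²u/∂z_p∂z̄_q`. -/
def hess (u : Cn n → ℝ) (p q : Fin n) : Cn n → ℂ := wirt (-Complex.I) p (gradR u q)

namespace LogHom

variable {u : Cn n → ℝ}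

theorem contDiffAt_gradL (hu : LogHom u) (p : Fin n) {z : Cn n} (hz : z ≠ 0) :
    ContDiffAt ℝ ∞ (gradL u p) z := contDiffAt_wirt (hu.smooth_ofReal hz)

theorem contDiffAt_gradR (hu : LogHom u) (p : Fin n) {z : Cn n} (hz : z ≠ 0) :
    ContDiffAt ℝ ∞ (gradR u p) z := contDiffAt_wirt (hu.smooth_ofReal hz)

theorem contDiffAt_hess (hu : LogHom u) (p q : Fin n) {z : Cn n} (hz : z ≠ 0) :
    ContDiffAt ℝ ∞ (hess u p q) z := contDiffAt_wirt (hu.contDiffAt_gradR q hz)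

theorem hess_eq (hu : LogHom u) (p q : Fin n) {z : Cn n} (hz : z ≠ 0) :
    hess u p q z = wirt Complex.I q (gradL u p) z := wirt_comm (hu.smooth_ofReal hz)

theorem hess_eventuallyEq (hu : LogHom u) (p q : Fin n) {z : Cn n} (hz : z ≠ 0) :
    hess u p q =ᶠ[𝓝 z] wirt Complex.I q (gradL u p) := by
  filter_upwards [isOpen_compl_singleton.mem_nhds (show z ∈ ({0}ᶜ : Set (Cn n)) from hz)]
    with w hw using hu.hess_eq p q hw

theorem homDeg_grad (hu : LogHom u) (c : ℂ) (p : Fin n) :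
    HomDeg (wirt c p fun z => (u z : ℂ)) 1 := fun r hr z hz => by
  rw [← wirt_eq_of_dilation (a := 1) (b := (Real.log r : ℂ))
    (fun w hw => by rw [hu.hom_real hr hw]; push_cast; ring) hz
    ((hu.smooth_ofReal (smul_ne_zero hr.ne' hz)).differentiableAt (by simp))]
  ring

theorem homDeg_hess (hu : LogHom u) (p q : Fin n) : HomDeg (hess u p q) 2 :=
  (hu.homDeg_grad Complex.I q).wirt
    (fun _ hz => (hu.contDiffAt_gradR q hz).differentiableAt (by simp)) _ p

theorem fderiv_self (hu : LogHom u) {z : Cn n} (hz : z ≠ 0) :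
    fderiv ℝ (fun z => (u z : ℂ)) z z = 1 := by
  have hd : HasFDerivAt (fun z => (u z : ℂ)) (fderiv ℝ (fun z => (u z : ℂ)) z) ((1 : ℝ) • z) := by
    rw [one_smul]
    exact ((hu.smooth_ofReal hz).differentiableAt (by simp)).hasFDerivAt
  have h1 : HasDerivAt (fun r : ℝ => r • z) ((1 : ℝ) • z) 1 := (hasDerivAt_id 1).smul_const z
  have h2 := hd.comp_hasDerivAt 1 h1
  have h3 : HasDerivAt (fun r : ℝ => (Real.log r : ℂ) + (u z : ℂ)) (((1 : ℝ)⁻¹ : ℝ) : ℂ) 1 :=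
    ((Real.hasDerivAt_log one_ne_zero).ofReal_comp).add_const _
  have h4 : (fun z => (u z : ℂ)) ∘ (fun r : ℝ => r • z)
      =ᶠ[𝓝 1] fun r : ℝ => (Real.log r : ℂ) + (u z : ℂ) := by
    filter_upwards [lt_mem_nhds (zero_lt_one : (0 : ℝ) < 1)] with r hr
    simp [hu.hom_real hr hz]
  have := h2.unique (h3.congr_of_eventuallyEq h4)
  simpa using this

theorem fderiv_I_smul (hu : LogHom u) {z : Cn n} (hz : z ≠ 0) :
    fderiv ℝ (fun z => (u z : ℂ)) z (Complex.I • z) = 0 := by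
  have h1 : HasDerivAt (fun θ : ℝ => Complex.exp (θ * Complex.I) • z) (Complex.I • z) 0 := by
    have h := ((((hasDerivAt_id (0 : ℝ)).ofReal_comp).mul_const Complex.I).cexp).smul_const z
    simpa using h
  have hd : HasFDerivAt (fun z => (u z : ℂ)) (fderiv ℝ (fun z => (u z : ℂ)) z)
      (Complex.exp ((0 : ℝ) * Complex.I) • z) := by
    simp only [Complex.ofReal_zero, zero_mul, Complex.exp_zero, one_smul]
    exact ((hu.smooth_ofReal hz).differentiableAt (by simp)).hasFDerivAt
  have h2 := hd.comp_hasDerivAt 0 h1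
  have h4 : (fun z => (u z : ℂ)) ∘ (fun θ : ℝ => Complex.exp (θ * Complex.I) • z)
      = fun _ => (u z : ℂ) := by
    funext θ
    simp [hu.hom _ z (Complex.exp_ne_zero _) hz, Complex.norm_exp_ofReal_mul_I]
  rw [h4] at h2
  exact h2.unique (hasDerivAt_const _ _)

theorem sum_mul_gradL (hu : LogHom u) {z : Cn n} (hz : z ≠ 0) :
    ∑ p, gradL u p z * z p = 1 / 2 := by
  simp only [gradL, mul_comm _ (z _)]
  rw [sum_mul_wirt, hu.fderiv_self hz, hu.fderiv_I_smul hz]; simp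

theorem sum_conj_mul_gradR (hu : LogHom u) {z : Cn n} (hz : z ≠ 0) :
    ∑ q, gradR u q z * (starRingEnd ℂ) (z q) = 1 / 2 := by
  simp only [gradR, mul_comm _ ((starRingEnd ℂ) (z _))]
  rw [sum_conj_mul_wirt, hu.fderiv_self hz, hu.fderiv_I_smul hz]; simp

theorem sum_conj_mul_hess (hu : LogHom u) (p : Fin n) {z : Cn n} (hz : z ≠ 0) :
    ∑ q, hess u p q z * (starRingEnd ℂ) (z q) = 0 := by
  have h1 : (fun w : Cn n => ∑ q, gradR u q w * (starRingEnd ℂ) (w q)) =ᶠ[𝓝 z]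
      fun _ => (1 / 2 : ℂ) := by
    filter_upwards [isOpen_compl_singleton.mem_nhds (show z ∈ ({0}ᶜ : Set (Cn n)) from hz)]
      with w hw using hu.sum_conj_mul_gradR hw
  have h2 := wirt_congr (c := -Complex.I) (j := p) h1
  have hd : ∀ q, DifferentiableAt ℝ (gradR u q) z := fun q =>
    (hu.contDiffAt_gradR q hz).differentiableAt (by simp)
  rw [wirt_const, wirt_sum (h := fun q w => gradR u q w * (starRingEnd ℂ) (w q))
    fun q _ => (hd q).mul (differentiable_conj_coord q z)] at h2
  rw [← h2]
  refine Finset.sum_congr rfl fun q _ => ?_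
  rw [wirt_mul (hd q) (differentiable_conj_coord q z), wirt_conj_coord]
  simp [hess]

theorem sum_mul_hess (hu : LogHom u) (q : Fin n) {z : Cn n} (hz : z ≠ 0) :
    ∑ p, hess u p q z * z p = 0 := by
  have h1 : (fun w : Cn n => ∑ p, gradL u p w * w p) =ᶠ[𝓝 z] fun _ => (1 / 2 : ℂ) := by
    filter_upwards [isOpen_compl_singleton.mem_nhds (show z ∈ ({0}ᶜ : Set (Cn n)) from hz)]
      with w hw using hu.sum_mul_gradL hw
  have h2 := wirt_congr (c := Complex.I) (j := q) h1
  have hd : ∀ p, DifferentiableAt ℝ (gradL u p) z := fun p =>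
    (hu.contDiffAt_gradL p hz).differentiableAt (by simp)
  rw [wirt_const, wirt_sum (h := fun p w => gradL u p w * w p)
    fun p _ => (hd p).mul (differentiable_coord p z)] at h2
  rw [← h2]
  refine Finset.sum_congr rfl fun p _ => ?_
  rw [wirt_mul (hd p) (differentiable_coord p z), wirt_coord, hu.hess_eq p q hz]
  simp

end LogHom

/-! ### Level means of antisymmetrized coefficients -/

theorem levelMean_congr {u : Cn n → ℝ} {h k : Cn n → ℂ} (e : ∀ z, z ≠ 0 → h z = k z) (t : ℝ) :
    levelMean u h t = levelMean u k t := by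
  simp only [levelMean, e _ (polarPt_ne_zero u t _)]

theorem levelMean_add {u : Cn n → ℝ} (hu : LogHom u) {h k : Cn n → ℂ} (hh : ContinuousOn h {0}ᶜ)
    (hk : ContinuousOn k {0}ᶜ) (t : ℝ) :
    levelMean u (fun z => h z + k z) t = levelMean u h t + levelMean u k t := by
  simp only [levelMean, mul_add]
  exact integral_add (hu.integrable_sph hh t) (hu.integrable_sph hk t)

theorem levelMean_altSum {u : Cn n → ℝ} (hu : LogHom u) {k : ℕ}
    {h : Perm (Fin k) → Perm (Fin k) → Cn n → ℂ} (hh : ∀ σ τ, ContinuousOn (h σ τ) {0}ᶜ) (t : ℝ) :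
    levelMean u (fun z => altSum fun σ τ => h σ τ z) t
      = altSum fun σ τ => levelMean u (h σ τ) t := by
  have hi := fun σ τ => hu.integrable_sph (hh σ τ) t
  have hi' : ∀ σ τ, Integrable (fun ζ : Sph n => (Real.exp (2 * n * (t - u ζ)) : ℂ) *
      (((Perm.sign σ : ℤ) : ℂ) * (((Perm.sign τ : ℤ) : ℂ) * h σ τ (polarPt u t ζ)))) (sphMeas n) :=
    fun σ τ => by
      refine (((hi σ τ).const_mul ((Perm.sign τ : ℤ) : ℂ)).const_mul
        ((Perm.sign σ : ℤ) : ℂ)).congr (ae_of_all _ fun ζ => ?_)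
      simp only
      ring
  simp only [levelMean, altSum, Finset.mul_sum]
  rw [integral_finsetSum _ fun σ _ => integrable_finsetSum _ fun τ _ => hi' σ τ]
  refine Finset.sum_congr rfl fun σ _ => ?_
  rw [integral_finsetSum _ fun τ _ => hi' σ τ]
  refine Finset.sum_congr rfl fun τ _ => ?_
  rw [← integral_const_mul, ← integral_const_mul]
  refine integral_congr_ae (ae_of_all _ fun ζ => ?_)
  simp only
  ring

theorem hasDerivAt_levelMean_altSum [NeZero n] {u : Cn n → ℝ} (hu : LogHom u) {k : ℕ}
    {h : Perm (Fin k) → Perm (Fin k) → Cn n → ℂ}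
    (hh : ∀ σ τ, ∀ z, z ≠ 0 → ContDiffAt ℝ ∞ (h σ τ) z) (c : ℂ)
    (ι : Perm (Fin k) → Perm (Fin k) → Fin n) (t : ℝ) :
    HasDerivAt (levelMean u fun z => altSum fun σ τ => h σ τ z *
        wirt c (ι σ τ) (fun z => (u z : ℂ)) z)
      (levelMean u (fun z => altSum fun σ τ => wirt c (ι σ τ) (h σ τ) z) t) t := by
  have h1 := fun σ τ => hu.hasDerivAt_levelMean
    (fun z hz => (hh σ τ z hz).contDiffWithinAt) c (ι σ τ) t
  have e : levelMean u (fun z => altSum fun σ τ => h σ τ z *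
        wirt c (ι σ τ) (fun z => (u z : ℂ)) z)
      = fun t => altSum fun σ τ => levelMean u (fun z => h σ τ z *
        wirt c (ι σ τ) (fun z => (u z : ℂ)) z) t := by
    funext t
    refine levelMean_altSum hu (fun σ τ z hz => ?_) t
    exact ((hh σ τ z hz).continuousAt.mul
      (contDiffAt_wirt (hu.smooth_ofReal hz)).continuousAt).continuousWithinAt
  rw [e, levelMean_altSum hu fun σ τ z hz =>
    (contDiffAt_wirt (hh σ τ z hz)).continuousAt.continuousWithinAt]
  unfold altSum
  exact HasDerivAt.fun_sum fun σ _ => HasDerivAt.fun_sum fun τ _ =>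
    ((h1 σ τ).const_mul _).const_mul _

/-! ### The coefficients of the Monge-Ampère powers -/

/-- The coefficient of `(∂∂̄u)^k` at `dz_I ∧ dz̄_J`. -/
def formD {k : ℕ} (u : Cn n → ℝ) (I J : Fin k → Fin n) (z : Cn n) : ℂ :=
  altSum fun σ τ => ∏ i, hess u (I (σ i)) (J (τ i)) z

/-- The coefficient of `∂u ∧ ∂̄u ∧ ∂∂̄x_1 ∧ ⋯ ∧ ∂∂̄x_k` at `dz_I ∧ dz̄_J`. -/
def formB {k : ℕ} (u : Cn n → ℝ) (x : Fin k → Cn n → ℝ) (I J : Fin (k + 1) → Fin n)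
    (z : Cn n) : ℂ :=
  altSum fun σ τ => gradL u (I (σ 0)) z * gradR u (J (τ 0)) z *
    ∏ i : Fin k, hess (x i) (I (σ i.succ)) (J (τ i.succ)) z

/-- The coefficient of `∂χ ∧ ∂̄u ∧ (∂∂̄u)^k` at `dz_I ∧ dz̄_J`. -/
def formC {k : ℕ} (u : Cn n → ℝ) (χ : Cn n → ℂ) (I J : Fin (k + 1) → Fin n) (z : Cn n) : ℂ :=
  altSum fun σ τ => wirt (-Complex.I) (I (σ 0)) χ z * gradR u (J (τ 0)) z *
    ∏ i : Fin k, hess u (I (σ i.succ)) (J (τ i.succ)) z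

/-- The coefficient of `∂∂̄χ ∧ (∂∂̄u)^k` at `dz_I ∧ dz̄_J`. -/
def formA {k : ℕ} (u : Cn n → ℝ) (χ : Cn n → ℂ) (I J : Fin (k + 1) → Fin n) (z : Cn n) : ℂ :=
  altSum fun σ τ => wirt (-Complex.I) (I (σ 0)) (wirt Complex.I (J (τ 0)) χ) z *
    ∏ i : Fin k, hess u (I (σ i.succ)) (J (τ i.succ)) z

/-- The coefficient of `∂∂̄χ ∧ ∂u ∧ ∂̄u ∧ (∂∂̄u)^k` at `dz_I ∧ dz̄_J`. -/
def formE {k : ℕ} (u : Cn n → ℝ) (χ : Cn n → ℂ) (I J : Fin (k + 2) → Fin n) (z : Cn n) : ℂ :=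
  altSum fun σ τ => wirt (-Complex.I) (I (σ 0)) (wirt Complex.I (J (τ 0)) χ) z *
    (gradL u (I (σ 1)) z * gradR u (J (τ 1)) z *
    ∏ i : Fin k, hess u (I (σ i.succ.succ)) (J (τ i.succ.succ)) z)

/-- The sum in the definition of `∂∂̄(φ T)`, for the density part of `T = (∂∂̄φ)^k`. -/
theorem sum_formD {k : ℕ} (u : Cn n → ℝ) (χ : Cn n → ℂ) (I J : Fin (k + 1) → Fin n) (z : Cn n) :
    ∑ a : Fin (k + 1), ∑ b : Fin (k + 1), (-1 : ℂ) ^ ((a : ℕ) + (b : ℕ)) *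
      (dz (I a) (dzbar (J b) χ) z * formD u (I ∘ a.succAbove) (J ∘ b.succAbove) z)
      = formA u χ I J z := by
  simp only [dz_eq_wirt, dzbar_eq_wirt, formD, formA, Function.comp]
  exact sum_sum_altSum I J (fun p q => wirt (-Complex.I) p (wirt Complex.I q χ) z)
    (fun p q => ∏ i, hess u (p i) (q i) z)

/-- The sum in the definition of `∂∂̄(φ T)`, for the singular part of `T = (∂∂̄φ)^(k+1)`. -/
theorem sum_formB {k : ℕ} (u : Cn n → ℝ) (χ : Cn n → ℂ) (I J : Fin (k + 2) → Fin n) (z : Cn n) :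
    ∑ a : Fin (k + 2), ∑ b : Fin (k + 2), (-1 : ℂ) ^ ((a : ℕ) + (b : ℕ)) *
      (dz (I a) (dzbar (J b) χ) z * formB u (fun _ : Fin k => u) (I ∘ a.succAbove)
        (J ∘ b.succAbove) z)
      = formE u χ I J z := by
  simp only [dz_eq_wirt, dzbar_eq_wirt, formB, formE, Function.comp]
  exact sum_sum_altSum I J (fun p q => wirt (-Complex.I) p (wirt Complex.I q χ) z)
    (fun p q => gradL u (p 0) z * gradR u (q 0) z * ∏ i : Fin k, hess u (p i.succ) (q i.succ) z)

theorem contDiffAt_prod_hess {k K : ℕ} {x : Fin k → Cn n → ℝ} (hx : ∀ i, LogHom (x i))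
    (s : Finset (Fin k)) (I J : Fin K → Fin n) (e : Fin k → Fin K) (σ τ : Perm (Fin K)) {z : Cn n}
    (hz : z ≠ 0) :
    ContDiffAt ℝ ∞ (fun z => ∏ i ∈ s, hess (x i) (I (σ (e i))) (J (τ (e i))) z) z :=
  contDiffAt_prod fun i _ => (hx i).contDiffAt_hess _ _ hz

theorem altSum_wirt_prod_left {k K : ℕ} {x : Fin k → Cn n → ℝ} (hx : ∀ i, LogHom (x i))
    (s : Finset (Fin k)) (I J : Fin K → Fin n) (a : Fin K) (e : Fin k → Fin K)
    (he : Function.Injective e) (hea : ∀ i ∈ s, e i ≠ a) {z : Cn n} (hz : z ≠ 0)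
    (Y : Perm (Fin K) → Perm (Fin K) → ℂ)
    (hY : ∀ i ∈ s, ∀ σ τ, Y (σ * swap a (e i)) τ = Y σ τ) :
    altSum (fun σ τ => Y σ τ * wirt (-Complex.I) (I (σ a))
      (fun z => ∏ i ∈ s, hess (x i) (I (σ (e i))) (J (τ (e i))) z) z) = 0 :=
  altSum_eq_zero_left fun τ => sum_sign_mul_wirt_prod (-Complex.I) I a s e he hea
    (fun i => gradR (x i) (J (τ (e i)))) z (fun i _ => (hx i).contDiffAt_gradR _ hz)
    (fun σ => Y σ τ) fun i hi σ => hY i hi σ τ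

theorem altSum_wirt_prod_right {k K : ℕ} {x : Fin k → Cn n → ℝ} (hx : ∀ i, LogHom (x i))
    (s : Finset (Fin k)) (I J : Fin K → Fin n) (a : Fin K) (e : Fin k → Fin K)
    (he : Function.Injective e) (hea : ∀ i ∈ s, e i ≠ a) {z : Cn n} (hz : z ≠ 0)
    (Y : Perm (Fin K) → Perm (Fin K) → ℂ)
    (hY : ∀ i ∈ s, ∀ σ τ, Y σ (τ * swap a (e i)) = Y σ τ) :
    altSum (fun σ τ => Y σ τ * wirt Complex.I (J (τ a))
      (fun z => ∏ i ∈ s, hess (x i) (I (σ (e i))) (J (τ (e i))) z) z) = 0 := by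
  refine altSum_eq_zero_right fun σ => ?_
  have h := sum_sign_mul_wirt_prod Complex.I J a s e he hea
    (fun i => gradL (x i) (I (σ (e i)))) z (fun i _ => (hx i).contDiffAt_gradL _ hz)
    (fun τ => Y σ τ) fun i hi τ => hY i hi σ τ
  rw [← h]
  refine Finset.sum_congr rfl fun τ _ => ?_
  congr 2
  refine wirt_congr ?_
  have h2 : ∀ i, hess (x i) (I (σ (e i))) (J (τ (e i))) =ᶠ[𝓝 z]
      wirt Complex.I (J (τ (e i))) (gradL (x i) (I (σ (e i)))) := fun i =>
    (hx i).hess_eventuallyEq _ _ hz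
  filter_upwards [eventually_all.2 h2] with w hw
  exact Finset.prod_congr rfl fun i _ => hw i

section Relations

variable {u : Cn n → ℝ} {χ : Cn n → ℂ} {k : ℕ}

theorem LogHom.contDiffAt_formD (hu : LogHom u) (I J : Fin k → Fin n) {z : Cn n} (hz : z ≠ 0) :
    ContDiffAt ℝ ∞ (formD u I J) z := by
  unfold formD altSum
  exact ContDiffAt.sum fun σ _ => ContDiffAt.sum fun τ _ => contDiffAt_const.mul
    (contDiffAt_const.mul (contDiffAt_prod fun i _ => hu.contDiffAt_hess _ _ hz))

theorem contDiffAt_formB {x : Fin k → Cn n → ℝ} (hu : LogHom u) (hx : ∀ i, LogHom (x i))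
    (I J : Fin (k + 1) → Fin n) {z : Cn n} (hz : z ≠ 0) :
    ContDiffAt ℝ ∞ (formB u x I J) z := by
  unfold formB altSum
  exact ContDiffAt.sum fun σ _ => ContDiffAt.sum fun τ _ => contDiffAt_const.mul
    (contDiffAt_const.mul (((hu.contDiffAt_gradL _ hz).mul (hu.contDiffAt_gradR _ hz)).mul
      (contDiffAt_prod fun i _ => (hx i).contDiffAt_hess _ _ hz)))

theorem LogHom.contDiffAt_formC (hu : LogHom u) (hχ : ContDiff ℝ ∞ χ) (I J : Fin (k + 1) → Fin n)
    {z : Cn n} (hz : z ≠ 0) : ContDiffAt ℝ ∞ (formC u χ I J) z := by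
  unfold formC altSum
  exact ContDiffAt.sum fun σ _ => ContDiffAt.sum fun τ _ => contDiffAt_const.mul
    (contDiffAt_const.mul (((contDiffAt_wirt hχ.contDiffAt).mul (hu.contDiffAt_gradR _ hz)).mul
      (contDiffAt_prod fun i _ => hu.contDiffAt_hess _ _ hz)))

variable [NeZero n]

/-- On level means: `d/dt (χ ∂u ∧ ∂̄u ∧ (∂∂̄u)^k) = χ (∂∂̄u)^(k+1) + ∂χ ∧ ∂̄u ∧ (∂∂̄u)^k`. -/
theorem LogHom.hasDerivAt_formB (hu : LogHom u) (hχ : ContDiff ℝ ∞ χ) (I J : Fin (k + 1) → Fin n)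
    (t : ℝ) : HasDerivAt (levelMean u fun z => χ z * formB u (fun _ : Fin k => u) I J z)
      (levelMean u (fun z => χ z * formD u I J z) t + levelMean u (formC u χ I J) t) t := by
  have hP : ∀ (σ τ : Perm (Fin (k + 1))) (z : Cn n), z ≠ 0 → ContDiffAt ℝ ∞
      (fun z => ∏ i : Fin k, hess u (I (σ i.succ)) (J (τ i.succ)) z) z := fun σ τ z hz =>
    contDiffAt_prod_hess (fun _ => hu) Finset.univ I J Fin.succ σ τ hz
  have h := hasDerivAt_levelMean_altSum hu (h := fun σ τ z => χ z * gradR u (J (τ 0)) z *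
      ∏ i : Fin k, hess u (I (σ i.succ)) (J (τ i.succ)) z)
    (fun σ τ z hz => (hχ.contDiffAt.mul (hu.contDiffAt_gradR _ hz)).mul (hP σ τ z hz))
    (-Complex.I) (fun σ _ => I (σ 0)) t
  have e1 : (fun z => altSum fun σ τ => (χ z * gradR u (J (τ 0)) z *
      ∏ i : Fin k, hess u (I (σ i.succ)) (J (τ i.succ)) z) *
        wirt (-Complex.I) (I (σ 0)) (fun z => (u z : ℂ)) z)
      = fun z => χ z * formB u (fun _ : Fin k => u) I J z := by
    funext z
    rw [formB, ← altSum_const_mul]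
    congr 1; funext σ τ
    simp only [gradL]; ring
  rw [e1] at h
  convert h using 1
  rw [← levelMean_add hu (h := fun z => χ z * formD u I J z)
    (fun z hz => (hχ.contDiffAt.continuousAt.mul
      (hu.contDiffAt_formD I J hz).continuousAt).continuousWithinAt)
    (fun z hz => (hu.contDiffAt_formC hχ I J hz).continuousAt.continuousWithinAt)]
  refine levelMean_congr (fun z hz => ?_) t
  have hz1 : ∀ σ τ : Perm (Fin (k + 1)), wirt (-Complex.I) (I (σ 0)) (fun z => χ z *
      gradR u (J (τ 0)) z * ∏ i : Fin k, hess u (I (σ i.succ)) (J (τ i.succ)) z) z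
      = χ z * ∏ i : Fin (k + 1), hess u (I (σ i)) (J (τ i)) z
        + wirt (-Complex.I) (I (σ 0)) χ z * gradR u (J (τ 0)) z *
          ∏ i : Fin k, hess u (I (σ i.succ)) (J (τ i.succ)) z
        + (χ z * gradR u (J (τ 0)) z) * wirt (-Complex.I) (I (σ 0))
          (fun z => ∏ i : Fin k, hess u (I (σ i.succ)) (J (τ i.succ)) z) z := by
    intro σ τ
    have d1 : DifferentiableAt ℝ χ z := hχ.contDiffAt.differentiableAt (by simp)
    have d2 : DifferentiableAt ℝ (gradR u (J (τ 0))) z :=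
      (hu.contDiffAt_gradR _ hz).differentiableAt (by simp)
    rw [wirt_mul (d1.fun_mul d2) ((hP σ τ z hz).differentiableAt (by simp)), wirt_mul d1 d2,
      Fin.prod_univ_succ]
    simp only [hess]
    ring
  simp only [hz1]
  rw [altSum_add, altSum_add, altSum_wirt_prod_left (fun _ => hu) Finset.univ I J 0 Fin.succ
    (Fin.succ_injective _) (fun i _ => Fin.succ_ne_zero i) hz _ (fun _ _ _ _ => rfl),
    altSum_const_mul]
  simp [formD, formC]

/-- On level means: `d/dt (∂χ ∧ ∂̄u ∧ (∂∂̄u)^k) = ∂∂̄χ ∧ (∂∂̄u)^k`. -/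
theorem LogHom.hasDerivAt_formC (hu : LogHom u) (hχ : ContDiff ℝ ∞ χ) (I J : Fin (k + 1) → Fin n)
    (t : ℝ) : HasDerivAt (levelMean u (formC u χ I J)) (levelMean u (formA u χ I J) t) t := by
  have hP : ∀ (σ τ : Perm (Fin (k + 1))) (z : Cn n), z ≠ 0 → ContDiffAt ℝ ∞
      (fun z => ∏ i : Fin k, hess u (I (σ i.succ)) (J (τ i.succ)) z) z := fun σ τ z hz =>
    contDiffAt_prod_hess (fun _ => hu) Finset.univ I J Fin.succ σ τ hz
  have h := hasDerivAt_levelMean_altSum hu (h := fun σ τ z => wirt (-Complex.I) (I (σ 0)) χ z *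
      ∏ i : Fin k, hess u (I (σ i.succ)) (J (τ i.succ)) z)
    (fun σ τ z hz => (contDiffAt_wirt hχ.contDiffAt).mul (hP σ τ z hz))
    Complex.I (fun _ τ => J (τ 0)) t
  have e1 : (fun z => altSum fun σ τ => (wirt (-Complex.I) (I (σ 0)) χ z *
      ∏ i : Fin k, hess u (I (σ i.succ)) (J (τ i.succ)) z) *
        wirt Complex.I (J (τ 0)) (fun z => (u z : ℂ)) z) = formC u χ I J := by
    funext z
    rw [formC]
    congr 1; funext σ τ
    simp only [gradR]; ring
  rw [e1] at h
  convert h using 1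
  refine levelMean_congr (fun z hz => ?_) t
  have hz1 : ∀ σ τ : Perm (Fin (k + 1)), wirt Complex.I (J (τ 0)) (fun z =>
      wirt (-Complex.I) (I (σ 0)) χ z *
        ∏ i : Fin k, hess u (I (σ i.succ)) (J (τ i.succ)) z) z
      = wirt (-Complex.I) (I (σ 0)) (wirt Complex.I (J (τ 0)) χ) z *
          ∏ i : Fin k, hess u (I (σ i.succ)) (J (τ i.succ)) z
        + wirt (-Complex.I) (I (σ 0)) χ z * wirt Complex.I (J (τ 0))
          (fun z => ∏ i : Fin k, hess u (I (σ i.succ)) (J (τ i.succ)) z) z := by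
    intro σ τ
    rw [wirt_mul ((contDiffAt_wirt hχ.contDiffAt).differentiableAt (by simp))
      ((hP σ τ z hz).differentiableAt (by simp)), wirt_comm hχ.contDiffAt]
  simp only [hz1]
  rw [altSum_add, altSum_wirt_prod_right (fun _ => hu) Finset.univ I J 0 Fin.succ
    (Fin.succ_injective _) (fun i _ => Fin.succ_ne_zero i) hz _ (fun _ _ _ _ => rfl)]
  simp [formA]

/-- On level means: `∂χ ∧ ∂̄u ∧ (∂∂̄u)^(k+1) = ∂∂̄χ ∧ ∂u ∧ ∂̄u ∧ (∂∂̄u)^k`. -/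
theorem LogHom.levelMean_formC_eq (hu : LogHom u) (hχ : ContDiff ℝ ∞ χ)
    (I J : Fin (k + 2) → Fin n) (t : ℝ) :
    levelMean u (formC u χ I J) t = levelMean u (formE u χ I J) t := by
  have hP : ∀ (σ τ : Perm (Fin (k + 2))) (z : Cn n), z ≠ 0 → ContDiffAt ℝ ∞
      (fun z => ∏ i : Fin k, hess u (I (σ i.succ.succ)) (J (τ i.succ.succ)) z) z :=
    fun σ τ z hz => contDiffAt_prod_hess (fun _ => hu) Finset.univ I J
      (fun i => i.succ.succ) σ τ hz
  have h := hasDerivAt_levelMean_altSum hu (h := fun σ τ z => wirt (-Complex.I) (I (σ 0)) χ z *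
      gradR u (J (τ 0)) z * gradL u (I (σ 1)) z *
      ∏ i : Fin k, hess u (I (σ i.succ.succ)) (J (τ i.succ.succ)) z)
    (fun σ τ z hz => (((contDiffAt_wirt hχ.contDiffAt).mul (hu.contDiffAt_gradR _ hz)).mul
      (hu.contDiffAt_gradL _ hz)).mul (hP σ τ z hz))
    Complex.I (fun _ τ => J (τ 1)) t
  have hne : ∀ i : Fin k, i.succ.succ ≠ (1 : Fin (k + 2)) := fun i h =>
    Fin.succ_ne_zero i (Fin.succ_injective _ (by rw [h]; rfl))
  have h01 : (0 : Fin (k + 2)) ≠ 1 := by simp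
  have hsw : ∀ i : Fin k, swap (0 : Fin (k + 2)) 1 i.succ.succ = i.succ.succ := fun i =>
    swap_apply_of_ne_of_ne (Fin.succ_ne_zero _) (hne i)
  -- the primitive vanishes, by antisymmetry in `q_0` and `q_1`
  have e1 : (fun z => altSum fun σ τ => (wirt (-Complex.I) (I (σ 0)) χ z *
      gradR u (J (τ 0)) z * gradL u (I (σ 1)) z *
      ∏ i : Fin k, hess u (I (σ i.succ.succ)) (J (τ i.succ.succ)) z) *
        wirt Complex.I (J (τ 1)) (fun z => (u z : ℂ)) z) = fun _ => 0 := by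
    funext z
    refine altSum_eq_zero_right fun σ => sum_sign_mul_eq_zero h01 fun τ => ?_
    simp only [hsw, Perm.mul_apply, swap_apply_left, swap_apply_right, gradR]
    ring
  rw [e1] at h
  have h0 : levelMean u (fun _ => 0) = fun _ => 0 := by
    funext t; simp [levelMean]
  rw [h0] at h
  have h2 := h.unique (hasDerivAt_const t 0)
  have cC : ContinuousOn (formC u χ I J) {0}ᶜ := fun z hz =>
    (hu.contDiffAt_formC hχ I J hz).continuousAt.continuousWithinAt
  have cE : ContinuousOn (fun z => (-1 : ℂ) * formE u χ I J z) {0}ᶜ := by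
    unfold formE altSum
    intro z hz
    have : ContDiffAt ℝ ∞ (formE u χ I J) z := by
      unfold formE altSum
      exact ContDiffAt.sum fun σ _ => ContDiffAt.sum fun τ _ => contDiffAt_const.mul
        (contDiffAt_const.mul ((contDiffAt_wirt (contDiffAt_wirt hχ.contDiffAt)).mul
          (((hu.contDiffAt_gradL _ hz).mul (hu.contDiffAt_gradR _ hz)).mul (hP σ τ z hz))))
    exact (continuousAt_const.mul this.continuousAt).continuousWithinAt
  have h3 : levelMean u (fun z => (-1 : ℂ) * formE u χ I J z) t
      = -levelMean u (formE u χ I J) t := by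
    simp only [levelMean, ← integral_neg]
    refine integral_congr_ae (ae_of_all _ fun ζ => ?_)
    simp only; ring
  rw [← sub_eq_zero, sub_eq_add_neg, ← h3, ← levelMean_add hu cC cE, ← h2]
  refine levelMean_congr (fun z hz => ?_) t
  have hz1 : ∀ σ τ : Perm (Fin (k + 2)), wirt Complex.I (J (τ 1)) (fun z =>
      wirt (-Complex.I) (I (σ 0)) χ z * gradR u (J (τ 0)) z * gradL u (I (σ 1)) z *
      ∏ i : Fin k, hess u (I (σ i.succ.succ)) (J (τ i.succ.succ)) z) z
      = wirt (-Complex.I) (I (σ 0)) χ z * gradR u (J (τ 0)) z *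
          ∏ i : Fin (k + 1), hess u (I (σ i.succ)) (J (τ i.succ)) z
        + wirt (-Complex.I) (I (σ 0)) (wirt Complex.I (J (τ 1)) χ) z *
          (gradL u (I (σ 1)) z * gradR u (J (τ 0)) z *
            ∏ i : Fin k, hess u (I (σ i.succ.succ)) (J (τ i.succ.succ)) z)
        + (wirt (-Complex.I) (I (σ 0)) χ z * wirt Complex.I (J (τ 1)) (gradR u (J (τ 0))) z *
          gradL u (I (σ 1)) z *
            ∏ i : Fin k, hess u (I (σ i.succ.succ)) (J (τ i.succ.succ)) z)
        + (wirt (-Complex.I) (I (σ 0)) χ z * gradR u (J (τ 0)) z * gradL u (I (σ 1)) z) *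
          wirt Complex.I (J (τ 1))
            (fun z => ∏ i : Fin k, hess u (I (σ i.succ.succ)) (J (τ i.succ.succ)) z) z := by
    intro σ τ
    have d1 : DifferentiableAt ℝ (wirt (-Complex.I) (I (σ 0)) χ) z :=
      (contDiffAt_wirt hχ.contDiffAt).differentiableAt (by simp)
    have d2 : DifferentiableAt ℝ (gradR u (J (τ 0))) z :=
      (hu.contDiffAt_gradR _ hz).differentiableAt (by simp)
    have d3 : DifferentiableAt ℝ (gradL u (I (σ 1))) z :=
      (hu.contDiffAt_gradL _ hz).differentiableAt (by simp)
    rw [wirt_mul ((d1.fun_mul d2).fun_mul d3) ((hP σ τ z hz).differentiableAt (by simp)),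
      wirt_mul (d1.fun_mul d2) d3, wirt_mul d1 d2, ← hu.hess_eq _ _ hz, Fin.prod_univ_succ,
      wirt_comm hχ.contDiffAt]
    simp only [Fin.succ_zero_eq_one]
    ring
  simp only [hz1]
  rw [altSum_add, altSum_add, altSum_add, altSum_wirt_prod_right (fun _ => hu) Finset.univ I J 1
    (fun i => i.succ.succ) (fun a b h => Fin.succ_injective _ (Fin.succ_injective _ h))
    (fun i _ => hne i) hz]
  · have z1 : altSum (fun σ τ : Perm (Fin (k + 2)) => wirt (-Complex.I) (I (σ 0)) χ z *
        wirt Complex.I (J (τ 1)) (gradR u (J (τ 0))) z * gradL u (I (σ 1)) z *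
            ∏ i : Fin k, hess u (I (σ i.succ.succ)) (J (τ i.succ.succ)) z) = 0 := by
      refine altSum_eq_zero_right fun σ => sum_sign_mul_eq_zero h01 fun τ => ?_
      simp only [hsw, Perm.mul_apply, swap_apply_left, swap_apply_right, gradR]
      rw [wirt_comm (hu.smooth_ofReal hz)]
    have z2 : altSum (fun σ τ : Perm (Fin (k + 2)) =>
        wirt (-Complex.I) (I (σ 0)) (wirt Complex.I (J (τ 1)) χ) z *
          (gradL u (I (σ 1)) z * gradR u (J (τ 0)) z *
            ∏ i : Fin k, hess u (I (σ i.succ.succ)) (J (τ i.succ.succ)) z))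
        = -formE u χ I J z := by
      rw [formE, ← altSum_swap_right h01]
      congr 1
    rw [z1, z2]
    simp [formC]
  · intro i _ σ τ
    rw [Perm.mul_apply, swap_apply_of_ne_of_ne h01]
    exact (Fin.succ_ne_zero _).symm

end Relations

/-! ### The total mass at the origin -/

theorem sum_sign_prod_eq_zero {K : ℕ} (hK : K = n) (J : Fin K → Fin n) (Y : Fin K → Fin n → ℂ)
    (ζ : Cn n) (hζ : ζ ≠ 0) (hY : ∀ i, ∑ q, Y i q * (starRingEnd ℂ) (ζ q) = 0) :
    ∑ τ : Perm (Fin K), ((Perm.sign τ : ℤ) : ℂ) * ∏ i, Y i (J (τ i)) = 0 := by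
  subst hK
  have h := Matrix.det_apply' (Matrix.of fun j i => Y i (J j))
  simp only [Matrix.of_apply] at h
  rw [← h]
  by_cases hJ : Function.Injective J
  · rw [← Matrix.det_transpose, ← Matrix.exists_mulVec_eq_zero_iff]
    have hb := Finite.injective_iff_bijective.1 hJ
    refine ⟨fun j => (starRingEnd ℂ) (ζ (J j)), fun h0 => hζ ?_, ?_⟩
    · ext q
      obtain ⟨j, rfl⟩ := hb.2 q
      simpa using congrFun h0 j
    · funext i
      simp only [Matrix.mulVec, dotProduct, Matrix.transpose_apply, Matrix.of_apply, Pi.zero_apply]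
      rw [hb.sum_comp (fun q => Y i q * (starRingEnd ℂ) (ζ q))]
      exact hY i
  · obtain ⟨a, b, hab, hne⟩ : ∃ a b, J a = J b ∧ a ≠ b := by
      simpa [Function.Injective] using hJ
    refine Matrix.det_zero_of_row_eq hne ?_
    funext i
    simp [hab]

/-- `(∂∂̄u)^n = 0` away from the origin. -/
theorem LogHom.formD_eq_zero {u : Cn n → ℝ} (hu : LogHom u) (I J : Fin n → Fin n) {z : Cn n}
    (hz : z ≠ 0) : formD u I J z = 0 :=
  altSum_eq_zero_right fun σ => sum_sign_prod_eq_zero rfl J (fun i q => hess u (I (σ i)) q z) z hz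
    fun _ => hu.sum_conj_mul_hess _ hz

section Mass

variable {k : ℕ}

/-- In top degree only the value of `du` on the radial field matters, so `u` may be replaced by any
other logarithmically homogeneous function in the factors `∂u` and `∂̄u`. -/
theorem formB_congr_grad (hk : k + 1 = n) {u v : Cn n → ℝ} (hu : LogHom u) (hv : LogHom v)
    {x : Fin k → Cn n → ℝ} (hx : ∀ i, LogHom (x i)) (I J : Fin (k + 1) → Fin n) {z : Cn n}
    (hz : z ≠ 0) : formB u x I J z = formB v x I J z := by
  have h1 : altSum (fun σ τ => gradL u (I (σ 0)) z * gradR u (J (τ 0)) z *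
      ∏ i : Fin k, hess (x i) (I (σ i.succ)) (J (τ i.succ)) z)
      = altSum (fun σ τ => gradL u (I (σ 0)) z * gradR v (J (τ 0)) z *
      ∏ i : Fin k, hess (x i) (I (σ i.succ)) (J (τ i.succ)) z) := by
    rw [← sub_eq_zero, ← altSum_sub]
    refine altSum_eq_zero_right fun σ => ?_
    have := sum_sign_prod_eq_zero hk J (fun i q => Fin.cases (gradR u q z - gradR v q z)
      (fun i => hess (x i) (I (σ i.succ)) q z) i) z hz (fun i => by
        refine Fin.cases ?_ (fun i => ?_) i
        · simp only [Fin.cases_zero, sub_mul, Finset.sum_sub_distrib]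
          rw [hu.sum_conj_mul_gradR hz, hv.sum_conj_mul_gradR hz, sub_self]
        · simp only [Fin.cases_succ]
          exact (hx i).sum_conj_mul_hess _ hz)
    simp only [Fin.prod_univ_succ, Fin.cases_zero, Fin.cases_succ] at this
    rw [← mul_zero (gradL u (I (σ 0)) z), ← this, Finset.mul_sum]
    refine Finset.sum_congr rfl fun τ _ => ?_
    ring
  have h2 : altSum (fun σ τ => gradL u (I (σ 0)) z * gradR v (J (τ 0)) z *
      ∏ i : Fin k, hess (x i) (I (σ i.succ)) (J (τ i.succ)) z)
      = altSum (fun σ τ => gradL v (I (σ 0)) z * gradR v (J (τ 0)) z *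
      ∏ i : Fin k, hess (x i) (I (σ i.succ)) (J (τ i.succ)) z) := by
    rw [← sub_eq_zero, ← altSum_sub]
    refine altSum_eq_zero_left fun τ => ?_
    -- the kernel of `∂∂̄x` in the holomorphic indices is spanned by `z`
    have := sum_sign_prod_eq_zero hk I (fun i p => Fin.cases (gradL u p z - gradL v p z)
      (fun i => hess (x i) p (J (τ i.succ)) z) i)
      (WithLp.toLp 2 fun p => (starRingEnd ℂ) (z p)) (fun h0 => hz (by
        ext p
        simpa using congrArg (fun w : Cn n => w p) h0)) (fun i => by
        refine Fin.cases ?_ (fun i => ?_) i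
        · simp only [Fin.cases_zero, sub_mul, Finset.sum_sub_distrib, Complex.conj_conj]
          rw [hu.sum_mul_gradL hz, hv.sum_mul_gradL hz, sub_self]
        · simp only [Fin.cases_succ, Complex.conj_conj]
          exact (hx i).sum_mul_hess _ hz)
    simp only [Fin.prod_univ_succ, Fin.cases_zero, Fin.cases_succ] at this
    rw [← mul_zero (gradR v (J (τ 0)) z), ← this, Finset.mul_sum]
    refine Finset.sum_congr rfl fun τ _ => ?_
    ring
  exact h1.trans h2

theorem homDeg_formB {u : Cn n → ℝ} (hu : LogHom u) {x : Fin k → Cn n → ℝ}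
    (hx : ∀ i, LogHom (x i)) (I J : Fin (k + 1) → Fin n) :
    HomDeg (formB u x I J) (2 * (k + 1)) := by
  have : 2 * (k + 1) = 1 + 1 + 2 * k := by ring
  rw [this]
  exact HomDeg.altSum fun σ τ => ((hu.homDeg_grad _ _).mul (hu.homDeg_grad _ _)).mul
    (HomDeg.prod fun i => (hx i).homDeg_hess _ _)

/-- The mean over a level set of a function of homogeneity `-2n` depends neither on the level nor on
the defining function. -/
theorem LogHom.levelMean_of_homDeg {u : Cn n → ℝ} {h : Cn n → ℂ}
    (hh : HomDeg h (2 * n)) (t : ℝ) : levelMean u h t = ∫ ζ : Sph n, h ζ ∂(sphMeas n) := by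
  refine integral_congr_ae (ae_of_all _ fun ζ => ?_)
  have := hh (Real.exp (t - u ζ)) (Real.exp_pos _) ζ (sph_ne_zero ζ)
  simp only [polarPt]
  rw [← this, ← Complex.ofReal_pow, ← Real.exp_nat_mul, mul_comm]
  push_cast
  rfl

/-- Exchanging one factor `∂∂̄x_i` does not change the mean: the difference is exact. -/
theorem integral_formB_update (hk : k + 1 = n) {v : Cn n → ℝ} (hv : LogHom v)
    {x : Fin k → Cn n → ℝ} (hx : ∀ i, LogHom (x i)) (i₀ : Fin k) {y : Cn n → ℝ} (hy : LogHom y)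
    (I J : Fin (k + 1) → Fin n) :
    ∫ ζ : Sph n, formB v x I J ζ ∂(sphMeas n)
      = ∫ ζ : Sph n, formB v (Function.update x i₀ y) I J ζ ∂(sphMeas n) := by
  have : NeZero n := ⟨by omega⟩
  have h0s : (0 : Fin (k + 1)) ≠ i₀.succ := (Fin.succ_ne_zero i₀).symm
  -- the remainder in the product rule
  set R : (Cn n → ℝ) → Cn n → ℂ := fun y z => altSum fun σ τ : Perm (Fin (k + 1)) =>
    gradL v (I (σ 0)) z * hess v (I (σ i₀.succ)) (J (τ 0)) z * gradR y (J (τ i₀.succ)) z *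
      ∏ i ∈ Finset.univ.erase i₀, hess (x i) (I (σ i.succ)) (J (τ i.succ)) z with hR
  set M : (Cn n → ℝ) → Cn n → ℂ := fun y z => altSum fun σ τ : Perm (Fin (k + 1)) =>
    gradL v (I (σ 0)) z * gradR v (J (τ 0)) z * (hess y (I (σ i₀.succ)) (J (τ i₀.succ)) z *
      ∏ i ∈ Finset.univ.erase i₀, hess (x i) (I (σ i.succ)) (J (τ i.succ)) z) with hM
  have hP : ∀ (σ τ : Perm (Fin (k + 1))) (z : Cn n), z ≠ 0 → ContDiffAt ℝ ∞
      (fun z => ∏ i ∈ Finset.univ.erase i₀, hess (x i) (I (σ i.succ)) (J (τ i.succ)) z) z :=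
    fun σ τ z hz => contDiffAt_prod_hess hx _ I J Fin.succ σ τ hz
  have hRc : ∀ y, LogHom y → ContinuousOn (R y) {0}ᶜ := by
    intro y hy z hz
    have : ContDiffAt ℝ ∞ (R y) z := by
      simp only [hR, altSum]
      exact ContDiffAt.sum fun σ _ => ContDiffAt.sum fun τ _ => contDiffAt_const.mul
        (contDiffAt_const.mul ((((hv.contDiffAt_gradL _ hz).mul (hv.contDiffAt_hess _ _ hz)).mul
          (hy.contDiffAt_gradR _ hz)).mul (hP σ τ z hz)))
    exact this.continuousAt.continuousWithinAt
  have hMc : ∀ y, LogHom y → ContinuousOn (M y) {0}ᶜ := by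
    intro y hy z hz
    have : ContDiffAt ℝ ∞ (M y) z := by
      simp only [hM, altSum]
      exact ContDiffAt.sum fun σ _ => ContDiffAt.sum fun τ _ => contDiffAt_const.mul
        (contDiffAt_const.mul (((hv.contDiffAt_gradL _ hz).mul (hv.contDiffAt_gradR _ hz)).mul
          ((hy.contDiffAt_hess _ _ hz).mul (hP σ τ z hz))))
    exact this.continuousAt.continuousWithinAt
  have key : ∀ y, LogHom y → levelMean v (M y) 0 + levelMean v (R y) 0 = 0 := by
    intro y hy
    have h := hasDerivAt_levelMean_altSum hv (h := fun σ τ z => gradL v (I (σ 0)) z *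
        gradR v (J (τ 0)) z * gradR y (J (τ i₀.succ)) z *
        ∏ i ∈ Finset.univ.erase i₀, hess (x i) (I (σ i.succ)) (J (τ i.succ)) z)
      (fun σ τ z hz => (((hv.contDiffAt_gradL _ hz).mul (hv.contDiffAt_gradR _ hz)).mul
        (hy.contDiffAt_gradR _ hz)).mul (hP σ τ z hz))
      (-Complex.I) (fun σ _ => I (σ i₀.succ)) 0
    have e1 : (fun z => altSum fun σ τ : Perm (Fin (k + 1)) => (gradL v (I (σ 0)) z *
        gradR v (J (τ 0)) z * gradR y (J (τ i₀.succ)) z *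
        ∏ i ∈ Finset.univ.erase i₀, hess (x i) (I (σ i.succ)) (J (τ i.succ)) z) *
        wirt (-Complex.I) (I (σ i₀.succ)) (fun z => (v z : ℂ)) z) = fun _ => 0 := by
      funext z
      refine altSum_eq_zero_left fun τ => sum_sign_mul_eq_zero h0s fun σ => ?_
      have : ∀ i ∈ Finset.univ.erase i₀, (swap (0 : Fin (k + 1)) i₀.succ) i.succ = i.succ :=
        fun i hi => swap_apply_of_ne_of_ne (Fin.succ_ne_zero _)
          (fun h => Finset.ne_of_mem_erase hi (Fin.succ_injective _ h))
      have e2 : ∏ i ∈ Finset.univ.erase i₀,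
          hess (x i) (I ((σ * swap (0 : Fin (k + 1)) i₀.succ : Perm (Fin (k + 1))) i.succ))
            (J (τ i.succ)) z
          = ∏ i ∈ Finset.univ.erase i₀, hess (x i) (I (σ i.succ)) (J (τ i.succ)) z :=
        Finset.prod_congr rfl fun i hi => by rw [Perm.mul_apply, this i hi]
      simp only [e2]
      simp only [Perm.mul_apply, swap_apply_left, swap_apply_right, gradL]
      ring
    rw [e1] at h
    have h0 : levelMean v (fun _ => 0) = fun _ => 0 := by
      funext t; simp [levelMean]
    rw [h0] at h
    rw [← levelMean_add hv (hMc y hy) (hRc y hy), ← h.unique (hasDerivAt_const 0 0)]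
    refine levelMean_congr (fun z hz => ?_) 0
    have hz1 : ∀ σ τ : Perm (Fin (k + 1)), wirt (-Complex.I) (I (σ i₀.succ)) (fun z =>
        gradL v (I (σ 0)) z * gradR v (J (τ 0)) z * gradR y (J (τ i₀.succ)) z *
        ∏ i ∈ Finset.univ.erase i₀, hess (x i) (I (σ i.succ)) (J (τ i.succ)) z) z
        = gradL v (I (σ 0)) z * gradR v (J (τ 0)) z * (hess y (I (σ i₀.succ)) (J (τ i₀.succ)) z *
            ∏ i ∈ Finset.univ.erase i₀, hess (x i) (I (σ i.succ)) (J (τ i.succ)) z)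
          + gradL v (I (σ 0)) z * hess v (I (σ i₀.succ)) (J (τ 0)) z *
            gradR y (J (τ i₀.succ)) z *
              ∏ i ∈ Finset.univ.erase i₀, hess (x i) (I (σ i.succ)) (J (τ i.succ)) z
          + wirt (-Complex.I) (I (σ i₀.succ)) (gradL v (I (σ 0))) z * gradR v (J (τ 0)) z *
            gradR y (J (τ i₀.succ)) z *
              ∏ i ∈ Finset.univ.erase i₀, hess (x i) (I (σ i.succ)) (J (τ i.succ)) z
          + (gradL v (I (σ 0)) z * gradR v (J (τ 0)) z * gradR y (J (τ i₀.succ)) z) *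
            wirt (-Complex.I) (I (σ i₀.succ)) (fun z => ∏ i ∈ Finset.univ.erase i₀,
              hess (x i) (I (σ i.succ)) (J (τ i.succ)) z) z := by
      intro σ τ
      have d1 : DifferentiableAt ℝ (gradL v (I (σ 0))) z :=
        (hv.contDiffAt_gradL _ hz).differentiableAt (by simp)
      have d2 : DifferentiableAt ℝ (gradR v (J (τ 0))) z :=
        (hv.contDiffAt_gradR _ hz).differentiableAt (by simp)
      have d3 : DifferentiableAt ℝ (gradR y (J (τ i₀.succ))) z :=
        (hy.contDiffAt_gradR _ hz).differentiableAt (by simp)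
      rw [wirt_mul ((d1.fun_mul d2).fun_mul d3) ((hP σ τ z hz).differentiableAt (by simp)),
        wirt_mul (d1.fun_mul d2) d3, wirt_mul d1 d2]
      simp only [hess]
      ring
    simp only [hz1]
    rw [altSum_add, altSum_add, altSum_add, altSum_wirt_prod_left hx (Finset.univ.erase i₀) I J
      i₀.succ Fin.succ (Fin.succ_injective _)
      (fun i hi h => Finset.ne_of_mem_erase hi (Fin.succ_injective _ h)) hz]
    · have z1 : altSum (fun σ τ : Perm (Fin (k + 1)) =>
          wirt (-Complex.I) (I (σ i₀.succ)) (gradL v (I (σ 0))) z * gradR v (J (τ 0)) z *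
            gradR y (J (τ i₀.succ)) z *
              ∏ i ∈ Finset.univ.erase i₀, hess (x i) (I (σ i.succ)) (J (τ i.succ)) z) = 0 := by
        refine altSum_eq_zero_left fun τ => sum_sign_mul_eq_zero h0s fun σ => ?_
        have : ∀ i ∈ Finset.univ.erase i₀, (swap (0 : Fin (k + 1)) i₀.succ) i.succ = i.succ :=
          fun i hi => swap_apply_of_ne_of_ne (Fin.succ_ne_zero _)
            (fun h => Finset.ne_of_mem_erase hi (Fin.succ_injective _ h))
        have e2 : ∏ i ∈ Finset.univ.erase i₀,
            hess (x i) (I ((σ * swap (0 : Fin (k + 1)) i₀.succ : Perm (Fin (k + 1))) i.succ))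
              (J (τ i.succ)) z
            = ∏ i ∈ Finset.univ.erase i₀, hess (x i) (I (σ i.succ)) (J (τ i.succ)) z :=
          Finset.prod_congr rfl fun i hi => by rw [Perm.mul_apply, this i hi]
        simp only [e2]
        simp only [Perm.mul_apply, swap_apply_left, swap_apply_right, gradL]
        rw [wirt_comm (hv.smooth_ofReal hz)]
      rw [z1, add_zero, add_zero]
    · intro i hi σ τ
      rw [Perm.mul_apply, swap_apply_of_ne_of_ne h0s (Fin.succ_ne_zero _).symm]
  -- the remainder does not depend on the exchanged function
  have hRR : ∀ y, LogHom y → levelMean v (R y) 0 = levelMean v (R (x i₀)) 0 := by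
    intro y hy
    refine levelMean_congr (fun z hz => ?_) 0
    simp only [hR]
    rw [← sub_eq_zero, ← altSum_sub]
    refine altSum_eq_zero_right fun σ => ?_
    have := sum_sign_prod_eq_zero hk J (fun i q => Fin.cases (hess v (I (σ i₀.succ)) q z)
      (fun i => if i = i₀ then gradR y q z - gradR (x i₀) q z
        else hess (x i) (I (σ i.succ)) q z) i) z hz (fun i => by
        refine Fin.cases ?_ (fun i => ?_) i
        · simp only [Fin.cases_zero]
          exact hv.sum_conj_mul_hess _ hz
        · simp only [Fin.cases_succ]
          by_cases hi : i = i₀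
          · simp only [hi, if_true, sub_mul, Finset.sum_sub_distrib]
            rw [hy.sum_conj_mul_gradR hz, (hx i₀).sum_conj_mul_gradR hz, sub_self]
          · simp only [hi, if_false]
            exact (hx i).sum_conj_mul_hess _ hz)
    simp only [Fin.prod_univ_succ, Fin.cases_zero, Fin.cases_succ] at this
    rw [← mul_zero (gradL v (I (σ 0)) z), ← this, Finset.mul_sum]
    refine Finset.sum_congr rfl fun τ _ => ?_
    rw [← Finset.mul_prod_erase Finset.univ _ (Finset.mem_univ i₀)]
    have e3 : ∏ i ∈ Finset.univ.erase i₀, (if i = i₀ then gradR y (J (τ i.succ)) z -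
        gradR (x i₀) (J (τ i.succ)) z else hess (x i) (I (σ i.succ)) (J (τ i.succ)) z)
        = ∏ i ∈ Finset.univ.erase i₀, hess (x i) (I (σ i.succ)) (J (τ i.succ)) z :=
      Finset.prod_congr rfl fun i hi => if_neg (Finset.ne_of_mem_erase hi)
    rw [e3]
    simp only [if_true]
    ring
  have e4 : formB v x I J = M (x i₀) := by
    funext z
    simp only [formB, hM]
    congr 1; funext σ τ
    rw [Finset.mul_prod_erase Finset.univ (fun i => hess (x i) (I (σ i.succ)) (J (τ i.succ)) z)
      (Finset.mem_univ i₀)]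
  have e5 : formB v (Function.update x i₀ y) I J = M y := by
    funext z
    simp only [formB, hM]
    congr 1; funext σ τ
    rw [← Finset.mul_prod_erase Finset.univ _ (Finset.mem_univ i₀), Function.update_self]
    congr 2
    exact Finset.prod_congr rfl fun i hi => by
      rw [Function.update_of_ne (Finset.ne_of_mem_erase hi)]
  have hxy : ∀ i, LogHom (Function.update x i₀ y i) := fun i => by
    by_cases hi : i = i₀
    · subst hi; simpa using hy
    · simpa [Function.update_of_ne hi] using hx i
  subst hk
  rw [← LogHom.levelMean_of_homDeg (u := v) (homDeg_formB hv hx I J) 0,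
    ← LogHom.levelMean_of_homDeg (u := v) (homDeg_formB hv hxy I J) 0, e4, e5]
  linear_combination key _ (hx i₀) - key _ hy + hRR y hy

theorem integral_formB_eq (hk : k + 1 = n) {u v : Cn n → ℝ} (hu : LogHom u) (hv : LogHom v)
    (I J : Fin (k + 1) → Fin n) :
    ∫ ζ : Sph n, formB u (fun _ : Fin k => u) I J ζ ∂(sphMeas n)
      = ∫ ζ : Sph n, formB v (fun _ : Fin k => v) I J ζ ∂(sphMeas n) := by
  classical
  have h1 : ∀ ζ : Sph n, formB u (fun _ : Fin k => u) I J ζ = formB v (fun _ : Fin k => u) I J ζ :=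
    fun ζ => formB_congr_grad hk hu hv (fun _ => hu) I J (sph_ne_zero ζ)
  simp only [h1]
  have h2 : ∀ s : Finset (Fin k), ∫ ζ : Sph n, formB v (fun _ : Fin k => u) I J ζ ∂(sphMeas n)
      = ∫ ζ : Sph n, formB v (fun i : Fin k => if i ∈ s then v else u) I J ζ ∂(sphMeas n) := by
    intro s
    induction s using Finset.induction_on with
    | empty => simp
    | insert a s ha ih =>
      rw [ih, integral_formB_update hk hv (fun i => by split_ifs <;> assumption) a hv]
      have : Function.update (fun i : Fin k => if i ∈ s then v else u) a v
          = fun i : Fin k => if i ∈ insert a s then v else u := by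
        funext i
        by_cases hi : i = a
        · subst hi; simp
        · simp [hi]
      rw [this]
  simpa using h2 Finset.univ

end Mass

/-! ### Positivity, and the explicit mass of `log |z|` -/

theorem conj_gradL (u : Cn n → ℝ) (p : Fin n) (z : Cn n) :
    (starRingEnd ℂ) (gradL u p z) = gradR u p z := by
  simp [gradL, gradR, conj_wirt]

open scoped MatrixOrder ComplexOrder in
/-- The form `∂u ∧ ∂̄u ∧ (∂∂̄u)^k` is positive if `∂∂̄u` is: its diagonal coefficients are sums of
squares of minors. -/
theorem formB_nonneg {k : ℕ} {u : Cn n → ℝ} {z : Cn n}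
    (hpsd : (Matrix.of fun p q => hess u p q z).PosSemidef) (I : Fin (k + 1) → Fin n) :
    ∃ r : ℝ, 0 ≤ r ∧ formB u (fun _ : Fin k => u) I I z = r := by
  obtain ⟨B, hB⟩ := CStarAlgebra.nonneg_iff_eq_star_mul_self.mp hpsd.nonneg
  have hH : ∀ p q, hess u p q z = ∑ l, (starRingEnd ℂ) (B l p) * B l q := fun p q => by
    have := congrFun (congrFun hB p) q
    simpa [Matrix.mul_apply, Matrix.star_eq_conjTranspose] using this
  set m : (Fin k → Fin n) → ℂ := fun l => ∑ σ : Perm (Fin (k + 1)), ((Perm.sign σ : ℤ) : ℂ) *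
    (gradL u (I (σ 0)) z * ∏ i : Fin k, (starRingEnd ℂ) (B (l i) (I (σ i.succ)))) with hm
  refine ⟨∑ l : Fin k → Fin n, Complex.normSq (m l),
    Finset.sum_nonneg fun l _ => Complex.normSq_nonneg _, ?_⟩
  push_cast
  simp only [← Complex.mul_conj]
  simp only [formB, altSum, hH, Finset.prod_univ_sum, Fintype.piFinset_univ,
    Finset.prod_mul_distrib, hm, map_sum, map_mul, map_prod, Complex.conj_conj, conj_gradL,
    Finset.sum_mul_sum, map_intCast]
  rw [Finset.sum_comm' (t' := Finset.univ) (s' := fun _ => Finset.univ) (by simp)]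
  rw [Finset.sum_comm]
  conv_rhs => rw [Finset.sum_comm]
  refine Finset.sum_congr rfl fun σ _ => ?_
  conv_rhs => rw [Finset.sum_comm]
  refine Finset.sum_congr rfl fun τ _ => ?_
  rw [Finset.mul_sum, Finset.mul_sum, Finset.mul_sum]
  refine Finset.sum_congr rfl fun l _ => ?_
  ring

/-- `log |z|`. -/
def logNorm (z : Cn n) : ℝ := Real.log ‖z‖

theorem logHom_logNorm : LogHom (logNorm : Cn n → ℝ) where
  smooth := fun z hz => ((contDiffAt_norm ℝ hz).log (norm_ne_zero_iff.2 hz)).contDiffWithinAt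
  hom := fun a z ha hz => by
    simp only [logNorm, norm_smul]
    exact Real.log_mul (norm_ne_zero_iff.2 ha) (norm_ne_zero_iff.2 hz)

theorem exp_logNorm {z : Cn n} (hz : z ≠ 0) : Real.exp (-2 * logNorm z) = (‖z‖ ^ 2)⁻¹ := by
  have h0 : 0 < ‖z‖ := norm_pos_iff.2 hz
  rw [logNorm, show -2 * Real.log ‖z‖ = -(((2 : ℕ) : ℝ) * Real.log ‖z‖) by push_cast; ring,
    Real.exp_neg, Real.exp_nat_mul, Real.exp_log h0]

theorem wirt_logNorm (c : ℂ) (p : Fin n) {z : Cn n} (hz : z ≠ 0) :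
    wirt c p (fun z => (logNorm z : ℂ)) z = (((z p).re : ℂ) + c * ((z p).im : ℂ)) / (2 * ‖z‖ ^ 2) := by
  have h0 : (‖z‖ : ℝ) ^ 2 ≠ 0 := pow_ne_zero 2 (norm_ne_zero_iff.2 hz)
  have e : (fun z : Cn n => (logNorm z : ℂ)) = fun z => ((Real.log (‖z‖ ^ 2) / 2 : ℝ) : ℂ) := by
    funext z; rw [Real.log_pow, logNorm]; push_cast; ring
  have h1 : HasFDerivAt (fun z : Cn n => ‖z‖ ^ 2) (2 • (innerSL ℝ z)) z :=
    (hasStrictFDerivAt_norm_sq z).hasFDerivAt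
  have h2 := (h1.log h0).mul_const (1 / 2 : ℝ)
  have h3 : HasFDerivAt (fun z : Cn n => ((Real.log (‖z‖ ^ 2) * (1 / 2) : ℝ) : ℂ)) _ z :=
    Complex.ofRealCLM.hasFDerivAt.comp z h2
  have e' : (fun z : Cn n => (logNorm z : ℂ))
      = fun z => ((Real.log (‖z‖ ^ 2) * (1 / 2) : ℝ) : ℂ) := by
    rw [e]; funext z; congr 1; ring
  simp only [wirt, e', h3.fderiv]
  have hin : ∀ a : ℂ, inner ℝ z (EuclideanSpace.single p a) = ((starRingEnd ℂ) (z p) * a).re := by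
    intro a
    rw [PiLp.inner_apply, Finset.sum_eq_single p]
    · simp [Complex.inner, mul_comm]
    · intro b _ hb
      simp [hb]
    · simp
  have h0' : (‖z‖ : ℂ) ≠ 0 := by exact_mod_cast norm_ne_zero_iff.2 hz
  simp [hin]
  field_simp

theorem gradR_logNorm (q : Fin n) {z : Cn n} (hz : z ≠ 0) :
    gradR logNorm q z = z q * (((1 / 2 : ℝ) * Real.exp (-2 * logNorm z) : ℝ) : ℂ) := by
  rw [gradR, wirt_logNorm _ _ hz, exp_logNorm hz]
  conv_rhs => rw [← Complex.re_add_im (z q)]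
  push_cast
  field_simp

theorem hess_logNorm (p q : Fin n) {z : Cn n} (hz : z ≠ 0) :
    hess logNorm p q z = (if q = p then (((2 * ‖z‖ ^ 2)⁻¹ : ℝ) : ℂ) else 0)
      + (-2 * gradR logNorm q z) * gradL logNorm p z := by
  have hu := logHom_logNorm (n := n)
  have h1 : gradR logNorm q =ᶠ[𝓝 z]
      fun z => z q * (((1 / 2 : ℝ) * Real.exp (-2 * logNorm z) : ℝ) : ℂ) := by
    filter_upwards [isOpen_compl_singleton.mem_nhds (show z ∈ ({0}ᶜ : Set (Cn n)) from hz)]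
      with w hw using gradR_logNorm q hw
  have hg : ContDiff ℝ ∞ fun s : ℝ => (1 / 2 : ℝ) * Real.exp (-2 * s) := by fun_prop
  have hd : DifferentiableAt ℝ
      (fun z : Cn n => (((1 / 2 : ℝ) * Real.exp (-2 * logNorm z) : ℝ) : ℂ)) z :=
    (Complex.ofRealCLM.contDiff.contDiffAt.comp z
      (hg.contDiffAt.comp z (hu.contDiffAt hz))).differentiableAt (n := ∞) (by simp)
  have hder : deriv (fun s : ℝ => (1 / 2 : ℝ) * Real.exp (-2 * s)) (logNorm z)
      = -Real.exp (-2 * logNorm z) := by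
    have := ((((hasDerivAt_id (logNorm z)).const_mul (-2 : ℝ)).exp).const_mul (1 / 2 : ℝ)).deriv
    simp only [id] at this
    rw [this]; ring
  rw [hess, wirt_congr h1, wirt_mul (differentiable_coord q z) hd,
    hu.wirt_comp hg hz, wirt_coord, hder, gradR_logNorm q hz]
  have e1 : (((1 / 2 : ℝ) * Real.exp (-2 * logNorm z) : ℝ) : ℂ) = (((2 * ‖z‖ ^ 2)⁻¹ : ℝ) : ℂ) := by
    rw [exp_logNorm hz]; push_cast; rw [mul_inv]; norm_num
  have e2 : ((-Real.exp (-2 * logNorm z) : ℝ) : ℂ)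
      = -2 * (((1 / 2 : ℝ) * Real.exp (-2 * logNorm z) : ℝ) : ℂ) := by
    push_cast; ring
  rw [e2, e1, gradL]
  split_ifs
  · simp; ring
  · simp; ring

theorem sum_perm_apply_zero {k : ℕ} (f : Fin (k + 1) → ℂ) :
    ∑ σ : Perm (Fin (k + 1)), f (σ 0) = (k.factorial : ℂ) * ∑ j, f j := by
  rw [← Equiv.sum_comp Perm.decomposeFin.symm, Fintype.sum_prod_type, Finset.mul_sum]
  simp [Fintype.card_perm]

/-- A rank-one perturbation `H + b aᵀ` of the factors `H` is invisible in `a ∧ H ∧ ⋯ ∧ H`. -/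
theorem sum_sign_mul_prod_add {k : ℕ} (a b : Fin (k + 1) → ℂ) (H : Fin (k + 1) → Fin k → ℂ)
    (c : Fin k → ℂ) (ha : b = a) :
    ∑ σ : Perm (Fin (k + 1)), ((Perm.sign σ : ℤ) : ℂ) *
        (a (σ 0) * ∏ i : Fin k, (H (σ i.succ) i + c i * b (σ i.succ)))
      = ∑ σ : Perm (Fin (k + 1)), ((Perm.sign σ : ℤ) : ℂ) *
        (a (σ 0) * ∏ i : Fin k, H (σ i.succ) i) := by
  subst ha
  have h := Matrix.det_eq_of_forall_row_eq_smul_add_const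
    (A := Matrix.of fun (i j : Fin (k + 1)) => Fin.cases (b j) (fun i => H j i + c i * b j) i)
    (B := Matrix.of fun (i j : Fin (k + 1)) => Fin.cases (b j) (fun i => H j i) i)
    (Fin.cases 0 c) 0 rfl (by
      intro i j
      refine Fin.cases ?_ (fun i => ?_) i <;> simp)
  rw [← Matrix.det_transpose, ← Matrix.det_transpose (Matrix.of _), Matrix.det_apply',
    Matrix.det_apply'] at h
  simpa [Fin.prod_univ_succ] using h

theorem formB_logNorm {k : ℕ} {z : Cn (k + 1)} (hz : z ≠ 0) :
    formB logNorm (fun _ : Fin k => logNorm) id id z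
      = (((k.factorial : ℝ) * (2 * ‖z‖ ^ 2)⁻¹ ^ k * (4 * ‖z‖ ^ 2)⁻¹ : ℝ) : ℂ) := by
  have h1 : formB logNorm (fun _ : Fin k => logNorm) id id z
      = ∑ τ : Perm (Fin (k + 1)), ∑ σ : Perm (Fin (k + 1)), ((Perm.sign τ : ℤ) : ℂ) *
        (gradR logNorm (τ 0) z * (((Perm.sign σ : ℤ) : ℂ) * (gradL logNorm (σ 0) z *
          ∏ i : Fin k, (if τ i.succ = σ i.succ then (((2 * ‖z‖ ^ 2)⁻¹ : ℝ) : ℂ) else 0)))) := by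
    simp only [formB, altSum, id]
    rw [Finset.sum_comm]
    refine Finset.sum_congr rfl fun τ _ => ?_
    have := sum_sign_mul_prod_add (k := k) (fun p => gradL logNorm p z)
      (fun p => gradL logNorm p z)
      (fun p i => if τ i.succ = p then (((2 * ‖z‖ ^ 2)⁻¹ : ℝ) : ℂ) else 0)
      (fun i => -2 * gradR logNorm (τ i.succ) z) rfl
    simp only [← hess_logNorm _ _ hz] at this
    rw [← Finset.mul_sum, ← Finset.mul_sum, ← this, Finset.mul_sum, Finset.mul_sum]
    refine Finset.sum_congr rfl fun σ _ => ?_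
    ring
  rw [h1]
  have h2 : ∀ τ : Perm (Fin (k + 1)), ∑ σ : Perm (Fin (k + 1)), ((Perm.sign τ : ℤ) : ℂ) *
        (gradR logNorm (τ 0) z * (((Perm.sign σ : ℤ) : ℂ) * (gradL logNorm (σ 0) z *
          ∏ i : Fin k, (if τ i.succ = σ i.succ then (((2 * ‖z‖ ^ 2)⁻¹ : ℝ) : ℂ) else 0))))
      = (((2 * ‖z‖ ^ 2)⁻¹ : ℝ) : ℂ) ^ k * (gradL logNorm (τ 0) z * gradR logNorm (τ 0) z) := by
    intro τ
    rw [Finset.sum_eq_single τ]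
    · have hs : ((Perm.sign τ : ℤ) : ℂ) * ((Perm.sign τ : ℤ) : ℂ) = 1 := by
        rcases Int.units_eq_one_or (Perm.sign τ) with h | h <;> simp [h]
      simp only [if_true, Finset.prod_const, Finset.card_univ, Fintype.card_fin]
      linear_combination (gradR logNorm (τ 0) z * gradL logNorm (τ 0) z *
        (((2 * ‖z‖ ^ 2)⁻¹ : ℝ) : ℂ) ^ k) * hs
    · intro σ _ hσ
      have : ∃ i : Fin k, τ i.succ ≠ σ i.succ := by
        by_contra hcon
        push Not at hcon
        -- two permutations that agree off `0` agree
        refine hσ (Equiv.ext fun j => ?_)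
        refine Fin.cases ?_ (fun i => (hcon i).symm) j
        obtain ⟨l, hl⟩ := σ.surjective (τ 0)
        rcases Fin.eq_zero_or_eq_succ l with h | ⟨i, h⟩
        · rw [← hl, h]
        · rw [h, ← hcon i] at hl
          exact absurd (τ.injective hl) (Fin.succ_ne_zero i)
      obtain ⟨i, hi⟩ := this
      rw [Finset.prod_eq_zero (Finset.mem_univ i) (if_neg hi)]
      ring
    · simp
  simp only [h2]
  rw [← Finset.mul_sum, sum_perm_apply_zero (fun j => gradL logNorm j z * gradR logNorm j z)]
  have h3 : ∑ j, gradL logNorm j z * gradR logNorm j z = (((4 * ‖z‖ ^ 2)⁻¹ : ℝ) : ℂ) := by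
    have h4 := logHom_logNorm.sum_mul_gradL hz
    have : ∀ j, gradL logNorm j z * gradR logNorm j z
        = (((2 * ‖z‖ ^ 2)⁻¹ : ℝ) : ℂ) * (gradL logNorm j z * z j) := fun j => by
      rw [gradR_logNorm j hz, exp_logNorm hz]
      push_cast
      rw [mul_inv]
      ring
    simp only [this]
    rw [← Finset.mul_sum, h4]
    push_cast
    rw [mul_inv, mul_inv]
    ring
  rw [h3]
  push_cast
  ring

/-- `(dd^c u)^n` has mass `2^{-n}`; in terms of coefficients, the mass of `(∂∂̄u)^n` is
`(π / 2)^n`. -/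
theorem integral_formB (k : ℕ) {u : Cn (k + 1) → ℝ} (hu : LogHom u) :
    ∫ ζ : Sph (k + 1), formB u (fun _ : Fin k => u) id id ζ ∂(sphMeas (k + 1))
      = (((Real.pi / 2) ^ (k + 1) : ℝ) : ℂ) := by
  rw [integral_formB_eq rfl hu logHom_logNorm]
  have h1 : ∀ ζ : Sph (k + 1), formB logNorm (fun _ : Fin k => logNorm) id id (ζ : Cn (k + 1))
      = (((k.factorial : ℝ) * (2 : ℝ)⁻¹ ^ k * (4 : ℝ)⁻¹ : ℝ) : ℂ) := fun ζ => by
    rw [formB_logNorm (sph_ne_zero ζ), norm_eq_of_mem_sphere ζ]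
    norm_num
  simp only [h1]
  rw [integral_const, Measure.toSphere_real_apply_univ, finrank_Cn, Measure.real,
    InnerProductSpace.volume_ball, finrank_Cn]
  have e1 : Real.Gamma (((2 * (k + 1) : ℕ) : ℝ) / 2 + 1) = (k + 1) * k.factorial := by
    rw [show ((2 * (k + 1) : ℕ) : ℝ) / 2 + 1 = ((k + 1 : ℕ) : ℝ) + 1 by push_cast; ring,
      Real.Gamma_nat_eq_factorial, Nat.factorial_succ]
    push_cast; ring
  rw [e1, pow_mul √Real.pi, Real.sq_sqrt Real.pi_pos.le, ENNReal.ofReal_one, one_pow, one_mul,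
    ENNReal.toReal_ofReal (by positivity), Complex.real_smul, ← Complex.ofReal_mul]
  congr 1
  have hk : (k.factorial : ℝ) ≠ 0 := by exact_mod_cast k.factorial_ne_zero
  have hk1 : ((k : ℝ) + 1) ≠ 0 := by positivity
  push_cast
  rw [div_pow, pow_succ (2 : ℝ) k, inv_pow]
  field_simp
  ring

/-! ### Convex increasing functions on the negative half-line -/

/-- The right derivative of a function of one real variable. -/
def rd (f : ℝ → ℝ) (x : ℝ) : ℝ := derivWithin f (Set.Ioi x) x

/-- The functions `f` of the theorem: convex and increasing on `(-∞, 0)`, with limit `0` at `0`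
(and measurable on the line, a condition on the irrelevant values on `[0, ∞)`). -/
structure Profile (f : ℝ → ℝ) : Prop where
  convex : ConvexOn ℝ (Set.Iio 0) f
  mono : MonotoneOn f (Set.Iio 0)
  lim : Tendsto f (𝓝[<] 0) (𝓝 0)
  meas : Measurable f

/-- Distribution functions on `(-∞, 0)`: increasing, nonnegative and right-continuous. -/
structure RCMono (F : ℝ → ℝ) : Prop where
  mono : MonotoneOn F (Set.Iio 0)
  nonneg : ∀ x < 0, 0 ≤ F x
  rc : ∀ x < 0, ContinuousWithinAt F (Set.Ici x) x

theorem Profile.hasDeriv {f : ℝ → ℝ} (hf : Profile f) {x : ℝ} (hx : x < 0) :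
    HasDerivWithinAt f (rd f x) (Set.Ioi x) x :=
  hf.convex.hasDerivWithinAt_rightDeriv_of_mem_interior (by simpa using hx)

theorem Profile.continuousOn {f : ℝ → ℝ} (hf : Profile f) : ContinuousOn f (Set.Iio 0) := by
  simpa using hf.convex.continuousOn_interior

theorem Profile.nonpos {f : ℝ → ℝ} (hf : Profile f) {x : ℝ} (hx : x < 0) : f x ≤ 0 := by
  refine ge_of_tendsto hf.lim ?_
  filter_upwards [Ioo_mem_nhdsLT hx] with y hy
  exact hf.mono hx hy.2 hy.1.le

theorem Profile.rd_nonneg {f : ℝ → ℝ} (hf : Profile f) {x : ℝ} (hx : x < 0) : 0 ≤ rd f x := by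
  rw [rd, hf.convex.rightDeriv_eq_sInf_slope_of_mem_interior (by simpa using hx)]
  apply Real.sInf_nonneg
  rintro _ ⟨y, ⟨hy, hxy⟩, rfl⟩
  rw [slope_def_field]
  exact div_nonneg (sub_nonneg.2 (hf.mono hx hy hxy.le)) (sub_nonneg.2 hxy.le)

theorem Profile.rd_mono {f : ℝ → ℝ} (hf : Profile f) : MonotoneOn (rd f) (Set.Iio 0) := by
  have := hf.convex.monotoneOn_rightDeriv
  rwa [interior_Iio] at this

theorem Profile.rd_le_slope {f : ℝ → ℝ} (hf : Profile f) {x y : ℝ} (hy : y < 0) (hxy : x < y) :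
    rd f x ≤ slope f x y :=
  hf.convex.rightDeriv_le_slope_of_mem_interior (by simpa using hxy.trans hy) hy hxy

theorem Profile.rcMono {f : ℝ → ℝ} (hf : Profile f) : RCMono (rd f) := by
  refine ⟨hf.rd_mono, fun x hx => hf.rd_nonneg hx, fun x hx => ?_⟩
  rw [← continuousWithinAt_Ioi_iff_Ici, ContinuousWithinAt, tendsto_order]
  constructor
  · intro a ha
    filter_upwards [Ioo_mem_nhdsGT hx] with y hy
    exact ha.trans_le (hf.rd_mono hx hy.2 hy.1.le)
  · intro a ha
    -- near `x` the right derivative lies below a slope, which is continuous in its left endpoint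
    have h1 : Tendsto (slope f x) (𝓝[>] x) (𝓝 (rd f x)) :=
      (hasDerivWithinAt_iff_tendsto_slope' (by simp)).1 (hf.hasDeriv hx)
    obtain ⟨w, hw, hxw, hw0⟩ : ∃ w, slope f x w < a ∧ x < w ∧ w < 0 := by
      have := ((tendsto_order.1 h1).2 a ha).and (Ioo_mem_nhdsGT hx)
      obtain ⟨w, h⟩ := this.exists
      exact ⟨w, h.1, h.2⟩
    have h2 : ContinuousAt (fun y => slope f y w) x := by
      simp only [slope_def_field]
      have hc : ContinuousAt f x := hf.continuousOn.continuousAt (Iio_mem_nhds hx)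
      exact (continuousAt_const.sub hc).div (continuousAt_const.sub continuousAt_id)
        (sub_ne_zero.2 hxw.ne')
    have h3 := (h2.tendsto.eventually_lt_const hw)
    filter_upwards [nhdsWithin_le_nhds h3, Ioo_mem_nhdsGT hxw] with y hy hy'
    exact (hf.rd_le_slope hw0 hy'.2).trans_lt hy

theorem RCMono.pow {F : ℝ → ℝ} (hF : RCMono F) (k : ℕ) : RCMono fun x => F x ^ k :=
  ⟨fun _ hx _ hy hxy => pow_le_pow_left₀ (hF.nonneg _ hx) (hF.mono hx hy hxy) k,
    fun x hx => pow_nonneg (hF.nonneg x hx) k, fun x hx => (hF.rc x hx).pow k⟩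

theorem Profile.ae_deriv_eq {f : ℝ → ℝ} (hf : Profile f) :
    ∀ᵐ x ∂(volume.restrict (Set.Iio (0 : ℝ))), deriv f x = rd f x := by
  rw [ae_restrict_iff' measurableSet_Iio]
  filter_upwards [hf.mono.ae_differentiableWithinAt_of_mem] with x h hx
  have hd : DifferentiableAt ℝ f x := (h hx).differentiableAt (Iio_mem_nhds hx)
  rw [rd, hd.derivWithin (uniqueDiffWithinAt_Ioi x)]

/-- A convex increasing function grows at most linearly at `-∞`. -/
theorem Profile.abs_le {f : ℝ → ℝ} (hf : Profile f) :
    ∃ a : ℝ, 0 ≤ a ∧ ∀ x < 0, |f x| ≤ a * (1 + |x|) := by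
  have hm1 : (-1 : ℝ) < 0 := by norm_num
  refine ⟨|f (-1)| + rd f (-1), add_nonneg (abs_nonneg _) (hf.rd_nonneg hm1), fun x hx => ?_⟩
  have hr := hf.rd_nonneg hm1
  have h0 : |f x| = -f x := abs_of_nonpos (hf.nonpos hx)
  have h1 : |f (-1)| = -f (-1) := abs_of_nonpos (hf.nonpos hm1)
  have hx' : |x| = -x := abs_of_neg hx
  rcases le_or_gt (-1) x with h | h
  · have := hf.mono hm1 hx h
    rw [h0, h1, hx']
    nlinarith [hf.nonpos hm1]
  · -- the slope over `[x, -1]` is at most the right derivative at `-1`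
    have h2 : (f (-1) - f x) / (-1 - x) ≤ rd f (-1) := by
      refine ge_of_tendsto ((hasDerivWithinAt_iff_tendsto_slope' (by simp)).1 (hf.hasDeriv hm1)) ?_
      filter_upwards [Ioo_mem_nhdsGT hm1] with y hy
      rw [slope_def_field]
      exact hf.convex.slope_mono_adjacent hx hy.2 h hy.1
    rw [div_le_iff₀ (by linarith)] at h2
    rw [h0, h1, hx']
    nlinarith [hf.nonpos hm1]

/-! ### Stieltjes measures on the negative half-line -/

/-- The limit of `F` at `-∞`, for `F` increasing and bounded below. -/
def limBot (F : ℝ → ℝ) : ℝ := sInf (F '' Set.Iio 0)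

theorem RCMono.bddBelow {F : ℝ → ℝ} (hF : RCMono F) : BddBelow (F '' Set.Iio 0) :=
  ⟨0, by rintro _ ⟨x, hx, rfl⟩; exact hF.nonneg x hx⟩

theorem RCMono.limBot_le {F : ℝ → ℝ} (hF : RCMono F) {x : ℝ} (hx : x < 0) : limBot F ≤ F x :=
  csInf_le hF.bddBelow ⟨x, hx, rfl⟩

theorem RCMono.limBot_nonneg {F : ℝ → ℝ} (hF : RCMono F) : 0 ≤ limBot F :=
  Real.sInf_nonneg (by rintro _ ⟨x, hx, rfl⟩; exact hF.nonneg x hx)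

theorem RCMono.tendsto {F : ℝ → ℝ} (hF : RCMono F) : Tendsto F atBot (𝓝 (limBot F)) := by
  rw [tendsto_order]
  constructor
  · intro a ha
    filter_upwards [Iio_mem_atBot (0 : ℝ)] with x hx
    exact ha.trans_le (hF.limBot_le hx)
  · intro a ha
    obtain ⟨_, ⟨y, hy, rfl⟩, hya⟩ := exists_lt_of_csInf_lt
      (Set.Nonempty.image F ⟨(-1 : ℝ), by norm_num⟩) ha
    filter_upwards [Iic_mem_atBot y] with x hx
    exact (hF.mono (Set.mem_Iio.2 (lt_of_le_of_lt hx hy)) hy hx).trans_lt hya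

/-- The Stieltjes measure `dF` on `(-∞, 0)`. The half-line is parametrized by the real line, so
that Mathlib's Stieltjes measures apply. -/
theorem RCMono.exists_measure {F : ℝ → ℝ} (hF : RCMono F) :
    ∃ M : Measure ℝ, SFinite M ∧ M (Set.Ici 0) = 0 ∧
      ∀ x < 0, M (Set.Iic x) = ENNReal.ofReal (F x - limBot F) := by
  have hn : ∀ s : ℝ, -Real.exp (-s) < 0 := fun s => neg_lt_zero.2 (Real.exp_pos _)
  have hm : Monotone fun s : ℝ => -Real.exp (-s) := fun a b h =>
    neg_le_neg (Real.exp_le_exp.2 (neg_le_neg h))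
  have hc : Continuous fun s : ℝ => -Real.exp (-s) := by fun_prop
  let S : StieltjesFunction ℝ :=
    { toFun := fun s => F (-Real.exp (-s))
      mono' := fun a b h => hF.mono (hn a) (hn b) (hm h)
      right_continuous' := fun x => ContinuousWithinAt.comp (f := fun s : ℝ => -Real.exp (-s))
        (hF.rc _ (hn x)) hc.continuousWithinAt fun y hy => hm hy }
  have hl : Tendsto S atBot (𝓝 (limBot F)) := by
    refine hF.tendsto.comp ?_
    exact tendsto_neg_atTop_atBot.comp (Real.tendsto_exp_atTop.comp tendsto_neg_atBot_atTop)
  refine ⟨S.measure.map fun s => -Real.exp (-s), inferInstance, ?_, fun x hx => ?_⟩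
  · rw [Measure.map_apply hc.measurable measurableSet_Ici]
    convert measure_empty (μ := S.measure)
    ext s
    simpa using hn s
  · rw [Measure.map_apply hc.measurable measurableSet_Iic]
    have : (fun s : ℝ => -Real.exp (-s)) ⁻¹' Set.Iic x = Set.Iic (-Real.log (-x)) := by
      ext s
      have hx' : 0 < -x := neg_pos.2 hx
      simp only [Set.mem_preimage, Set.mem_Iic]
      rw [neg_le, ← Real.log_le_iff_le_exp hx', le_neg]
    rw [this, S.measure_Iic hl]
    congr 2
    change F (-Real.exp (- -Real.log (-x))) = F x
    rw [neg_neg, Real.exp_log (neg_pos.2 hx), neg_neg]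

/-- The Stieltjes measure `dF` on `(-∞, 0)`, for `F` increasing and right-continuous there; it does
not charge `-∞`. (It is zero if `F` is not such a function.) -/
def dMeas (F : ℝ → ℝ) : Measure ℝ :=
  open Classical in if h : RCMono F then h.exists_measure.choose else 0

instance sFinite_dMeas (F : ℝ → ℝ) : SFinite (dMeas F) := by
  rw [dMeas]
  split_ifs with h
  · exact h.exists_measure.choose_spec.1
  · infer_instance

theorem RCMono.dMeas_Ici {F : ℝ → ℝ} (hF : RCMono F) : dMeas F (Set.Ici 0) = 0 := by
  rw [dMeas, dif_pos hF]
  exact hF.exists_measure.choose_spec.2.1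

theorem RCMono.dMeas_Iic {F : ℝ → ℝ} (hF : RCMono F) {x : ℝ} (hx : x < 0) :
    dMeas F (Set.Iic x) = ENNReal.ofReal (F x - limBot F) := by
  rw [dMeas, dif_pos hF]
  exact hF.exists_measure.choose_spec.2.2 x hx

theorem RCMono.restrict_dMeas {F : ℝ → ℝ} (hF : RCMono F) :
    (dMeas F).restrict (Set.Iio 0) = dMeas F := by
  rw [Measure.restrict_eq_self_of_ae_mem]
  rw [ae_iff]
  simpa [Set.Ici] using hF.dMeas_Ici

theorem RCMono.dMeas_const (c : ℝ) (hc : 0 ≤ c) : dMeas (fun _ => c) = 0 := by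
  have hF : RCMono fun _ => c :=
    ⟨monotoneOn_const, fun _ _ => hc, fun _ _ => continuousWithinAt_const⟩
  have hl : limBot (fun _ => c) = c := by
    rw [limBot, Set.Nonempty.image_const ⟨-1, by norm_num⟩, csInf_singleton]
  rw [← hF.restrict_dMeas, Measure.restrict_eq_zero]
  have : Set.Iio (0 : ℝ) = ⋃ k : ℕ, Set.Iic (-(1 / ((k : ℝ) + 1))) := by
    ext x
    simp only [Set.mem_Iio, Set.mem_iUnion, Set.mem_Iic]
    constructor
    · intro hx
      obtain ⟨k, hk⟩ := exists_nat_one_div_lt (neg_pos.2 hx)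
      exact ⟨k, by linarith⟩
    · rintro ⟨k, hk⟩
      have : 0 < 1 / ((k : ℝ) + 1) := by positivity
      linarith
  rw [this, measure_iUnion_null_iff]
  intro k
  have : 0 < 1 / ((k : ℝ) + 1) := by positivity
  rw [hF.dMeas_Iic (by linarith), hl]
  simp

theorem RCMono.aemeasurable {F : ℝ → ℝ} (hF : RCMono F) :
    AEMeasurable F (volume.restrict (Set.Iio (0 : ℝ))) :=
  aemeasurable_restrict_of_monotoneOn measurableSet_Iio hF.mono

/-- A function vanishing on `[-ε, 0)` is minus the integral of its right derivative. -/
theorem eq_neg_setIntegral_of_hasDeriv_right {g g' : ℝ → ℂ} {ε : ℝ} (hε : 0 < ε)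
    (hg : ContinuousOn g (Set.Iio 0)) (hd : ∀ x < 0, HasDerivWithinAt g (g' x) (Set.Ioi x) x)
    (h0 : ∀ x, -ε ≤ x → x < 0 → g x = 0) (hi : IntegrableOn g' (Set.Iic (-ε))) {x : ℝ}
    (hx : x ≤ -ε) : g x = -∫ y in x..-ε, g' y := by
  have hs : Set.Icc x (-ε) ⊆ Set.Iio 0 := fun y hy => lt_of_le_of_lt hy.2 (neg_lt_zero.2 hε)
  rw [intervalIntegral.integral_eq_sub_of_hasDeriv_right_of_le hx (hg.mono hs)
    (fun y hy => hd y (hs ⟨hy.1.le, hy.2.le⟩)), h0 _ le_rfl (neg_lt_zero.2 hε)]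
  · ring
  · rw [intervalIntegrable_iff_integrableOn_Ioc_of_le hx]
    exact hi.mono_set fun y hy => hy.2

/-- Integration by parts against the Stieltjes measure `dF`, with the boundary term at `-∞`. -/
theorem RCMono.integral_by_parts {F : ℝ → ℝ} (hF : RCMono F) {g g' : ℝ → ℂ} {ε : ℝ} (hε : 0 < ε)
    {L : ℂ} (hg : ContinuousOn g (Set.Iio 0))
    (hd : ∀ x < 0, HasDerivWithinAt g (g' x) (Set.Ioi x) x)
    (h0 : ∀ x, -ε ≤ x → x < 0 → g x = 0) (h0' : ∀ x, -ε ≤ x → x < 0 → g' x = 0)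
    (hi : IntegrableOn g' (Set.Iic (-ε))) (hL : Tendsto g atBot (𝓝 L)) :
    ∫ x, g x ∂(dMeas F) = -(∫ x in Set.Iio (0 : ℝ), (F x : ℂ) * g' x) - limBot F * L := by
  have hn : -ε < 0 := neg_lt_zero.2 hε
  have hsub : Set.Iic (-ε) ⊆ Set.Iio (0 : ℝ) := fun y hy => lt_of_le_of_lt hy hn
  set N := (dMeas F).restrict (Set.Iic (-ε)) with hN
  have hfin : IsFiniteMeasure N := by
    refine ⟨?_⟩
    rw [hN, Measure.restrict_apply_univ, hF.dMeas_Iic hn]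
    exact ENNReal.ofReal_lt_top
  set V := (volume : Measure ℝ).restrict (Set.Iic (-ε)) with hV
  have e1 : ∫ x, g x ∂(dMeas F) = ∫ x, g x ∂N := by
    rw [← hF.restrict_dMeas, hN]
    refine setIntegral_eq_of_subset_of_forall_sdiff_eq_zero measurableSet_Iio hsub ?_
    rintro x ⟨hx, hx'⟩
    exact h0 x (not_le.1 hx').le hx
  have e2 : ∀ x ≤ -ε, g x = -∫ y, Set.indicator {p : ℝ × ℝ | p.1 ≤ p.2}
      (fun p => g' p.2) (x, y) ∂V := by
    intro x hx
    rw [eq_neg_setIntegral_of_hasDeriv_right hε hg hd h0 hi hx,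
      intervalIntegral.integral_of_le hx, ← integral_Icc_eq_integral_Ioc]
    congr 1
    have : (fun y => Set.indicator {p : ℝ × ℝ | p.1 ≤ p.2} (fun p => g' p.2) (x, y))
        = Set.indicator (Set.Ici x) g' := by
      ext y
      simp [Set.indicator, Set.mem_Ici]
    rw [this, integral_indicator measurableSet_Ici, hV,
      Measure.restrict_restrict measurableSet_Ici]
    rfl
  have hint : Integrable (fun p : ℝ × ℝ => Set.indicator {p : ℝ × ℝ | p.1 ≤ p.2}
      (fun p => g' p.2) p) (N.prod V) :=
    (Integrable.comp_snd hi N).indicator (measurableSet_le measurable_fst measurable_snd)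
  have e3 : ∫ x, g x ∂N = -∫ y, ∫ x, Set.indicator {p : ℝ × ℝ | p.1 ≤ p.2}
      (fun p => g' p.2) (x, y) ∂N ∂V := by
    rw [← integral_integral_swap hint, ← integral_neg]
    refine integral_congr_ae ?_
    filter_upwards [ae_restrict_mem measurableSet_Iic] with x hx
    exact e2 x hx
  have e4 : ∀ y ≤ -ε, ∫ x, Set.indicator {p : ℝ × ℝ | p.1 ≤ p.2} (fun p => g' p.2) (x, y) ∂N
      = ((F y : ℂ) * g' y) - limBot F * g' y := by
    intro y hy
    have : (fun x => Set.indicator {p : ℝ × ℝ | p.1 ≤ p.2} (fun p => g' p.2) (x, y))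
        = Set.indicator (Set.Iic y) fun _ => g' y := by
      ext x
      simp [Set.indicator, Set.mem_Iic]
    have hy0 := lt_of_le_of_lt hy hn
    rw [this, integral_indicator measurableSet_Iic, setIntegral_const, hN, measureReal_def,
      Measure.restrict_apply measurableSet_Iic,
      Set.inter_eq_left.2 (Set.Iic_subset_Iic.2 hy), hF.dMeas_Iic hy0,
      ENNReal.toReal_ofReal (sub_nonneg.2 (hF.limBot_le hy0)), Complex.real_smul]
    push_cast
    ring
  have hFi : IntegrableOn (fun x => (F x : ℂ) * g' x) (Set.Iic (-ε)) := by
    refine Integrable.bdd_mul (c := F (-ε)) hi ?_ ?_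
    · exact (Complex.measurable_ofReal.comp_aemeasurable
        (hF.aemeasurable.mono_measure (Measure.restrict_mono hsub le_rfl))).aestronglyMeasurable
    · filter_upwards [ae_restrict_mem measurableSet_Iic] with x hx
      rw [Complex.norm_real, Real.norm_of_nonneg (hF.nonneg x (hsub hx))]
      exact hF.mono (hsub hx) hn hx
  have e5 : ∫ y, g' y ∂V = -L := by
    have h1 := intervalIntegral_tendsto_integral_Iic (-ε) hi tendsto_id
    have h2 : Tendsto (fun x => -g x) atBot (𝓝 (-L)) := hL.neg
    refine tendsto_nhds_unique h1 (h2.congr' ?_)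
    filter_upwards [Iic_mem_atBot (-ε)] with x hx
    rw [eq_neg_setIntegral_of_hasDeriv_right hε hg hd h0 hi hx, neg_neg, id]
  have e6 : ∫ x in Set.Iio (0 : ℝ), (F x : ℂ) * g' x = ∫ x, (F x : ℂ) * g' x ∂V := by
    refine setIntegral_eq_of_subset_of_forall_sdiff_eq_zero measurableSet_Iio hsub ?_
    rintro x ⟨hx, hx'⟩
    rw [h0' x (not_le.1 hx').le hx, mul_zero]
  rw [e1, e3, e6]
  have e7 : ∫ y, ∫ x, Set.indicator {p : ℝ × ℝ | p.1 ≤ p.2} (fun p => g' p.2) (x, y) ∂N ∂V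
      = ∫ y, (((F y : ℂ) * g' y) - limBot F * g' y) ∂V := by
    refine integral_congr_ae ?_
    filter_upwards [ae_restrict_mem measurableSet_Iic] with y hy
    exact e4 y hy
  rw [e7, integral_sub hFi (hi.const_mul _), integral_const_mul, e5]
  ring

/-- `-f` is the integral of the right derivative up to the boundary. -/
theorem Profile.ofReal_neg {f : ℝ → ℝ} (hf : Profile f) {x : ℝ} (hx : x < 0) :
    ENNReal.ofReal (-f x) = ∫⁻ y in Set.Ico x 0, ENNReal.ofReal (rd f y) := by
  set F : ℝ → ℝ := fun y => if y < 0 then f y else 0 with hF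
  have hFf : ∀ y < 0, F y = f y := fun y hy => if_pos hy
  have hc : ContinuousOn F (Set.Icc x 0) := by
    intro y hy
    rcases hy.2.lt_or_eq with h | h
    · refine ContinuousAt.continuousWithinAt ?_
      refine (hf.continuousOn.continuousAt (Iio_mem_nhds h)).congr ?_
      filter_upwards [Iio_mem_nhds h] with w hw
      exact (hFf w hw).symm
    · subst h
      have : ContinuousWithinAt F (Set.Iio 0) 0 := by
        rw [ContinuousWithinAt, show F 0 = 0 from if_neg (lt_irrefl _)]
        refine hf.lim.congr' ?_
        filter_upwards [self_mem_nhdsWithin] with w hw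
        exact (hFf w hw).symm
      have h2 : ContinuousWithinAt F (Set.Iic 0) 0 := by
        rw [← continuousWithinAt_Iio_iff_Iic]
        exact this
      exact h2.mono fun w hw => hw.2
  have hd : ∀ y ∈ Set.Ioo x 0, HasDerivWithinAt F (rd f y) (Set.Ioi y) y := by
    intro y hy
    refine (hf.hasDeriv hy.2).congr_of_eventuallyEq ?_ (hFf y hy.2)
    filter_upwards [nhdsWithin_le_nhds (Iio_mem_nhds hy.2)] with w hw
    exact hFf w hw
  have hi : IntegrableOn (rd f) (Set.Ioc x 0) :=
    intervalIntegral.integrableOn_deriv_right_of_nonneg hc hd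
      fun y hy => hf.rd_nonneg hy.2
  have e := intervalIntegral.integral_eq_sub_of_hasDeriv_right_of_le hx.le hc hd
    ((intervalIntegrable_iff_integrableOn_Ioc_of_le hx.le).2 hi)
  rw [hFf x hx, show F 0 = 0 from if_neg (lt_irrefl _), zero_sub,
    intervalIntegral.integral_of_le hx.le, ← integral_Ico_eq_integral_Ioc] at e
  rw [← e, ofReal_integral_eq_lintegral_ofReal]
  · exact hi.congr_set_ae Ico_ae_eq_Ioc
  · filter_upwards [ae_restrict_mem measurableSet_Ico] with y hy
    exact hf.rd_nonneg hy.2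

/-- The energy of the absolutely continuous and singular parts away from `-∞`, by Tonelli. -/
theorem Profile.lintegral_neg {f : ℝ → ℝ} (hf : Profile f) {F : ℝ → ℝ} (hF : RCMono F) :
    ∫⁻ x, ENNReal.ofReal (-f x) ∂(dMeas F)
      + ENNReal.ofReal (limBot F) * ∫⁻ y in Set.Iio (0 : ℝ), ENNReal.ofReal (rd f y)
      = ∫⁻ y in Set.Iio (0 : ℝ), ENNReal.ofReal (rd f y) * ENNReal.ofReal (F y) := by
  set V := (volume : Measure ℝ).restrict (Set.Iio 0) with hV
  have hm : AEMeasurable (fun y => ENNReal.ofReal (rd f y)) V :=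
    ENNReal.measurable_ofReal.comp_aemeasurable hf.rcMono.aemeasurable
  have e1 : ∫⁻ x, ENNReal.ofReal (-f x) ∂(dMeas F) = ∫⁻ x, ∫⁻ y,
      Set.indicator {p : ℝ × ℝ | p.1 ≤ p.2} (fun p => ENNReal.ofReal (rd f p.2)) (x, y)
        ∂V ∂(dMeas F) := by
    rw [← hF.restrict_dMeas]
    refine setLIntegral_congr_fun measurableSet_Iio fun x hx => ?_
    have : (fun y => Set.indicator {p : ℝ × ℝ | p.1 ≤ p.2}
        (fun p => ENNReal.ofReal (rd f p.2)) (x, y))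
        = Set.indicator (Set.Ici x) fun y => ENNReal.ofReal (rd f y) := by
      ext y
      simp [Set.indicator, Set.mem_Ici]
    rw [hf.ofReal_neg hx, this, lintegral_indicator measurableSet_Ici, hV,
      Measure.restrict_restrict measurableSet_Ici]
    rfl
  have e2 : ∫⁻ x, ∫⁻ y,
      Set.indicator {p : ℝ × ℝ | p.1 ≤ p.2} (fun p => ENNReal.ofReal (rd f p.2)) (x, y)
        ∂V ∂(dMeas F) = ∫⁻ y, ∫⁻ x,
      Set.indicator {p : ℝ × ℝ | p.1 ≤ p.2} (fun p => ENNReal.ofReal (rd f p.2)) (x, y)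
        ∂(dMeas F) ∂V := by
    refine lintegral_lintegral_swap ?_
    exact (hm.comp_snd (μ := dMeas F)).indicator (measurableSet_le measurable_fst measurable_snd)
  have e3 : ∀ y < 0, ∫⁻ x,
      Set.indicator {p : ℝ × ℝ | p.1 ≤ p.2} (fun p => ENNReal.ofReal (rd f p.2)) (x, y)
        ∂(dMeas F) = ENNReal.ofReal (rd f y) * ENNReal.ofReal (F y - limBot F) := by
    intro y hy
    have : (fun x => Set.indicator {p : ℝ × ℝ | p.1 ≤ p.2}
        (fun p => ENNReal.ofReal (rd f p.2)) (x, y))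
        = Set.indicator (Set.Iic y) fun _ => ENNReal.ofReal (rd f y) := by
      ext x
      simp [Set.indicator, Set.mem_Iic]
    rw [this, lintegral_indicator measurableSet_Iic, setLIntegral_const, hF.dMeas_Iic hy]
  rw [e1, e2, ← lintegral_const_mul'' _ hm, ← lintegral_add_right' _ (hm.const_mul _)]
  refine setLIntegral_congr_fun measurableSet_Iio fun y hy => ?_
  rw [e3 y hy, mul_comm (ENNReal.ofReal (limBot F)), ← mul_add, ← ENNReal.ofReal_add
    (sub_nonneg.2 (hF.limBot_le hy)) hF.limBot_nonneg, sub_add_cancel]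

/-- If `f'` is bounded below by a positive constant, then `f` is unbounded below. -/
theorem Profile.lt_of_limBot_pos {f : ℝ → ℝ} (hf : Profile f) {k : ℕ} (hk : k ≠ 0)
    (h : 0 < limBot fun x => rd f x ^ k) (a : ℝ) : ∃ x < 0, f x < a := by
  set c := min 1 (limBot fun x => rd f x ^ k) with hc
  have hc0 : 0 < c := lt_min one_pos h
  have hcr : ∀ x < 0, c ≤ rd f x := by
    intro x hx
    by_contra! hlt
    have h1 : rd f x < 1 := hlt.trans_le (min_le_left _ _)
    have h2 : rd f x ^ k ≤ rd f x := pow_le_of_le_one (hf.rd_nonneg hx) h1.le hk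
    have h3 := (hf.rcMono.pow k).limBot_le hx
    have h4 : c ≤ limBot fun x => rd f x ^ k := min_le_right _ _
    linarith
  have hac : 0 < (|a| + 1) / c := by positivity
  have hx1 : -2 - (|a| + 1) / c < -1 := by linarith
  refine ⟨-2 - (|a| + 1) / c, by linarith, ?_⟩
  have h1 := (hcr _ (by linarith)).trans (hf.rd_le_slope (by norm_num : (-1 : ℝ) < 0) hx1)
  rw [slope_def_field, le_div_iff₀ (by linarith)] at h1
  have h2 : c * (-1 - (-2 - (|a| + 1) / c)) = c + |a| + 1 := by
    field_simp
    ring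
  have h3 := hf.nonpos (by norm_num : (-1 : ℝ) < 0)
  linarith [neg_abs_le a]

theorem Profile.lintegral_rd_eq_top {f : ℝ → ℝ} (hf : Profile f) {k : ℕ} (hk : k ≠ 0)
    (h : 0 < limBot fun x => rd f x ^ k) :
    ∫⁻ y in Set.Iio (0 : ℝ), ENNReal.ofReal (rd f y) = ⊤ := by
  refine ENNReal.eq_top_of_forall_nnreal_le fun r => ?_
  obtain ⟨x, hx, hxr⟩ := hf.lt_of_limBot_pos hk h (-r)
  calc (r : ℝ≥0∞) = ENNReal.ofReal r := by simp
    _ ≤ ENNReal.ofReal (-f x) := ENNReal.ofReal_le_ofReal (by linarith)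
    _ = _ := hf.ofReal_neg hx
    _ ≤ _ := lintegral_mono_set fun y hy => hy.2

theorem Profile.extendBot_eq_bot {f : ℝ → ℝ} (hf : Profile f) {k : ℕ} (hk : k ≠ 0)
    (h : 0 < limBot fun x => rd f x ^ k) : extendBot f ⊥ = ⊥ := by
  rw [extendBot, if_pos rfl, iInf_eq_bot]
  intro b hb
  obtain ⟨a, ha⟩ : ∃ a : ℝ, ((a : ℝ) : EReal) ≤ b := by
    induction b using EReal.rec with
    | bot => exact absurd hb (lt_irrefl _)
    | coe a => exact ⟨a, le_rfl⟩
    | top => exact ⟨0, le_top⟩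
  obtain ⟨x, hx, hxa⟩ := hf.lt_of_limBot_pos hk h a
  exact ⟨⟨x, hx⟩, (EReal.coe_lt_coe_iff.2 hxa).trans_le ha⟩

/-! ### Complex Radon measures -/

/-- The sum of two complex Radon measures, presented by its density with respect to the sum of the
two positive measures. -/
def Coeff.add (c d : Coeff n) : Coeff n where
  ν := c.ν + d.ν
  θ z := (c.ν.rnDeriv (c.ν + d.ν) z).toReal • c.θ z + (d.ν.rnDeriv (c.ν + d.ν) z).toReal • d.θ z

theorem Coeff.integrableOn_add {c d : Coeff n} [SigmaFinite c.ν] [SigmaFinite d.ν]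
    {s : Set (Cn n)} (hs : MeasurableSet s) {g : Cn n → ℂ}
    (hc : IntegrableOn (fun z => g z * c.θ z) s c.ν)
    (hd : IntegrableOn (fun z => g z * d.θ z) s d.ν) :
    IntegrableOn (fun z => g z * (c.add d).θ z) s (c.add d).ν ∧
      ∫ z in s, g z * (c.add d).θ z ∂(c.add d).ν
        = ∫ z in s, g z * c.θ z ∂c.ν + ∫ z in s, g z * d.θ z ∂d.ν := by
  have ac : c.ν ≪ c.ν + d.ν := Measure.absolutelyContinuous_of_le (Measure.le_add_right le_rfl)
  have ad : d.ν ≪ c.ν + d.ν := Measure.absolutelyContinuous_of_le (Measure.le_add_left le_rfl)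
  rw [← integrable_indicator_iff hs] at hc hd
  have hc' := (integrable_rnDeriv_smul_iff ac).2 hc
  have hd' := (integrable_rnDeriv_smul_iff ad).2 hd
  have e : s.indicator (fun z => g z * (c.add d).θ z) = fun z =>
      (c.ν.rnDeriv (c.ν + d.ν) z).toReal • s.indicator (fun z => g z * c.θ z) z
      + (d.ν.rnDeriv (c.ν + d.ν) z).toReal • s.indicator (fun z => g z * d.θ z) z := by
    ext z
    by_cases hz : z ∈ s
    · simp only [Set.indicator_of_mem hz, Coeff.add, Complex.real_smul]
      ring
    · simp [Set.indicator_of_notMem hz]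
  constructor
  · rw [← integrable_indicator_iff hs, e]
    exact hc'.add hd'
  · rw [← integral_indicator hs, ← integral_indicator hs, ← integral_indicator hs, e]
    change ∫ z, _ ∂(c.ν + d.ν) = _
    rw [integral_add hc' hd', integral_rnDeriv_smul ac, integral_rnDeriv_smul ad]

theorem Coeff.pair_add {c d : Coeff n} [SigmaFinite c.ν] [SigmaFinite d.ν] {g : Cn n → ℂ}
    (hc : Integrable (fun z => g z * c.θ z) c.ν) (hd : Integrable (fun z => g z * d.θ z) d.ν) :
    (c.add d).pair g = c.pair g + d.pair g := by
  have := (Coeff.integrableOn_add MeasurableSet.univ hc.integrableOn hd.integrableOn).2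
  simpa [Coeff.pair] using this

theorem Coeff.LocallyFinite.add {Ω : Set (Cn n)} {c d : Coeff n} [SigmaFinite c.ν]
    [SigmaFinite d.ν] (hc : c.LocallyFinite Ω) (hd : d.LocallyFinite Ω) :
    (c.add d).LocallyFinite Ω := fun K hK hK' => by
  have := (Coeff.integrableOn_add (g := fun _ => 1) hK'.measurableSet (c := c) (d := d)
    (by simpa using hc K hK hK') (by simpa using hd K hK hK')).1
  simpa using this

theorem Coeff.MulLocallyFinite.add {Ω : Set (Cn n)} {φ : Cn n → EReal} {c d : Coeff n}
    [SigmaFinite c.ν] [SigmaFinite d.ν] (hc : c.MulLocallyFinite Ω φ)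
    (hd : d.MulLocallyFinite Ω φ) : (c.add d).MulLocallyFinite Ω φ := fun K hK hK' => by
  refine ⟨?_, (Coeff.integrableOn_add hK'.measurableSet (hc K hK hK').2 (hd K hK hK').2).1⟩
  change ∀ᵐ z ∂((c.ν + d.ν).restrict K), _
  have zero : ∀ (ν ν' : Measure (Cn n)) [SigmaFinite ν] [SigmaFinite ν'] (θ : Cn n → ℂ)
      (p : Cn n → Prop), ν ≪ ν' → (∀ᵐ z ∂(ν.restrict K), θ z ≠ 0 → p z) →
      ∀ᵐ z ∂(ν'.restrict K), (ν.rnDeriv ν' z).toReal • θ z ≠ 0 → p z := by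
    intro ν ν' _ _ θ p h h1
    rw [ae_restrict_iff' hK'.measurableSet] at h1 ⊢
    rw [← Measure.withDensity_rnDeriv_eq ν ν' h,
      ae_withDensity_iff (Measure.measurable_rnDeriv _ _)] at h1
    filter_upwards [h1] with z hz hzK hne
    refine hz ?_ hzK ?_
    · rintro h0
      simp [h0] at hne
    · rintro h0
      simp [h0] at hne
  have h1 := zero c.ν (c.ν + d.ν) c.θ (fun z => φ z ≠ ⊥ ∧ φ z ≠ ⊤)
    (Measure.absolutelyContinuous_of_le (Measure.le_add_right le_rfl)) (hc K hK hK').1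
  have h2 := zero d.ν (c.ν + d.ν) d.θ (fun z => φ z ≠ ⊥ ∧ φ z ≠ ⊤)
    (Measure.absolutelyContinuous_of_le (Measure.le_add_left le_rfl)) (hd K hK hK').1
  filter_upwards [h1, h2] with z hz1 hz2 hne
  by_cases h : (c.ν.rnDeriv (c.ν + d.ν) z).toReal • c.θ z = 0
  · refine hz2 fun h' => hne ?_
    simp only [Coeff.add]
    rw [h, h', add_zero]
  · exact hz1 h

/-- The polar decomposition of a complex measure of finite mass: `θ ν = p a` with `a` a finite
measure and `|p| ≤ 1`. -/
theorem exists_finite_polar {ν : Measure (Cn n)} {θ : Cn n → ℂ} (h : Integrable θ ν) :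
    ∃ (a : Measure (Cn n)) (p : Cn n → ℂ), IsFiniteMeasure a ∧ Integrable p a ∧
      ∀ g : Cn n → ℂ, (Integrable (fun z => g z * θ z) ν → Integrable (fun z => g z * p z) a) ∧
        ∫ z, g z * p z ∂a = ∫ z, g z * θ z ∂ν := by
  have hm : AEMeasurable (fun z => ‖θ z‖₊) ν := h.1.aemeasurable.nnnorm
  have e : ∀ g : Cn n → ℂ, (fun z => ‖θ z‖₊ • (g z * (θ z / ‖θ z‖))) = fun z => g z * θ z := by
    intro g
    ext z
    rw [NNReal.smul_def, coe_nnnorm, Complex.real_smul]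
    by_cases h0 : θ z = 0
    · simp [h0]
    · have : (‖θ z‖ : ℂ) ≠ 0 := by simpa using h0
      field_simp
  have hi : ∀ g : Cn n → ℂ, Integrable (fun z => g z * θ z) ν →
      Integrable (fun z => g z * (θ z / ‖θ z‖)) (ν.withDensity fun z => ‖θ z‖₊) := by
    intro g hg
    rw [integrable_withDensity_iff_integrable_smul₀ hm, e]
    exact hg
  refine ⟨ν.withDensity fun z => ‖θ z‖₊, fun z => θ z / ‖θ z‖, ?_, ?_, fun g => ⟨hi g, ?_⟩⟩
  · exact isFiniteMeasure_withDensity h.2.ne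
  · simpa using hi (fun _ => 1) (by simpa using h)
  · rw [integral_withDensity_eq_integral_smul₀ hm, e]

theorem integrableOn_univ_of_support {c : Coeff n} {K : Set (Cn n)} (hK : MeasurableSet K)
    {g : Cn n → ℂ} (hg : ∀ z ∉ K, g z = 0) (hi : IntegrableOn (fun z => g z * c.θ z) K c.ν) :
    Integrable (fun z => g z * c.θ z) c.ν := by
  rw [← integrable_indicator_iff hK] at hi
  have e : K.indicator (fun z => g z * c.θ z) = fun z => g z * c.θ z := by
    ext z
    by_cases hz : z ∈ K
    · rw [Set.indicator_of_mem hz]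
    · rw [Set.indicator_of_notMem hz, hg z hz, zero_mul]
  rwa [e] at hi

/-- Two complex Radon measures which agree on test functions agree on all functions with compact
support that are integrable for both. -/
theorem Coeff.pair_eq_of_test {Ω : Set (Cn n)} (hΩ : IsOpen Ω) {c d : Coeff n}
    (hc : c.LocallyFinite Ω) (hd : d.LocallyFinite Ω)
    (h : ∀ χ, IsTestFunction Ω χ → c.pair χ = d.pair χ) {K : Set (Cn n)} (hK : IsCompact K)
    (hKΩ : K ⊆ Ω) {g : Cn n → ℂ} (hg : ∀ z ∉ K, g z = 0)
    (hgc : Integrable (fun z => g z * c.θ z) c.ν) (hgd : Integrable (fun z => g z * d.θ z) d.ν) :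
    c.pair g = d.pair g := by
  obtain ⟨U, hU, hKU, hUΩ, hUc⟩ := exists_open_between_and_isCompact_closure hK hΩ hKΩ
  -- restrict both measures to the compact set `closure U` and present them by finite measures
  have hms : MeasurableSet (closure U) := hUc.measurableSet
  obtain ⟨a, p, _, hp, ha⟩ := exists_finite_polar (hc _ hUΩ hUc)
  obtain ⟨b, q, _, hq, hb⟩ := exists_finite_polar (hd _ hUΩ hUc)
  have supp : ∀ (c : Coeff n) (k : Cn n → ℂ), (∀ z ∉ closure U, k z = 0) →
      ∫ z in closure U, k z * c.θ z ∂c.ν = c.pair k := by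
    intro c k hk
    refine setIntegral_eq_integral_of_forall_compl_eq_zero fun z hz => ?_
    rw [hk z hz, zero_mul]
  let e : Coeff n := Coeff.add ⟨a, p⟩ ⟨b, fun z => -q z⟩
  have he : ∀ k : Cn n → ℂ, Integrable (fun z => k z * p z) a → Integrable (fun z => k z * q z) b →
      Integrable (fun z => k z * e.θ z) e.ν ∧
      ∫ z, k z * e.θ z ∂e.ν = ∫ z, k z * p z ∂a - ∫ z, k z * q z ∂b := by
    intro k hk hk'
    have hk'' : Integrable (fun z => k z * -q z) b := by simpa using hk'.neg
    have := Coeff.integrableOn_add (c := ⟨a, p⟩) (d := ⟨b, fun z => -q z⟩) MeasurableSet.univ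
      (g := k) hk.integrableOn hk''.integrableOn
    simp only [IntegrableOn, Measure.restrict_univ] at this
    refine ⟨this.1, this.2.trans ?_⟩
    simp only [mul_neg, integral_neg, sub_eq_add_neg]
  have hefin : IsFiniteMeasure e.ν := by
    change IsFiniteMeasure (a + b)
    infer_instance
  have hei : Integrable e.θ e.ν := by
    have := (he (fun _ => 1) (by simpa using hp) (by simpa using hq)).1
    simpa using this
  have hzero : ∀ᵐ z ∂e.ν, z ∈ U → e.θ z = 0 := by
    refine hU.ae_eq_zero_of_integral_contDiff_smul_eq_zero
      (hei.locallyIntegrable.locallyIntegrableOn _) fun χ hχ hχc hχU => ?_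
    have hts : tsupport (fun z => (χ z : ℂ)) ⊆ tsupport χ :=
      closure_mono fun z hz => by simpa using hz
    have hcs : HasCompactSupport fun z => (χ z : ℂ) :=
      hχc.of_isClosed_subset (isClosed_tsupport _) hts
    have hcont : ContDiff ℝ ∞ fun z => (χ z : ℂ) := Complex.ofRealCLM.contDiff.comp hχ
    have htest : IsTestFunction Ω fun z => (χ z : ℂ) :=
      ⟨hcont, hcs, (hts.trans hχU).trans (subset_closure.trans hUΩ)⟩
    obtain ⟨C, hC⟩ := hcs.exists_bound_of_continuous hcont.continuous
    have hint : ∀ (m : Measure (Cn n)) (r : Cn n → ℂ), Integrable r m →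
        Integrable (fun z => (χ z : ℂ) * r z) m := fun m r hr =>
      hr.bdd_mul hcont.continuous.aestronglyMeasurable (Eventually.of_forall hC)
    have h0 : ∀ z ∉ closure U, (χ z : ℂ) = 0 := by
      intro z hz
      rw [image_eq_zero_of_notMem_tsupport fun h' => hz (subset_closure (hχU h')),
        Complex.ofReal_zero]
    have := (he (fun z => (χ z : ℂ)) (hint a p hp) (hint b q hq)).2
    simp only [Complex.real_smul]
    rw [this, (ha _).2, (hb _).2, supp c _ h0, supp d _ h0, h _ htest, sub_self]
  have h0 : ∀ z ∉ closure U, g z = 0 := fun z hz => hg z fun h' => hz (subset_closure (hKU h'))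
  have := (he g ((ha g).1 hgc.integrableOn) ((hb g).1 hgd.integrableOn)).2
  rw [(ha _).2, (hb _).2, supp c _ h0, supp d _ h0] at this
  rw [← sub_eq_zero, ← this]
  refine integral_eq_zero_of_ae ?_
  filter_upwards [hzero] with z hz
  by_cases hzK : z ∈ K
  · rw [hz (hKU hzK), mul_zero]; rfl
  · rw [hg z hzK, zero_mul]; rfl

/-- Radon measures on `Ω` are determined by their integrals over compact sets. -/
theorem measure_ext_of_test {Ω : Set (Cn n)} (hΩ : IsOpen Ω) {μ μ' : Measure (Cn n)}
    (h0 : μ Ωᶜ = 0) (h0' : μ' Ωᶜ = 0) (hK : ∀ K ⊆ Ω, IsCompact K → μ K < ⊤)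
    (hK' : ∀ K ⊆ Ω, IsCompact K → μ' K < ⊤)
    (h : ∀ χ, IsTestFunction Ω χ → ∫ z, χ z ∂μ = ∫ z, χ z ∂μ') : μ = μ' := by
  have key : ∀ s, MeasurableSet s → ∀ K ⊆ Ω, IsCompact K → μ (s ∩ K) = μ' (s ∩ K) := by
    intro s hs K hKΩ hKc
    have hm : MeasurableSet (s ∩ K) := hs.inter hKc.measurableSet
    have f1 : μ (s ∩ K) < ⊤ := (measure_mono Set.inter_subset_right).trans_lt (hK K hKΩ hKc)
    have f2 : μ' (s ∩ K) < ⊤ := (measure_mono Set.inter_subset_right).trans_lt (hK' K hKΩ hKc)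
    have e : ∀ m : Measure (Cn n), ∫ z, (s ∩ K).indicator (fun _ => (1 : ℂ)) z * 1 ∂m
        = (m.real (s ∩ K) : ℂ) := by
      intro m
      simp [integral_indicator hm]
    have := Coeff.pair_eq_of_test hΩ (c := ⟨μ, fun _ => 1⟩) (d := ⟨μ', fun _ => 1⟩)
      (fun K h1 h2 => integrableOn_const (hs := (hK K h1 h2).ne))
      (fun K h1 h2 => integrableOn_const (hs := (hK' K h1 h2).ne))
      (fun χ hχ => by simpa [Coeff.pair] using h χ hχ) hKc hKΩ
      (g := (s ∩ K).indicator fun _ => 1)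
      (fun z hz => Set.indicator_of_notMem (fun h' => hz h'.2) _)
      (by
        simp only [mul_one]
        exact (integrable_indicator_iff hm).2 (integrableOn_const (hs := f1.ne)))
      (by
        simp only [mul_one]
        exact (integrable_indicator_iff hm).2 (integrableOn_const (hs := f2.ne)))
    simp only [Coeff.pair] at this
    rw [e, e, Complex.ofReal_inj, measureReal_def, measureReal_def,
      ENNReal.toReal_eq_toReal_iff' f1.ne f2.ne] at this
    exact this
  obtain ⟨C, hCc, hCΩ, hCU, hCm⟩ := hΩ.exists_iUnion_isClosed
  let D : ℕ → Set (Cn n) := fun j => C j ∩ Metric.closedBall 0 j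
  have hD : ⋃ j, D j = Ω := by
    rw [← hCU]
    ext z
    simp only [D, Set.mem_iUnion, Set.mem_inter_iff, Metric.mem_closedBall, dist_zero_right]
    constructor
    · rintro ⟨j, hj, -⟩
      exact ⟨j, hj⟩
    · rintro ⟨j, hj⟩
      obtain ⟨m, hm⟩ := exists_nat_ge ‖z‖
      exact ⟨max j m, hCm (le_max_left _ _) hj, hm.trans (by exact_mod_cast le_max_right _ _)⟩
  have hDm : Monotone D := fun i j hij => Set.inter_subset_inter (hCm hij)
    (Metric.closedBall_subset_closedBall (by exact_mod_cast hij))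
  ext s hs
  have split : ∀ m : Measure (Cn n), m Ωᶜ = 0 → m s = ⨆ j, m (s ∩ D j) := by
    intro m hm
    rw [← Monotone.measure_iUnion (fun i j hij => Set.inter_subset_inter_right s (hDm hij)),
      ← Set.inter_iUnion, hD]
    refine le_antisymm ?_ (measure_mono Set.inter_subset_left)
    calc m s ≤ m (s ∩ Ω ∪ Ωᶜ) := measure_mono fun z hz => by
          by_cases h : z ∈ Ω
          · exact Or.inl ⟨hz, h⟩
          · exact Or.inr h
      _ ≤ m (s ∩ Ω) + m Ωᶜ := measure_union_le _ _
      _ = m (s ∩ Ω) := by rw [hm, add_zero]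
  rw [split μ h0, split μ' h0']
  refine iSup_congr fun j => key s hs (D j) (Set.inter_subset_left.trans (hCΩ j)) ?_
  exact (isCompact_closedBall _ _).inter_left (hCc j)

/-! ### Integrability on the level sets of a logarithmically homogeneous function -/

namespace LogHom

variable {u : Cn n → ℝ}

theorem measurable (hu : LogHom u) : Measurable u :=
  measurable_of_continuousOn_compl_singleton 0 hu.continuousOn

theorem liftMeas_zero (hu : LogHom u) (M : Measure ℝ) : liftMeas u M {0} = 0 := by
  rw [liftMeas, Measure.map_apply hu.continuous_polarPt.measurable (measurableSet_singleton 0)]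
  convert measure_empty (μ := (M.prod (sphMeas n)).withDensity _)
  ext x
  simpa using polarPt_ne_zero u x.1 x.2

theorem ae_ne_zero (hu : LogHom u) (M : Measure ℝ) : ∀ᵐ z ∂(liftMeas u M), z ≠ 0 := by
  rw [ae_iff]
  simpa using hu.liftMeas_zero M

theorem liftMeas_preimage (hu : LogHom u) {M : Measure ℝ} [SFinite M] {S : Set ℝ}
    (hS : MeasurableSet S) (h0 : M S = 0) : liftMeas u M (u ⁻¹' S) = 0 := by
  rw [liftMeas, Measure.map_apply hu.continuous_polarPt.measurable (hu.measurable hS)]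
  refine withDensity_absolutelyContinuous _ _ ?_
  have : (fun x : ℝ × Sph n => polarPt u x.1 x.2) ⁻¹' (u ⁻¹' S) = S ×ˢ Set.univ := by
    ext x
    simp [hu.apply_polarPt]
  rw [this, Measure.prod_prod, h0, zero_mul]

theorem integrable_weight (hu : LogHom u) (c : ℝ) :
    Integrable (fun ζ : Sph n => Real.exp (c * u ζ)) (sphMeas n) :=
  (Real.continuous_exp.comp (continuous_const.mul
    hu.continuous_sph)).integrable_of_hasCompactSupport (HasCompactSupport.of_compactSpace _)

theorem norm_integrand_le {h : Cn n → ℂ} {w : ℝ → ℝ} (hu : LogHom u)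
    (hw : ∀ z, z ≠ 0 → ‖h z‖ ≤ w (u z) * Real.exp (-(2 * n) * u z)) (t : ℝ) (ζ : Sph n) :
    ‖(Real.exp (2 * n * (t - u ζ)) : ℂ) * h (polarPt u t ζ)‖
      ≤ w t * Real.exp (-(2 * n) * u ζ) := by
  have h1 := hw _ (polarPt_ne_zero u t ζ)
  rw [hu.apply_polarPt] at h1
  rw [norm_mul, Complex.norm_real, Real.norm_of_nonneg (Real.exp_pos _).le]
  calc Real.exp (2 * n * (t - u ζ)) * ‖h (polarPt u t ζ)‖
      ≤ Real.exp (2 * n * (t - u ζ)) * (w t * Real.exp (-(2 * n) * t)) := by gcongr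
    _ = w t * (Real.exp (2 * n * (t - u ζ)) * Real.exp (-(2 * n) * t)) := by ring
    _ = w t * Real.exp (-(2 * n) * u ζ) := by rw [← Real.exp_add]; ring_nf

theorem integrable_of_bound (hu : LogHom u) {M : Measure ℝ} [SFinite M] {h : Cn n → ℂ}
    (hh : Measurable h) {w : ℝ → ℝ} (hwi : Integrable w M)
    (hw : ∀ z, z ≠ 0 → ‖h z‖ ≤ w (u z) * Real.exp (-(2 * n) * u z)) :
    Integrable h (liftMeas u M) := by
  rw [hu.integrable_liftMeas_iff M hh.aestronglyMeasurable]
  refine Integrable.mono' (hwi.mul_prod (hu.integrable_weight (-(2 * n)))) ?_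
    (ae_of_all _ fun x => hu.norm_integrand_le hw x.1 x.2)
  have h3 : Continuous fun x : ℝ × Sph n => u x.2 := hu.continuous_sph.comp continuous_snd
  have h4 : Continuous fun x : ℝ × Sph n => (Real.exp (2 * n * (x.1 - u x.2)) : ℂ) :=
    Complex.continuous_ofReal.comp
      (Real.continuous_exp.comp (continuous_const.mul (continuous_fst.sub h3)))
  exact (h4.measurable.mul (hh.comp hu.continuous_polarPt.measurable)).aestronglyMeasurable

theorem norm_levelMean_le (hu : LogHom u) {h : Cn n → ℂ} {w : ℝ → ℝ}
    (hw : ∀ z, z ≠ 0 → ‖h z‖ ≤ w (u z) * Real.exp (-(2 * n) * u z)) (t : ℝ) :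
    ‖levelMean u h t‖ ≤ w t * ∫ ζ : Sph n, Real.exp (-(2 * n) * u ζ) ∂(sphMeas n) := by
  rw [levelMean, ← integral_const_mul]
  exact norm_integral_le_of_norm_le ((hu.integrable_weight _).const_mul _)
    (ae_of_all _ fun ζ => hu.norm_integrand_le hw t ζ)

theorem sigmaFinite_liftMeas (hu : LogHom u) {M : Measure ℝ} [SFinite M] (h0 : M (Set.Ici 0) = 0)
    (hM : ∀ a b : ℝ, b < 0 → M (Set.Icc a b) < ⊤) : SigmaFinite (liftMeas u M) := by
  let S : ℕ → Set (Cn n) := fun k => {z | z = 0 ∨ 0 ≤ u z ∨ u z ∈ Set.Icc (-(k : ℝ)) (-(1 / (k + 1)))}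
  have hm := hu.measurable
  have hpos : liftMeas u M {z | 0 ≤ u z} = 0 := hu.liftMeas_preimage measurableSet_Ici h0
  refine Measure.sigmaFinite_of_countable (S := Set.range S) (Set.countable_range _) ?_ ?_
  · rintro _ ⟨k, rfl⟩
    set T := {z : Cn n | u z ∈ Set.Icc (-(k : ℝ)) (-(1 / (k + 1)))} with hT
    have hTm : MeasurableSet T := hm measurableSet_Icc
    have hb : -(1 / ((k : ℝ) + 1)) < 0 := neg_lt_zero.2 (by positivity)
    have hi : Integrable (T.indicator fun _ => (1 : ℂ)) (liftMeas u M) := by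
      refine hu.integrable_of_bound (measurable_const.indicator hTm)
        (w := (Set.Icc (-(k : ℝ)) (-(1 / (k + 1)))).indicator fun t => Real.exp (2 * n * t)) ?_ ?_
      · rw [integrable_indicator_iff measurableSet_Icc]
        exact IntegrableOn.of_bound (hM _ _ hb) (by fun_prop) 1 <| by
          filter_upwards [ae_restrict_mem measurableSet_Icc] with t ht
          rw [Real.norm_of_nonneg (Real.exp_pos _).le, Real.exp_le_one_iff]
          exact mul_nonpos_of_nonneg_of_nonpos (by positivity) (ht.2.trans hb.le)
      · intro z _
        by_cases hz : z ∈ T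
        · have hz' : u z ∈ Set.Icc (-(k : ℝ)) (-(1 / (k + 1))) := hz
          rw [Set.indicator_of_mem hz, Set.indicator_of_mem hz', ← Real.exp_add]
          simp
        · have hz' : u z ∉ Set.Icc (-(k : ℝ)) (-(1 / (k + 1))) := hz
          rw [Set.indicator_of_notMem hz, Set.indicator_of_notMem hz']
          simp
    rw [integrable_indicator_iff hTm, integrableOn_const_iff] at hi
    have hT' : liftMeas u M T < ⊤ := by simpa using hi
    calc liftMeas u M (S k) ≤ liftMeas u M ({0} ∪ ({z | 0 ≤ u z} ∪ T)) :=
          measure_mono fun z hz => hz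
      _ ≤ liftMeas u M {0} + (liftMeas u M {z | 0 ≤ u z} + liftMeas u M T) :=
          (measure_union_le _ _).trans (by gcongr; exact measure_union_le _ _)
      _ < ⊤ := by rw [hu.liftMeas_zero, hpos, zero_add, zero_add]; exact hT'
  · rw [Set.sUnion_range, Set.eq_univ_iff_forall]
    intro z
    rw [Set.mem_iUnion]
    by_cases hz : 0 ≤ u z
    · exact ⟨0, Or.inr (Or.inl hz)⟩
    · obtain ⟨k, hk⟩ := exists_nat_ge (-u z)
      obtain ⟨m, hm⟩ := exists_nat_one_div_lt (neg_pos.2 (not_le.1 hz))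
      refine ⟨max k m, Or.inr (Or.inr ⟨?_, ?_⟩)⟩
      · have : (k : ℝ) ≤ (max k m : ℕ) := by exact_mod_cast le_max_left _ _
        linarith
      · have h1 : (m : ℝ) ≤ (max k m : ℕ) := by exact_mod_cast le_max_right _ _
        have h2 : 1 / (((max k m : ℕ) : ℝ) + 1) ≤ 1 / ((m : ℝ) + 1) :=
          one_div_le_one_div_of_le (by positivity) (by linarith)
        linarith

end LogHom

/-- `h` is supported in `{u ≤ -ε}`, and `O(e^{su} e^{-2nu})`: of critical size for `s = 0`, and
better for `s > 0`. -/
structure Small (u : Cn n → ℝ) (s ε : ℝ) (h : Cn n → ℂ) : Prop where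
  meas : Measurable h
  supp : ∀ z, z ≠ 0 → -ε < u z → h z = 0
  bound : ∃ C, 0 ≤ C ∧ ∀ z, z ≠ 0 →
    ‖h z‖ ≤ C * Real.exp (s * u z) * Real.exp (-(2 * n) * u z)

theorem OrdBound.exp_bound {u : Cn n → ℝ} (hu : LogHom u) {h : Cn n → ℂ} {d : ℕ}
    (hh : OrdBound h d) : ∃ C, 0 ≤ C ∧ ∀ z, z ≠ 0 → ‖h z‖ ≤ C * Real.exp (-d * u z) := by
  obtain ⟨C, hC⟩ := hh.2
  obtain ⟨R, hR⟩ := hu.exists_bound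
  refine ⟨|C| * Real.exp (d * R), by positivity, fun z hz => ?_⟩
  have hz' : 0 < ‖z‖ := norm_pos_iff.2 hz
  have h1 : Real.exp (u z) ≤ Real.exp R * ‖z‖ := by
    have h0 : Real.exp (u z) ≤ Real.exp (R + Real.log ‖z‖) := by
      rw [Real.exp_le_exp]
      linarith [(abs_le.1 (hR z hz)).2]
    rwa [Real.exp_add, Real.exp_log hz'] at h0
  have h2 : ‖h z‖ ≤ |C| / ‖z‖ ^ d := by
    rw [le_div_iff₀ (by positivity)]
    exact (hC z hz).trans (le_abs_self C)
  refine h2.trans ?_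
  rw [div_le_iff₀ (by positivity), mul_assoc, mul_assoc]
  refine le_mul_of_one_le_right (abs_nonneg C) ?_
  have h3 : Real.exp (u z) ^ d ≤ Real.exp R ^ d * ‖z‖ ^ d := by
    rw [← mul_pow]
    exact pow_le_pow_left₀ (Real.exp_pos _).le h1 d
  rw [← Real.exp_nat_mul, ← Real.exp_nat_mul] at h3
  calc (1 : ℝ) = Real.exp (-d * u z) * Real.exp (d * u z) := by
        rw [← Real.exp_add]; simp
    _ ≤ Real.exp (-d * u z) * (Real.exp (d * R) * ‖z‖ ^ d) := by gcongr
    _ = _ := by ring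

namespace Small

variable {u : Cn n → ℝ} {s ε : ℝ} {h : Cn n → ℂ}

theorem of_ordBound (hu : LogHom u) (hε : 0 < ε) {d : ℕ} (hd : d + s ≤ 2 * n) {g : Cn n → ℂ}
    (hg : Measurable g) (hb : ∃ C, ∀ z, ‖g z‖ ≤ C) (hs : ∀ z, z ≠ 0 → -ε < u z → g z = 0)
    (hh : OrdBound h d) : Small u s ε fun z => g z * h z := by
  obtain ⟨C, hC⟩ := hb
  obtain ⟨D, hD, hDh⟩ := hh.exp_bound hu
  have hC0 : 0 ≤ C := (norm_nonneg _).trans (hC 0)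
  refine ⟨hg.mul (measurable_of_continuousOn_compl_singleton 0 hh.1),
    fun z hz hz' => by rw [hs z hz hz', zero_mul], C * D, by positivity, fun z hz => ?_⟩
  by_cases hz' : -ε < u z
  · rw [hs z hz hz', zero_mul, norm_zero]
    positivity
  · have h1 : Real.exp (-d * u z) ≤ Real.exp (s * u z) * Real.exp (-(2 * n) * u z) := by
      rw [← Real.exp_add, Real.exp_le_exp]
      nlinarith
    calc ‖g z * h z‖ = ‖g z‖ * ‖h z‖ := norm_mul _ _
      _ ≤ C * (D * Real.exp (-d * u z)) := mul_le_mul (hC z) (hDh z hz) (norm_nonneg _) hC0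
      _ ≤ C * (D * (Real.exp (s * u z) * Real.exp (-(2 * n) * u z))) := by gcongr
      _ = _ := by ring

theorem zero (u : Cn n → ℝ) (s ε : ℝ) : Small u s ε fun _ => 0 :=
  ⟨measurable_const, fun _ _ _ => rfl, 0, le_rfl, fun z _ => by simp⟩

theorem congr (hh : Small u s ε h) {k : Cn n → ℂ} (hk : Measurable k)
    (e : ∀ z, z ≠ 0 → k z = h z) : Small u s ε k := by
  obtain ⟨C, hC, hb⟩ := hh.bound
  exact ⟨hk, fun z hz hz' => (e z hz).trans (hh.supp z hz hz'), C, hC,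
    fun z hz => by rw [e z hz]; exact hb z hz⟩

theorem levelMean_eq_zero (hu : LogHom u) (hh : Small u s ε h) {t : ℝ} (ht : -ε < t) :
    levelMean u h t = 0 := by
  refine integral_eq_zero_of_ae (ae_of_all _ fun ζ => ?_)
  have := hh.supp _ (polarPt_ne_zero u t ζ) (by rwa [hu.apply_polarPt])
  simp only [this, mul_zero, Pi.zero_apply]

theorem norm_levelMean_le (hu : LogHom u) (hh : Small u s ε h) :
    ∃ C, 0 ≤ C ∧ ∀ t, ‖levelMean u h t‖ ≤ C * Real.exp (s * t) := by
  obtain ⟨C, hC, hb⟩ := hh.bound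
  refine ⟨C * ∫ ζ : Sph n, Real.exp (-(2 * n) * u ζ) ∂(sphMeas n),
    mul_nonneg hC (integral_nonneg fun ζ => (Real.exp_pos _).le), fun t => ?_⟩
  refine (hu.norm_levelMean_le (w := fun t => C * Real.exp (s * t)) hb t).trans (le_of_eq ?_)
  ring

/-- Functions of critical size are integrable against lifts of measures that are finite near
`-∞`. -/
theorem integrable (hu : LogHom u) (hs : 0 ≤ s) (hε : 0 < ε) (hh : Small u s ε h)
    {M : Measure ℝ} [SFinite M] (hM : M (Set.Iic (-ε)) < ⊤) : Integrable h (liftMeas u M) := by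
  obtain ⟨C, hC, hb⟩ := hh.bound
  refine hu.integrable_of_bound hh.meas (w := (Set.Iic (-ε)).indicator fun _ => C) ?_ fun z hz => ?_
  · rw [integrable_indicator_iff measurableSet_Iic]
    exact integrableOn_const (hs := hM.ne)
  · by_cases hz' : u z ≤ -ε
    · rw [Set.indicator_of_mem (Set.mem_Iic.2 hz')]
      refine (hb z hz).trans ?_
      gcongr
      refine mul_le_of_le_one_right hC (Real.exp_le_one_iff.2 ?_)
      exact mul_nonpos_of_nonneg_of_nonpos hs (by linarith)
    · rw [Set.indicator_of_notMem (by simpa using hz'), hh.supp z hz (not_le.1 hz')]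
      simp

/-- Multiplication by a function of `u` that is bounded on compact subsets of `{u < 0}`. -/
theorem mul_comp (hu : LogHom u) (hh : Small u s ε h) {F : ℝ → ℝ} (hF : Measurable F) {s' : ℝ}
    (hb : ∃ C, 0 ≤ C ∧ ∀ t ≤ -ε, |F t| * Real.exp (s * t) ≤ C * Real.exp (s' * t)) :
    Small u s' ε fun z => (F (u z) : ℂ) * h z := by
  obtain ⟨C, hC, hb'⟩ := hh.bound
  obtain ⟨D, hD, hF'⟩ := hb
  refine ⟨(Complex.measurable_ofReal.comp (hF.comp hu.measurable)).mul hh.meas,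
    fun z hz hz' => by rw [hh.supp z hz hz', mul_zero], C * D, by positivity, fun z hz => ?_⟩
  by_cases hz' : -ε < u z
  · rw [hh.supp z hz hz', mul_zero, norm_zero]
    positivity
  · rw [norm_mul, Complex.norm_real, Real.norm_eq_abs]
    calc |F (u z)| * ‖h z‖
        ≤ |F (u z)| * (C * Real.exp (s * u z) * Real.exp (-(2 * n) * u z)) := by
          gcongr
          exact hb' z hz
      _ = C * (|F (u z)| * Real.exp (s * u z)) * Real.exp (-(2 * n) * u z) := by ring
      _ ≤ C * (D * Real.exp (s' * u z)) * Real.exp (-(2 * n) * u z) := by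
          refine mul_le_mul_of_nonneg_right (mul_le_mul_of_nonneg_left ?_ hC) (Real.exp_pos _).le
          exact hF' _ (not_lt.1 hz')
      _ = _ := by ring

theorem integrable_abs (hu : LogHom u) (hs : 0 < s) (hh : Small u s ε h) :
    Integrable h (liftMeas u (volume.restrict (Set.Iio 0))) := by
  obtain ⟨C, hC, hb⟩ := hh.bound
  refine hu.integrable_of_bound hh.meas (w := fun t => C * Real.exp (s * t)) ?_ hb
  exact ((integrableOn_exp_mul_Iic hs 0).mono_set Set.Iio_subset_Iic_self).const_mul C

theorem integrableOn_levelMean (hu : LogHom u) (hs : 0 < s) (hh : Small u s ε h)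
    (hc : Continuous (levelMean u h)) : IntegrableOn (levelMean u h) (Set.Iio 0) := by
  obtain ⟨C, hC, hb⟩ := hh.norm_levelMean_le hu
  exact Integrable.mono' (((integrableOn_exp_mul_Iic hs 0).mono_set
    Set.Iio_subset_Iic_self).const_mul C) hc.aestronglyMeasurable (ae_of_all _ hb)

end Small

theorem levelMean_mul_comp {u : Cn n → ℝ} (hu : LogHom u) (F : ℝ → ℝ) (h : Cn n → ℂ) (t : ℝ) :
    levelMean u (fun z => (F (u z) : ℂ) * h z) t = F t * levelMean u h t := by
  simp only [levelMean, hu.apply_polarPt]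
  rw [← integral_const_mul]
  refine integral_congr_ae (ae_of_all _ fun ζ => ?_)
  simp only
  ring

/-- On a compact subset of a domain `{0} ∪ {u < 0}`, `u` is bounded away from zero. -/
theorem LogHom.exists_le_neg {u : Cn n → ℝ} (hu : LogHom u) {K : Set (Cn n)} (hK : IsCompact K)
    (hK0 : ∀ z ∈ K, z = 0 ∨ u z < 0) : ∃ ε, 0 < ε ∧ ∀ z ∈ K, z ≠ 0 → u z ≤ -ε := by
  obtain ⟨R, hR⟩ := hu.exists_bound
  have hr : 0 < Real.exp (-1 - R) := Real.exp_pos _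
  have hsmall : ∀ z : Cn n, z ≠ 0 → ‖z‖ < Real.exp (-1 - R) → u z ≤ -1 := by
    intro z hz hz'
    have h1 := (Real.log_lt_iff_lt_exp (norm_pos_iff.2 hz)).2 hz'
    linarith [(abs_le.1 (hR z hz)).2]
  set K' := K \ Metric.ball 0 (Real.exp (-1 - R)) with hK'
  have hKc : IsCompact K' := hK.diff Metric.isOpen_ball
  have hne : ∀ z ∈ K', z ≠ 0 := by
    rintro z ⟨_, hz⟩ rfl
    exact hz (Metric.mem_ball_self hr)
  have main : ∃ ε, 0 < ε ∧ ∀ z ∈ K', u z ≤ -ε := by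
    rcases K'.eq_empty_or_nonempty with h | h
    · exact ⟨1, one_pos, fun z hz => by simp [h] at hz⟩
    · obtain ⟨z₀, hz₀, hmax⟩ := hKc.exists_isMaxOn h (hu.continuousOn.mono fun z hz => hne z hz)
      refine ⟨-u z₀, neg_pos.2 ((hK0 z₀ hz₀.1).resolve_left (hne z₀ hz₀)), fun z hz => ?_⟩
      rw [neg_neg]
      exact hmax hz
  obtain ⟨ε, hε, h⟩ := main
  refine ⟨min ε 1, lt_min hε one_pos, fun z hz hz0 => ?_⟩
  by_cases hb : z ∈ Metric.ball (0 : Cn n) (Real.exp (-1 - R))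
  · exact (hsmall z hz0 (by simpa using hb)).trans (neg_le_neg (min_le_right _ _))
  · exact (h z ⟨hz, hb⟩).trans (neg_le_neg (min_le_left _ _))

/-! ### The two integrations by parts -/

theorem wirt_eq_zero_of_notMem {c : ℂ} {j : Fin n} {χ : Cn n → ℂ} {z : Cn n}
    (hz : z ∉ tsupport χ) : wirt c j χ z = 0 := by
  have h : χ =ᶠ[𝓝 z] fun _ => 0 := notMem_tsupport_iff_eventuallyEq.1 hz
  rw [wirt_congr h, wirt_const]

theorem IsTestFunction.wirt {Ω : Set (Cn n)} {χ : Cn n → ℂ} (hχ : IsTestFunction Ω χ) (c : ℂ)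
    (j : Fin n) : IsTestFunction Ω (wirt c j χ) := by
  have hs : tsupport (Pluripotential.wirt c j χ) ⊆ tsupport χ :=
    closure_minimal (fun z hz => by
      by_contra h
      exact hz (wirt_eq_zero_of_notMem h)) (isClosed_tsupport _)
  refine ⟨?_, hχ.2.1.of_isClosed_subset (isClosed_tsupport _) hs, hs.trans hχ.2.2⟩
  exact contDiff_iff_contDiffAt.2 fun z => contDiffAt_wirt hχ.1.contDiffAt

theorem IsTestFunction.ordBound {Ω : Set (Cn n)} {χ : Cn n → ℂ} (hχ : IsTestFunction Ω χ) :
    OrdBound χ 0 := ordBound_of_compactSupport hχ.1.continuous hχ.2.1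

section Bounds

variable {u : Cn n → ℝ} {Ω : Set (Cn n)} {χ : Cn n → ℂ} {k : ℕ}

theorem LogHom.ordBound_prod_hess (hu : LogHom u) (p q : Fin k → Fin n) :
    OrdBound (fun z => ∏ i, hess u (p i) (q i) z) (2 * k) :=
  (HomDeg.prod fun i => hu.homDeg_hess (p i) (q i)).ordBound fun _ hz =>
    (contDiffAt_prod fun _ _ => hu.contDiffAt_hess _ _ hz).continuousAt.continuousWithinAt

theorem LogHom.ordBound_gradR (hu : LogHom u) (q : Fin n) : OrdBound (gradR u q) 1 :=
  (hu.homDeg_grad Complex.I q).ordBound fun _ hz =>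
    (hu.contDiffAt_gradR _ hz).continuousAt.continuousWithinAt

theorem LogHom.ordBound_formD (hu : LogHom u) (I J : Fin k → Fin n) :
    OrdBound (formD u I J) (2 * k) :=
  OrdBound.altSum fun _ _ => hu.ordBound_prod_hess _ _

theorem LogHom.ordBound_formB (hu : LogHom u) (I J : Fin (k + 1) → Fin n) :
    OrdBound (formB u (fun _ : Fin k => u) I J) (2 * (k + 1)) :=
  (homDeg_formB hu (fun _ => hu) I J).ordBound fun _ hz =>
    (contDiffAt_formB hu (fun _ => hu) I J hz).continuousAt.continuousWithinAt

theorem LogHom.ordBound_formC (hu : LogHom u) (hχ : IsTestFunction Ω χ)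
    (I J : Fin (k + 1) → Fin n) : OrdBound (formC u χ I J) (0 + 1 + 2 * k) :=
  OrdBound.altSum fun _ _ => ((hχ.wirt _ _).ordBound.mul (hu.ordBound_gradR _)).mul
    (hu.ordBound_prod_hess _ _)

theorem LogHom.ordBound_formA (hu : LogHom u) (hχ : IsTestFunction Ω χ)
    (I J : Fin (k + 1) → Fin n) : OrdBound (formA u χ I J) (0 + 2 * k) :=
  OrdBound.altSum fun _ _ => ((hχ.wirt _ _).wirt _ _).ordBound.mul (hu.ordBound_prod_hess _ _)

/-- A function supported in the support of a test function is small as soon as its order at the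
origin permits. -/
theorem Small.of_support (hu : LogHom u) {K : Set (Cn n)} (hK : IsCompact K) {ε : ℝ} (hε : 0 < ε)
    (hKε : ∀ z ∈ K, z ≠ 0 → u z ≤ -ε) {h : Cn n → ℂ} (hm : Measurable h) {d : ℕ} {s : ℝ}
    (hd : d + s ≤ 2 * n) (hh : OrdBound h d) (hs : ∀ z ∉ K, h z = 0) : Small u s ε h := by
  have h1 := Small.of_ordBound (s := s) hu hε hd (g := K.indicator fun _ => 1)
    (measurable_const.indicator hK.measurableSet)
    ⟨1, fun z => by
      by_cases hz : z ∈ K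
      · simp [Set.indicator_of_mem hz]
      · simp [Set.indicator_of_notMem hz]⟩
    (fun z hz hz' => Set.indicator_of_notMem (fun h' => absurd (hKε z h' hz) (not_le.2 hz')) _) hh
  refine h1.congr hm fun z _ => ?_
  by_cases hz : z ∈ K
  · rw [Set.indicator_of_mem hz, one_mul]
  · rw [hs z hz, mul_zero]

theorem formC_eq_zero (I J : Fin (k + 1) → Fin n) {z : Cn n} (hz : z ∉ tsupport χ) :
    formC u χ I J z = 0 := by
  simp [formC, altSum, wirt_eq_zero_of_notMem hz]

theorem formA_eq_zero (I J : Fin (k + 1) → Fin n) {z : Cn n} (hz : z ∉ tsupport χ) :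
    formA u χ I J z = 0 := by
  have h : ∀ c j, wirt c j χ =ᶠ[𝓝 z] fun _ => 0 := fun c j => by
    have h' : χ =ᶠ[𝓝 z] fun _ => 0 := notMem_tsupport_iff_eventuallyEq.1 hz
    filter_upwards [h'.eventuallyEq_nhds] with w hw
    rw [wirt_congr hw, wirt_const]
  simp [formA, altSum, wirt_congr (h _ _), wirt_const]

end Bounds

theorem OrdBound.measurable {h : Cn n → ℂ} {d : ℕ} (hh : OrdBound h d) : Measurable h :=
  measurable_of_continuousOn_compl_singleton 0 hh.1

theorem Small.tendsto {u : Cn n → ℝ} (hu : LogHom u) {s ε : ℝ} (hs : 0 < s) {h : Cn n → ℂ}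
    (hh : Small u s ε h) : Tendsto (levelMean u h) atBot (𝓝 0) := by
  obtain ⟨C, hC, hb⟩ := hh.norm_levelMean_le hu
  refine squeeze_zero_norm hb ?_
  have : Tendsto (fun t : ℝ => Real.exp (s * t)) atBot (𝓝 0) :=
    Real.tendsto_exp_atBot.comp (tendsto_id.const_mul_atBot hs)
  simpa using this.const_mul C

theorem Small.integrableOn_mul {u : Cn n → ℝ} (hu : LogHom u) {s ε s' : ℝ} (hs : 0 < s')
    {h : Cn n → ℂ} (hh : Small u s ε h) (hc : Continuous (levelMean u h)) {F : ℝ → ℝ}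
    (hF : Measurable F)
    (hb : ∃ C, 0 ≤ C ∧ ∀ t ≤ -ε, |F t| * Real.exp (s * t) ≤ C * Real.exp (s' * t)) :
    IntegrableOn (fun t => (F t : ℂ) * levelMean u h t) (Set.Iio 0) := by
  obtain ⟨C, hC, hb'⟩ := (hh.mul_comp hu hF hb).norm_levelMean_le hu
  refine Integrable.mono' (((integrableOn_exp_mul_Iic hs 0).mono_set
    Set.Iio_subset_Iic_self).const_mul C)
    ((Complex.measurable_ofReal.comp hF).mul hc.measurable).aestronglyMeasurable
    (ae_of_all _ fun t => ?_)
  have := hb' t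
  rwa [levelMean_mul_comp hu] at this

theorem Profile.measurable_rd (f : ℝ → ℝ) : Measurable (rd f) := measurable_derivWithin_Ioi f

theorem Profile.exp_bound {f : ℝ → ℝ} (hf : Profile f) {ε : ℝ} (hε : 0 < ε) :
    ∃ C, 0 ≤ C ∧ ∀ t ≤ -ε, |f t| * Real.exp (1 * t) ≤ C * Real.exp (1 / 2 * t) := by
  obtain ⟨a, ha, hb⟩ := hf.abs_le
  refine ⟨a * 2, by positivity, fun t ht => ?_⟩
  have ht0 : t < 0 := by linarith
  have h1 := hb t ht0
  rw [abs_of_neg ht0] at h1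
  have h2 : Real.exp (1 * t) = Real.exp (1 / 2 * t) * Real.exp (1 / 2 * t) := by
    rw [← Real.exp_add]; ring_nf
  have h3 : (1 + -t) * Real.exp (1 / 2 * t) ≤ 2 := by
    have h4 := Real.add_one_le_exp (-(1 / 2 * t))
    have h5 : Real.exp (-(1 / 2 * t)) * Real.exp (1 / 2 * t) = 1 := by
      rw [← Real.exp_add]; simp
    have h6 : 0 < Real.exp (1 / 2 * t) := Real.exp_pos _
    nlinarith
  rw [h2, ← mul_assoc]
  refine mul_le_mul_of_nonneg_right ?_ (Real.exp_pos _).le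
  calc |f t| * Real.exp (1 / 2 * t) ≤ a * (1 + -t) * Real.exp (1 / 2 * t) := by gcongr
    _ = a * ((1 + -t) * Real.exp (1 / 2 * t)) := by ring
    _ ≤ a * 2 := by gcongr

theorem RCMono.exp_bound {F : ℝ → ℝ} (hF : RCMono F) {ε : ℝ} (hε : 0 < ε) (s : ℝ) :
    ∃ C, 0 ≤ C ∧ ∀ t ≤ -ε, |F t| * Real.exp (s * t) ≤ C * Real.exp (s * t) := by
  have hn : -ε < 0 := neg_lt_zero.2 hε
  refine ⟨F (-ε), hF.nonneg _ hn, fun t ht => ?_⟩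
  have ht0 : t < 0 := lt_of_le_of_lt ht hn
  rw [abs_of_nonneg (hF.nonneg t ht0)]
  exact mul_le_mul_of_nonneg_right (hF.mono ht0 hn ht) (Real.exp_pos _).le

section Parts

variable {u : Cn n → ℝ} {Ω : Set (Cn n)} {χ : Cn n → ℂ} {k : ℕ} {f : ℝ → ℝ}

theorem continuous_levelMean_of_ordBound (hu : LogHom u) {h : Cn n → ℂ} {d : ℕ}
    (hh : OrdBound h d) : Continuous (levelMean u h) := hu.continuous_levelMean hh.1

theorem small_formC (hu : LogHom u) (hχ : IsTestFunction Ω χ) {ε : ℝ} (hε : 0 < ε)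
    (hχε : ∀ z ∈ tsupport χ, z ≠ 0 → u z ≤ -ε) (hk : k < n) (I J : Fin (k + 1) → Fin n) :
    Small u 1 ε (formC u χ I J) :=
  have hk' : (k : ℝ) + 1 ≤ n := by exact_mod_cast hk
  Small.of_support hu hχ.2.1 hε hχε (hu.ordBound_formC hχ I J).measurable
    (by push_cast; linarith) (hu.ordBound_formC hχ I J) fun _ hz => formC_eq_zero I J hz

theorem small_formA (hu : LogHom u) (hχ : IsTestFunction Ω χ) {ε : ℝ} (hε : 0 < ε)
    (hχε : ∀ z ∈ tsupport χ, z ≠ 0 → u z ≤ -ε) (hk : k < n) (I J : Fin (k + 1) → Fin n) :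
    Small u 1 ε (formA u χ I J) :=
  have hk' : (k : ℝ) + 1 ≤ n := by exact_mod_cast hk
  Small.of_support hu hχ.2.1 hε hχε (hu.ordBound_formA hχ I J).measurable
    (by push_cast; linarith) (hu.ordBound_formA hχ I J) fun _ hz => formA_eq_zero I J hz

/-- `(∂∂̄u)^k` is of less than critical size for `k < n`, and vanishes for `k = n`. -/
theorem small_mul_formD (hu : LogHom u) {g : Cn n → ℂ} {K : Set (Cn n)} (hK : IsCompact K)
    (hg : Measurable g) (hgb : ∃ C, ∀ z, ‖g z‖ ≤ C) (hgK : ∀ z ∉ K, g z = 0) {ε : ℝ} (hε : 0 < ε)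
    (hKε : ∀ z ∈ K, z ≠ 0 → u z ≤ -ε) (hk : k ≤ n) (I J : Fin k → Fin n) :
    Small u 1 ε fun z => g z * formD u I J z := by
  have hD := hu.ordBound_formD I J
  rcases hk.lt_or_eq with hk | rfl
  · have hk' : (k : ℝ) + 1 ≤ n := by exact_mod_cast hk
    refine Small.of_ordBound hu hε (by push_cast; linarith) hg hgb (fun z hz hz' => hgK z ?_) hD
    exact fun h => absurd (hKε z h hz) (not_le.2 hz')
  · refine (Small.zero u 1 ε).congr (hg.mul hD.measurable) fun z hz => ?_
    rw [hu.formD_eq_zero I J hz, mul_zero]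

theorem small_mul_formB (hu : LogHom u) {g : Cn n → ℂ} {K : Set (Cn n)}
    (hg : Measurable g) (hgb : ∃ C, ∀ z, ‖g z‖ ≤ C) (hgK : ∀ z ∉ K, g z = 0) {ε s : ℝ} (hε : 0 < ε)
    (hKε : ∀ z ∈ K, z ≠ 0 → u z ≤ -ε) (hk : 2 * (k + 1) + s ≤ 2 * n) (I J : Fin (k + 1) → Fin n) :
    Small u s ε fun z => g z * formB u (fun _ : Fin k => u) I J z := by
  refine Small.of_ordBound hu hε (by push_cast; linarith) hg hgb (fun z hz hz' => hgK z ?_)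
    (hu.ordBound_formB I J)
  exact fun h => absurd (hKε z h hz) (not_le.2 hz')

theorem IsTestFunction.bounded (hχ : IsTestFunction Ω χ) : ∃ C, ∀ z, ‖χ z‖ ≤ C :=
  hχ.2.1.exists_bound_of_continuous hχ.1.continuous

/-- The mass that the top power puts at the origin, as a limit along the level sets. -/
theorem tendsto_levelMean_formB (hu : LogHom u) (hχ : IsTestFunction Ω χ) (hk : k + 1 = n)
    (I J : Fin (k + 1) → Fin n) :
    Tendsto (levelMean u fun z => χ z * formB u (fun _ : Fin k => u) I J z) atBot
      (𝓝 (χ 0 * ∫ ζ : Sph n, formB u (fun _ : Fin k => u) I J ζ ∂(sphMeas n))) := by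
  obtain ⟨C, hC⟩ := hχ.bounded
  have hhom : HomDeg (formB u (fun _ : Fin k => u) I J) (2 * n) := by
    simpa only [show 2 * (k + 1) = 2 * n by omega] using homDeg_formB hu (fun _ => hu) I J
  have hcB : Continuous fun ζ : Sph n => formB u (fun _ : Fin k => u) I J ζ :=
    (hu.ordBound_formB I J).1.comp_continuous continuous_subtype_val fun ζ => sph_ne_zero ζ
  have hiB : Integrable (fun ζ : Sph n => formB u (fun _ : Fin k => u) I J ζ) (sphMeas n) :=
    hcB.integrable_of_hasCompactSupport (HasCompactSupport.of_compactSpace _)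
  have e : (levelMean u fun z => χ z * formB u (fun _ : Fin k => u) I J z) = fun t =>
      ∫ ζ : Sph n, χ (polarPt u t ζ) * formB u (fun _ : Fin k => u) I J ζ ∂(sphMeas n) := by
    funext t
    refine integral_congr_ae (ae_of_all _ fun ζ => ?_)
    have := hhom (Real.exp (t - u ζ)) (Real.exp_pos _) ζ (sph_ne_zero ζ)
    simp only
    rw [← this, ← Complex.ofReal_pow, ← Real.exp_nat_mul, polarPt]
    push_cast
    ring
  rw [e, ← integral_const_mul]
  refine tendsto_integral_filter_of_dominated_convergence
    (fun ζ => C * ‖formB u (fun _ : Fin k => u) I J ζ‖) ?_ ?_ (hiB.norm.const_mul C) ?_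
  · refine Eventually.of_forall fun t => ?_
    have : Continuous fun ζ : Sph n => polarPt u t ζ :=
      hu.continuous_polarPt.comp (f := fun ζ : Sph n => (t, ζ)) (by fun_prop)
    exact ((hχ.1.continuous.comp this).mul hcB).aestronglyMeasurable
  · refine Eventually.of_forall fun t => ae_of_all _ fun ζ => ?_
    rw [norm_mul]
    exact mul_le_mul_of_nonneg_right (hC _) (norm_nonneg _)
  · refine ae_of_all _ fun ζ => ?_
    refine Tendsto.mul_const _ ?_
    have h0 : Tendsto (fun t => polarPt u t ζ) atBot (𝓝 0) := by
      have h1 : Tendsto (fun t : ℝ => Real.exp (t - u ζ)) atBot (𝓝 0) :=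
        Real.tendsto_exp_atBot.comp (tendsto_atBot_add_const_right _ _ tendsto_id)
      simpa [polarPt] using h1.smul_const (ζ : Cn n)
    exact (hχ.1.continuous.tendsto 0).comp h0

/-- The density of `(∂∂̄φ)^k` and its singular part, tested against `f ∂∂̄χ`: one integration by
parts. -/
theorem parts_formC [NeZero n] (hu : LogHom u) (hf : Profile f) (hχ : IsTestFunction Ω χ) {ε : ℝ}
    (hε : 0 < ε) (hχε : ∀ z ∈ tsupport χ, z ≠ 0 → u z ≤ -ε) (hk : k < n)
    (I J : Fin (k + 1) → Fin n) :
    (∫ t in Set.Iio (0 : ℝ), ((rd f t ^ k : ℝ) : ℂ) * (f t * levelMean u (formA u χ I J) t))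
      + ∫ t, (f t : ℂ) * levelMean u (formC u χ I J) t ∂(dMeas fun x => rd f x ^ k)
      = -∫ t in Set.Iio (0 : ℝ), ((rd f t ^ (k + 1) : ℝ) : ℂ) * levelMean u (formC u χ I J) t := by
  have sA := small_formA hu hχ hε hχε hk I J
  have sC := small_formC hu hχ hε hχε hk I J
  have cA := continuous_levelMean_of_ordBound hu (hu.ordBound_formA hχ I J)
  have cC := continuous_levelMean_of_ordBound hu (hu.ordBound_formC hχ I J)
  have hF := hf.rcMono.pow k
  have hF' := hf.rcMono.pow (k + 1)
  have hFm : Measurable fun x => rd f x ^ k := (Profile.measurable_rd f).pow_const k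
  have hFm' : Measurable fun x => rd f x ^ (k + 1) := (Profile.measurable_rd f).pow_const _
  have iA : IntegrableOn (fun t => (f t : ℂ) * levelMean u (formA u χ I J) t) (Set.Iio 0) :=
    sA.integrableOn_mul hu (by norm_num) cA hf.meas (hf.exp_bound hε)
  have iC : IntegrableOn (fun t => (rd f t : ℂ) * levelMean u (formC u χ I J) t) (Set.Iio 0) :=
    sC.integrableOn_mul hu one_pos cC (Profile.measurable_rd f) (hf.rcMono.exp_bound hε 1)
  have iFC : IntegrableOn (fun t => ((rd f t ^ (k + 1) : ℝ) : ℂ) * levelMean u (formC u χ I J) t)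
      (Set.Iio 0) :=
    sC.integrableOn_mul hu one_pos cC hFm' (hF'.exp_bound hε 1)
  have iFA : IntegrableOn
      (fun t => ((rd f t ^ k : ℝ) : ℂ) * (f t * levelMean u (formA u χ I J) t)) (Set.Iio 0) := by
    obtain ⟨C, hC, hb⟩ := hf.exp_bound hε
    obtain ⟨D, hD, hb'⟩ := hF.exp_bound hε 1
    refine (sA.integrableOn_mul (F := fun t => rd f t ^ k * f t) hu (s' := 1 / 2) (by norm_num) cA
      (hFm.mul hf.meas) ?_).congr_fun (fun t _ => by push_cast; ring) measurableSet_Iio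
    refine ⟨D * C, by positivity, fun t ht => ?_⟩
    have h1 : |rd f t ^ k| ≤ D := le_of_mul_le_mul_right (hb' t ht) (Real.exp_pos _)
    rw [abs_mul, mul_assoc, mul_assoc]
    exact mul_le_mul h1 (hb t ht) (by positivity) hD
  have hsub : Set.Iic (-(ε / 2)) ⊆ Set.Iio (0 : ℝ) := fun t ht =>
    Set.mem_Iio.2 (lt_of_le_of_lt (Set.mem_Iic.1 ht) (neg_lt_zero.2 (half_pos hε)))
  have h := hF.integral_by_parts (ε := ε / 2) (L := 0) (by positivity)
    (g := fun t => (f t : ℂ) * levelMean u (formC u χ I J) t)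
    (g' := fun t => (rd f t : ℂ) * levelMean u (formC u χ I J) t
      + (f t : ℂ) * levelMean u (formA u χ I J) t)
    ((Complex.continuous_ofReal.comp_continuousOn hf.continuousOn).mul cC.continuousOn)
    (fun x hx => (hf.hasDeriv hx).ofReal_comp.mul
      (hu.hasDerivAt_formC hχ.1 I J x).hasDerivWithinAt)
    (fun x hx _ => by rw [sC.levelMean_eq_zero hu (by linarith), mul_zero])
    (fun x hx _ => by
      rw [sC.levelMean_eq_zero hu (by linarith), sA.levelMean_eq_zero hu (by linarith)]; simp)
    ((iC.add iA).mono_set hsub)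
    (by
      have := (sC.mul_comp hu hf.meas (hf.exp_bound hε)).tendsto hu (by norm_num)
      refine this.congr fun t => ?_
      rw [levelMean_mul_comp hu])
  rw [h, mul_zero, sub_zero]
  have e : ∀ t, ((rd f t ^ k : ℝ) : ℂ) * ((rd f t : ℂ) * levelMean u (formC u χ I J) t
      + (f t : ℂ) * levelMean u (formA u χ I J) t)
      = ((rd f t ^ (k + 1) : ℝ) : ℂ) * levelMean u (formC u χ I J) t
        + ((rd f t ^ k : ℝ) : ℂ) * (f t * levelMean u (formA u χ I J) t) := fun t => by
    push_cast; ring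
  simp only [e]
  rw [integral_add iFC iFA]
  ring

/-- The second integration by parts, which produces the density and the singular part of
`(∂∂̄φ)^(k+1)`. -/
theorem parts_formB [NeZero n] (hu : LogHom u) (hf : Profile f) (hχ : IsTestFunction Ω χ) {ε : ℝ}
    (hε : 0 < ε) (hχε : ∀ z ∈ tsupport χ, z ≠ 0 → u z ≤ -ε) (hk : k < n)
    (I J : Fin (k + 1) → Fin n) :
    -(∫ t in Set.Iio (0 : ℝ), ((rd f t ^ (k + 1) : ℝ) : ℂ) * levelMean u (formC u χ I J) t)
      = (∫ t in Set.Iio (0 : ℝ), ((rd f t ^ (k + 1) : ℝ) : ℂ) *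
          levelMean u (fun z => χ z * formD u I J z) t)
        + (∫ t, levelMean u (fun z => χ z * formB u (fun _ : Fin k => u) I J z) t
            ∂(dMeas fun x => rd f x ^ (k + 1)))
        + limBot (fun x => rd f x ^ (k + 1)) * (if k + 1 = n then
            χ 0 * ∫ ζ : Sph n, formB u (fun _ : Fin k => u) I J ζ ∂(sphMeas n) else 0) := by
  have hχm : Measurable χ := hχ.1.continuous.measurable
  have hχ0 : ∀ z ∉ tsupport χ, χ z = 0 := fun z hz => image_eq_zero_of_notMem_tsupport hz
  have sC := small_formC hu hχ hε hχε hk I J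
  have sD := small_mul_formD hu hχ.2.1 hχm hχ.bounded hχ0 hε hχε (Nat.succ_le_of_lt hk) I J
  have hk' : (k : ℝ) + 1 ≤ n := by exact_mod_cast hk
  have sB : Small u 0 ε fun z => χ z * formB u (fun _ : Fin k => u) I J z :=
    small_mul_formB hu hχm hχ.bounded hχ0 hε hχε (by linarith) I J
  have cC := continuous_levelMean_of_ordBound hu (hu.ordBound_formC hχ I J)
  have cD := continuous_levelMean_of_ordBound hu (hχ.ordBound.mul (hu.ordBound_formD I J))
  have hF := hf.rcMono.pow (k + 1)
  have hFm : Measurable fun x => rd f x ^ (k + 1) := (Profile.measurable_rd f).pow_const _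
  have iD := sD.integrableOn_levelMean hu one_pos cD
  have iC := sC.integrableOn_levelMean hu one_pos cC
  have iFC : IntegrableOn (fun t => ((rd f t ^ (k + 1) : ℝ) : ℂ) * levelMean u (formC u χ I J) t)
      (Set.Iio 0) := sC.integrableOn_mul hu one_pos cC hFm (hF.exp_bound hε 1)
  have iFD : IntegrableOn (fun t => ((rd f t ^ (k + 1) : ℝ) : ℂ) *
      levelMean u (fun z => χ z * formD u I J z) t)
      (Set.Iio 0) := sD.integrableOn_mul hu one_pos cD hFm (hF.exp_bound hε 1)
  have hsub : Set.Iic (-(ε / 2)) ⊆ Set.Iio (0 : ℝ) := fun t ht =>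
    Set.mem_Iio.2 (lt_of_le_of_lt (Set.mem_Iic.1 ht) (neg_lt_zero.2 (half_pos hε)))
  have hd := hu.hasDerivAt_formB hχ.1 I J
  have h := hF.integral_by_parts (ε := ε / 2) (L := if k + 1 = n then
      χ 0 * ∫ ζ : Sph n, formB u (fun _ : Fin k => u) I J ζ ∂(sphMeas n) else 0) (by positivity)
    (g := levelMean u fun z => χ z * formB u (fun _ : Fin k => u) I J z)
    (g' := fun t => levelMean u (fun z => χ z * formD u I J z) t + levelMean u (formC u χ I J) t)
    (fun t _ => (hd t).continuousAt.continuousWithinAt) (fun x _ => (hd x).hasDerivWithinAt)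
    (fun x hx _ => sB.levelMean_eq_zero hu (by linarith))
    (fun x hx _ => by
      rw [sC.levelMean_eq_zero hu (by linarith), sD.levelMean_eq_zero hu (by linarith), add_zero])
    ((iD.add iC).mono_set hsub)
    (by
      split_ifs with hkn
      · exact tendsto_levelMean_formB hu hχ hkn I J
      · have hk2 : (k : ℝ) + 2 ≤ n := by
          have : k + 2 ≤ n := by omega
          exact_mod_cast this
        exact (small_mul_formB (s := 1) hu hχm hχ.bounded hχ0 hε hχε (by linarith) I J).tendsto
          hu one_pos)
  rw [h]
  simp only [mul_add]
  rw [integral_add iFD iFC]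
  ring

end Parts

/-! ### The powers of `∂∂̄φ` -/

section Powers

variable {u : Cn n → ℝ} {f : ℝ → ℝ} {k : ℕ}

/-- The part `(f')^k(u) (∂∂̄u)^k` of `(∂∂̄φ)^k`, `φ = f(u)`, which has a density. -/
def absPart (u : Cn n → ℝ) (f : ℝ → ℝ) (k : ℕ) : Current n k := fun I J =>
  ⟨liftMeas u (volume.restrict (Set.Iio 0)), fun z => ((rd f (u z) ^ k : ℝ) : ℂ) * formD u I J z⟩

/-- The part `∂u ∧ ∂̄u ∧ (∂∂̄u)^(k-1) d((f')^k)(u)` of `(∂∂̄φ)^k`, at level `k + 1`. -/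
def singPart (u : Cn n → ℝ) (f : ℝ → ℝ) (k : ℕ) : Current n (k + 1) := fun I J =>
  ⟨liftMeas u (dMeas fun x => rd f x ^ (k + 1)), formB u (fun _ : Fin k => u) I J⟩

/-- The point mass of `(∂∂̄φ)^n` at the origin, at level `k + 1`. -/
def pointPart (u : Cn n → ℝ) (f : ℝ → ℝ) (k : ℕ) : Current n (k + 1) := fun I J =>
  ⟨Measure.dirac 0, fun _ => limBot (fun x => rd f x ^ (k + 1)) * if k + 1 = n then
    ∫ ζ : Sph n, formB u (fun _ : Fin k => u) I J ζ ∂(sphMeas n) else 0⟩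

/-- The powers of `∂∂̄φ` for `φ = f(u)`. -/
def powers (u : Cn n → ℝ) (f : ℝ → ℝ) : (k : ℕ) → Current n k
  | 0 => fun _ _ => ⟨volume, fun _ => 1⟩
  | k + 1 => fun I J => ((absPart u f (k + 1) I J).add (singPart u f k I J)).add (pointPart u f k I J)

instance sigmaFinite_add {c d : Coeff n} [SigmaFinite c.ν] [SigmaFinite d.ν] :
    SigmaFinite (c.add d).ν := by
  change SigmaFinite (c.ν + d.ν)
  infer_instance

theorem sigmaFinite_absPart (hu : LogHom u) (I J : Fin k → Fin n) :
    SigmaFinite (absPart u f k I J).ν := by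
  refine hu.sigmaFinite_liftMeas (M := volume.restrict (Set.Iio 0)) ?_ fun a b _ => ?_
  · rw [Measure.restrict_apply measurableSet_Ici]
    convert measure_empty (μ := (volume : Measure ℝ))
    ext x
    simp
  · exact (Measure.restrict_apply_le _ _).trans_lt measure_Icc_lt_top

theorem sigmaFinite_singPart (hu : LogHom u) (hf : Profile f) (I J : Fin (k + 1) → Fin n) :
    SigmaFinite (singPart u f k I J).ν := by
  have hF := hf.rcMono.pow (k + 1)
  refine hu.sigmaFinite_liftMeas hF.dMeas_Ici fun a b hb => ?_
  refine (measure_mono fun x hx => hx.2 : _ ≤ dMeas _ (Set.Iic b)).trans_lt ?_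
  rw [hF.dMeas_Iic hb]
  exact ENNReal.ofReal_lt_top

instance sigmaFinite_pointPart (I J : Fin (k + 1) → Fin n) :
    SigmaFinite (pointPart u f k I J).ν := by
  change SigmaFinite (Measure.dirac 0)
  infer_instance

theorem absPart_pair (hu : LogHom u) (hf : Profile f) {s ε : ℝ} (hs : 0 < s) (hε : 0 < ε)
    {h g : Cn n → ℂ} (hh : Small u s ε h) {I J : Fin k → Fin n}
    (e : ∀ z, z ≠ 0 → g z * formD u I J z = h z) :
    Integrable (fun z => g z * (absPart u f k I J).θ z) (absPart u f k I J).ν ∧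
      (absPart u f k I J).pair g
        = ∫ t in Set.Iio (0 : ℝ), ((rd f t ^ k : ℝ) : ℂ) * levelMean u h t := by
  have hF := hf.rcMono.pow k
  have hFm : Measurable fun x => rd f x ^ k := (Profile.measurable_rd f).pow_const k
  have h1 := (hh.mul_comp hu hFm (hF.exp_bound hε s)).integrable_abs hu hs
  have h2 : (fun z => ((rd f (u z) ^ k : ℝ) : ℂ) * h z)
      =ᵐ[liftMeas u (volume.restrict (Set.Iio 0))] fun z => g z * (absPart u f k I J).θ z := by
    filter_upwards [hu.ae_ne_zero _] with z hz
    rw [← e z hz]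
    simp only [absPart]
    ring
  refine ⟨h1.congr h2, (integral_congr_ae h2).symm.trans ?_⟩
  rw [hu.integral_liftMeas _ h1]
  refine integral_congr_ae (ae_of_all _ fun t => ?_)
  exact levelMean_mul_comp hu (fun t => rd f t ^ k) h t

theorem singPart_pair (hu : LogHom u) (hf : Profile f) {s ε : ℝ} (hs : 0 ≤ s) (hε : 0 < ε)
    {h g : Cn n → ℂ} (hh : Small u s ε h) {I J : Fin (k + 1) → Fin n}
    (e : ∀ z, z ≠ 0 → g z * formB u (fun _ : Fin k => u) I J z = h z) :
    Integrable (fun z => g z * (singPart u f k I J).θ z) (singPart u f k I J).ν ∧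
      (singPart u f k I J).pair g
        = ∫ t, levelMean u h t ∂(dMeas fun x => rd f x ^ (k + 1)) := by
  have hF := hf.rcMono.pow (k + 1)
  have h1 := hh.integrable hu hs hε (M := dMeas fun x => rd f x ^ (k + 1)) (by
    rw [hF.dMeas_Iic (neg_lt_zero.2 hε)]
    exact ENNReal.ofReal_lt_top)
  have h2 : h =ᵐ[liftMeas u (dMeas fun x => rd f x ^ (k + 1))]
      fun z => g z * (singPart u f k I J).θ z := by
    filter_upwards [hu.ae_ne_zero _] with z hz
    exact (e z hz).symm
  exact ⟨h1.congr h2, (integral_congr_ae h2).symm.trans (hu.integral_liftMeas _ h1)⟩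

theorem pointPart_pair (g : Cn n → ℂ) (I J : Fin (k + 1) → Fin n) :
    Integrable (fun z => g z * (pointPart u f k I J).θ z) (pointPart u f k I J).ν ∧
      (pointPart u f k I J).pair g = g 0 * (limBot (fun x => rd f x ^ (k + 1)) *
        if k + 1 = n then ∫ ζ : Sph n, formB u (fun _ : Fin k => u) I J ζ ∂(sphMeas n) else 0) := by
  simp only [pointPart, Coeff.pair, integral_dirac]
  exact ⟨integrable_dirac (by simp), trivial⟩

theorem volume_pair [NeZero n] (hu : LogHom u) {s ε : ℝ} (hs : 0 < s) (hε : 0 < ε)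
    {h g : Cn n → ℂ} (hh : Small u s ε h) (e : ∀ z, z ≠ 0 → g z = h z) :
    Integrable (fun z => g z * 1) (volume : Measure (Cn n)) ∧
      (Coeff.mk volume fun _ => 1).pair g = ∫ t in Set.Iio (0 : ℝ), levelMean u h t := by
  obtain ⟨C, hC, hb⟩ := hh.bound
  have h1 : Integrable h (liftMeas u volume) := by
    refine hu.integrable_of_bound hh.meas
      (w := (Set.Iic (-ε)).indicator fun t => C * Real.exp (s * t)) ?_ fun z hz => ?_
    · rw [integrable_indicator_iff measurableSet_Iic]
      exact (integrableOn_exp_mul_Iic hs _).const_mul C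
    · by_cases hz' : u z ≤ -ε
      · rw [Set.indicator_of_mem (Set.mem_Iic.2 hz')]
        exact hb z hz
      · rw [Set.indicator_of_notMem (by simpa using hz'), hh.supp z hz (not_le.1 hz')]
        simp
  have h2 : h =ᵐ[liftMeas u volume] fun z => g z * 1 := by
    filter_upwards [hu.ae_ne_zero _] with z hz
    rw [mul_one, e z hz]
  have h3 : ∫ z, g z * 1 ∂(liftMeas u volume) = ∫ t, levelMean u h t :=
    (integral_congr_ae h2).symm.trans (hu.integral_liftMeas _ h1)
  have h4 := h1.congr h2
  rw [hu.liftMeas_volume] at h3 h4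
  refine ⟨h4, h3.trans (setIntegral_eq_integral_of_forall_compl_eq_zero fun t ht => ?_).symm⟩
  exact hh.levelMean_eq_zero hu (by simp only [Set.mem_Iio, not_lt] at ht; linarith)

theorem levelMean_sum (hu : LogHom u) {ι : Type*} (s : Finset ι) (c : ι → ℂ) {h : ι → Cn n → ℂ}
    (hc : ∀ i, ContinuousOn (h i) {0}ᶜ) (t : ℝ) :
    levelMean u (fun z => ∑ i ∈ s, c i * h i z) t = ∑ i ∈ s, c i * levelMean u (h i) t := by
  simp only [levelMean, ← integral_const_mul]
  rw [← integral_finsetSum s fun i _ => (hu.integrable_sph (hc i) t).const_mul _]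
  refine integral_congr_ae (ae_of_all _ fun ζ => ?_)
  simp only [Finset.mul_sum]
  exact Finset.sum_congr rfl fun i _ => by ring

theorem sum_integral_levelMean (hu : LogHom u) {k : ℕ} (c : Fin k → Fin k → ℂ)
    {h : Fin k → Fin k → Cn n → ℂ} (hc : ∀ a b, ContinuousOn (h a b) {0}ᶜ) {M : Measure ℝ}
    {G : ℝ → ℂ} (hi : ∀ a b, Integrable (fun t => G t * levelMean u (h a b) t) M) {H : Cn n → ℂ}
    (hH : ∀ z, ∑ a, ∑ b, c a b * h a b z = H z) :
    ∑ a, ∑ b, c a b * ∫ t, G t * levelMean u (h a b) t ∂M = ∫ t, G t * levelMean u H t ∂M := by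
  have e : ∀ t, G t * levelMean u H t
      = ∑ i : Fin k × Fin k, c i.1 i.2 * (G t * levelMean u (h i.1 i.2) t) := by
    intro t
    have : H = fun z => ∑ i : Fin k × Fin k, c i.1 i.2 * h i.1 i.2 z := by
      funext z
      rw [← hH z, Fintype.sum_prod_type]
    rw [this, levelMean_sum hu _ (fun i : Fin k × Fin k => c i.1 i.2) (fun i => hc i.1 i.2),
      Finset.mul_sum]
    exact Finset.sum_congr rfl fun i _ => by ring
  simp only [e]
  rw [integral_finsetSum _ fun i _ => (hi i.1 i.2).const_mul _]
  simp only [integral_const_mul]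
  rw [Fintype.sum_prod_type]

end Powers

/-- The data of the theorem away from the origin: the domain is `{0} ∪ {u < 0}` and `φ = f(u)`. -/
structure RadialData (u : Cn n → ℝ) (f : ℝ → ℝ) (Ω : Set (Cn n)) (φ : Cn n → EReal) : Prop where
  logHom : LogHom u
  profile : Profile f
  isOpen : IsOpen Ω
  mem_iff : ∀ z, z ∈ Ω ↔ z = 0 ∨ u z < 0
  apply_eq : ∀ z ∈ Ω, z ≠ 0 → φ z = ((f (u z) : ℝ) : EReal)

namespace RadialData

variable {u : Cn n → ℝ} {f : ℝ → ℝ} {Ω : Set (Cn n)} {φ : Cn n → EReal} {k : ℕ}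

theorem exists_le_neg (H : RadialData u f Ω φ) {K : Set (Cn n)} (hK : IsCompact K) (hKΩ : K ⊆ Ω) :
    ∃ ε, 0 < ε ∧ ∀ z ∈ K, z ≠ 0 → u z ≤ -ε :=
  H.logHom.exists_le_neg hK fun z hz => (H.mem_iff z).1 (hKΩ hz)

theorem toReal_mul (H : RadialData u f Ω φ) {η : Cn n → ℂ} (hη : ∀ z ∉ Ω, η z = 0) {z : Cn n}
    (hz : z ≠ 0) : ((φ z).toReal : ℂ) * η z = f (u z) * η z := by
  by_cases h : z ∈ Ω
  · rw [H.apply_eq z h hz, EReal.toReal_coe]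
  · rw [hη z h, mul_zero, mul_zero]

theorem ind_bounded (K : Set (Cn n)) : ∃ C, ∀ z, ‖K.indicator (fun _ => (1 : ℂ)) z‖ ≤ C :=
  ⟨1, fun z => by
    by_cases hz : z ∈ K
    · simp [Set.indicator_of_mem hz]
    · simp [Set.indicator_of_notMem hz]⟩

theorem locallyFinite_of_indicator {c : Coeff n}
    (h : ∀ K ⊆ Ω, IsCompact K → Integrable (fun z => K.indicator (fun _ => 1) z * c.θ z) c.ν) :
    c.LocallyFinite Ω := fun K hK hKc => by
  refine (h K hK hKc).integrableOn.congr_fun (fun z hz => ?_) hKc.measurableSet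
  simp only [Set.indicator_of_mem hz, one_mul]

theorem mulLocallyFinite_of_indicator {c : Coeff n} (h0 : ∀ᵐ z ∂c.ν, c.θ z ≠ 0 → z ≠ 0)
    (H : RadialData u f Ω φ)
    (h : ∀ K ⊆ Ω, IsCompact K →
      Integrable (fun z => ((f (u z) : ℂ) * K.indicator (fun _ => 1) z) * c.θ z) c.ν) :
    c.MulLocallyFinite Ω φ := fun K hK hKc => by
  constructor
  · rw [ae_restrict_iff' hKc.measurableSet]
    filter_upwards [h0] with z hz hzK hne
    rw [H.apply_eq z (hK hzK) (hz hne)]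
    exact ⟨EReal.coe_ne_bot _, EReal.coe_ne_top _⟩
  · refine (h K hK hKc).integrableOn.congr ?_
    have h0' := ae_restrict_of_ae (s := K) h0
    filter_upwards [h0', ae_restrict_mem hKc.measurableSet] with z hz hzK
    rw [Set.indicator_of_mem hzK, mul_one]
    by_cases hne : c.θ z = 0
    · rw [hne, mul_zero, mul_zero]
    · rw [H.apply_eq z (hK hzK) (hz hne), EReal.toReal_coe]

theorem small_f (H : RadialData u f Ω φ) {ε : ℝ} (hε : 0 < ε) {h : Cn n → ℂ} (hh : Small u 1 ε h) :
    Small u (1 / 2) ε fun z => (f (u z) : ℂ) * h z :=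
  hh.mul_comp H.logHom H.profile.meas (H.profile.exp_bound hε)

end RadialData

namespace RadialData

variable {u : Cn n → ℝ} {f : ℝ → ℝ} {Ω : Set (Cn n)} {φ : Cn n → EReal} {k : ℕ}

theorem small_ind_formD (H : RadialData u f Ω φ) {K : Set (Cn n)} (hK : IsCompact K) {ε : ℝ}
    (hε : 0 < ε) (hKε : ∀ z ∈ K, z ≠ 0 → u z ≤ -ε) (hk : k ≤ n) (I J : Fin k → Fin n) :
    Small u 1 ε fun z => K.indicator (fun _ => 1) z * formD u I J z :=
  small_mul_formD H.logHom hK (measurable_const.indicator hK.measurableSet) (ind_bounded K)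
    (fun _ hz => Set.indicator_of_notMem hz _) hε hKε hk I J

theorem small_ind_formB (H : RadialData u f Ω φ) {K : Set (Cn n)} (hK : IsCompact K) {s ε : ℝ}
    (hε : 0 < ε) (hKε : ∀ z ∈ K, z ≠ 0 → u z ≤ -ε) (hk : 2 * (k + 1) + s ≤ 2 * n)
    (I J : Fin (k + 1) → Fin n) :
    Small u s ε fun z => K.indicator (fun _ => 1) z * formB u (fun _ : Fin k => u) I J z :=
  small_mul_formB H.logHom (measurable_const.indicator hK.measurableSet) (ind_bounded K)
    (fun _ hz => Set.indicator_of_notMem hz _) hε hKε hk I J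

theorem locallyFinite (H : RadialData u f Ω φ) (hk : k ≤ n) (I J : Fin k → Fin n) :
    (powers u f k I J).LocallyFinite Ω := by
  have hu := H.logHom
  have hf := H.profile
  cases k with
  | zero =>
    intro K _ hKc
    change IntegrableOn (fun _ => (1 : ℂ)) K volume
    exact integrableOn_const (hs := hKc.measure_lt_top.ne)
  | succ k =>
    have := sigmaFinite_absPart (f := f) hu I J
    have := sigmaFinite_singPart hu hf I J
    have hk' : (k : ℝ) + 1 ≤ n := by exact_mod_cast hk
    refine Coeff.LocallyFinite.add (Coeff.LocallyFinite.add ?_ ?_) ?_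
    · refine locallyFinite_of_indicator fun K hK hKc => ?_
      obtain ⟨ε, hε, hKε⟩ := H.exists_le_neg hKc hK
      exact (absPart_pair hu hf one_pos hε (H.small_ind_formD hKc hε hKε hk I J)
        fun z _ => rfl).1
    · refine locallyFinite_of_indicator fun K hK hKc => ?_
      obtain ⟨ε, hε, hKε⟩ := H.exists_le_neg hKc hK
      exact (singPart_pair hu hf le_rfl hε
        (H.small_ind_formB hKc hε hKε (by linarith) I J) fun z _ => rfl).1
    · exact locallyFinite_of_indicator fun K _ _ => (pointPart_pair _ I J).1

theorem mulLocallyFinite [NeZero n] (H : RadialData u f Ω φ) (hk : k < n) (I J : Fin k → Fin n) :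
    (powers u f k I J).MulLocallyFinite Ω φ := by
  have hu := H.logHom
  have hf := H.profile
  cases k with
  | zero =>
    refine mulLocallyFinite_of_indicator ?_ H fun K hK hKc => ?_
    · have h := hu.ae_ne_zero volume
      rw [hu.liftMeas_volume] at h
      filter_upwards [h] with z hz _ using hz
    · obtain ⟨ε, hε, hKε⟩ := H.exists_le_neg hKc hK
      refine (volume_pair hu (by norm_num) hε
        (H.small_f hε (H.small_ind_formD hKc hε hKε hk.le I J)) fun z hz => ?_).1
      simp [formD, altSum]
  | succ k =>
    have := sigmaFinite_absPart (f := f) hu I J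
    have := sigmaFinite_singPart hu hf I J
    have hk' : (k : ℝ) + 2 ≤ n := by exact_mod_cast hk
    refine Coeff.MulLocallyFinite.add (Coeff.MulLocallyFinite.add ?_ ?_) ?_
    · refine mulLocallyFinite_of_indicator ?_ H fun K hK hKc => ?_
      · filter_upwards [hu.ae_ne_zero _] with z hz _ using hz
      · obtain ⟨ε, hε, hKε⟩ := H.exists_le_neg hKc hK
        exact (absPart_pair hu hf (by norm_num) hε
          (H.small_f hε (H.small_ind_formD hKc hε hKε hk.le I J)) fun z _ => by ring).1
    · refine mulLocallyFinite_of_indicator ?_ H fun K hK hKc => ?_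
      · filter_upwards [hu.ae_ne_zero _] with z hz _ using hz
      · obtain ⟨ε, hε, hKε⟩ := H.exists_le_neg hKc hK
        exact (singPart_pair hu hf (s := 1 / 2) (by norm_num) hε
          (H.small_f hε (H.small_ind_formB hKc hε hKε (by linarith) I J)) fun z _ => by ring).1
    · have h0 : ∀ z, (pointPart u f k I J).θ z = 0 := fun z => by
        simp [pointPart, hk.ne]
      refine mulLocallyFinite_of_indicator (ae_of_all _ fun z hz => absurd (h0 z) hz) H
        fun K _ _ => ?_
      simp [h0]

/-- The value of `(∂∂̄φ)^(k+1)` on functions that are small for both of its parts. -/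
theorem powers_succ_pair (H : RadialData u f Ω φ) {I J : Fin (k + 1) → Fin n} {s s' ε : ℝ}
    (hs : 0 < s) (hs' : 0 ≤ s') (hε : 0 < ε) {g h h' : Cn n → ℂ} (hh : Small u s ε h)
    (e : ∀ z, z ≠ 0 → g z * formD u I J z = h z) (hh' : Small u s' ε h')
    (e' : ∀ z, z ≠ 0 → g z * formB u (fun _ : Fin k => u) I J z = h' z) :
    (powers u f (k + 1) I J).pair g
      = (∫ t in Set.Iio (0 : ℝ), ((rd f t ^ (k + 1) : ℝ) : ℂ) * levelMean u h t)
        + (∫ t, levelMean u h' t ∂(dMeas fun x => rd f x ^ (k + 1)))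
        + g 0 * (limBot (fun x => rd f x ^ (k + 1)) * if k + 1 = n then
            ∫ ζ : Sph n, formB u (fun _ : Fin k => u) I J ζ ∂(sphMeas n) else 0) := by
  have hu := H.logHom
  have hf := H.profile
  have := sigmaFinite_absPart (f := f) hu I J
  have := sigmaFinite_singPart hu hf I J
  have h1 := absPart_pair hu hf hs hε hh e
  have h2 := singPart_pair hu hf hs' hε hh' e'
  have h3 := pointPart_pair (u := u) (f := f) g I J
  have h12 := Coeff.integrableOn_add MeasurableSet.univ h1.1.integrableOn h2.1.integrableOn
  rw [powers, Coeff.pair_add (by simpa using h12.1) h3.1, Coeff.pair_add h1.1 h2.1, h1.2, h2.2,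
    h3.2]

/-- The distributional identity `(∂∂̄φ)^(k+1) = ∂∂̄(φ (∂∂̄φ)^k)`: both sides are reduced to the mean of
`∂χ ∧ ∂̄u ∧ (∂∂̄u)^k` over the level sets of `u`, integrated against `(f')^(k+1) dt`. -/
theorem isDDbarMul [NeZero n] (H : RadialData u f Ω φ) (hk : k < n) :
    IsDDbarMul Ω φ (powers u f k) (powers u f (k + 1)) := by
  intro I J χ hχ
  have hu := H.logHom
  have hf := H.profile
  have hχm : Measurable χ := hχ.1.continuous.measurable
  have hχ0 : ∀ z ∉ tsupport χ, χ z = 0 := fun z hz => image_eq_zero_of_notMem_tsupport hz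
  obtain ⟨ε, hε, hχε⟩ := H.exists_le_neg hχ.2.1 hχ.2.2
  have hk' : (k : ℝ) + 1 ≤ n := by exact_mod_cast hk
  have hT := H.powers_succ_pair one_pos le_rfl hε
    (small_mul_formD hu hχ.2.1 hχm hχ.bounded hχ0 hε hχε (Nat.succ_le_of_lt hk) I J)
    (fun z _ => rfl) (small_mul_formB (s := 0) hu hχm hχ.bounded hχ0 hε hχε (by linarith) I J)
    (fun z _ => rfl)
  have hB := parts_formB hu hf hχ hε hχε hk I J
  have hC := parts_formC hu hf hχ hε hχε hk I J
  have e1 : (powers u f (k + 1) I J).pair χ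
      = -∫ t in Set.Iio (0 : ℝ), ((rd f t ^ (k + 1) : ℝ) : ℂ) * levelMean u (formC u χ I J) t := by
    rw [hT, hB]
    split_ifs <;> ring
  rw [e1, ← hC]
  -- the second derivatives of the test function, and their products with the powers of `∂∂̄u`
  have hη : ∀ a b : Fin (k + 1), IsTestFunction Ω (dz (I a) (dzbar (J b) χ)) := fun a b => by
    have e : dz (I a) (dzbar (J b) χ) = wirt (-Complex.I) (I a) (wirt Complex.I (J b) χ) := by
      funext z
      rw [dz_eq_wirt]
      congr 1
    rw [e]
    exact (hχ.wirt _ _).wirt _ _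
  have hηm := fun a b => (hη a b).1.continuous.measurable
  have hη0 : ∀ a b, ∀ z ∉ tsupport χ, dz (I a) (dzbar (J b) χ) z = 0 := fun a b z hz => by
    have h' : χ =ᶠ[𝓝 z] fun _ => 0 := notMem_tsupport_iff_eventuallyEq.1 hz
    have h2 : wirt Complex.I (J b) χ =ᶠ[𝓝 z] fun _ => 0 := by
      filter_upwards [h'.eventuallyEq_nhds] with w hw
      rw [wirt_congr hw, wirt_const]
    have e : dzbar (J b) χ = wirt Complex.I (J b) χ := by
      funext w
      rw [dzbar_eq_wirt]
    rw [dz_eq_wirt, e, wirt_congr h2, wirt_const]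
  have hηΩ : ∀ a b, ∀ z ∉ Ω, dz (I a) (dzbar (J b) χ) z = 0 := fun a b z hz =>
    hη0 a b z fun h => hz (hχ.2.2 h)
  have sD : ∀ a b, Small u 1 ε fun z => dz (I a) (dzbar (J b) χ) z *
      formD u (I ∘ a.succAbove) (J ∘ b.succAbove) z := fun a b =>
    small_mul_formD hu hχ.2.1 (hηm a b) (hη a b).bounded (hη0 a b) hε hχε hk.le _ _
  have cD : ∀ a b, ContinuousOn (fun z => dz (I a) (dzbar (J b) χ) z *
      formD u (I ∘ a.succAbove) (J ∘ b.succAbove) z) {0}ᶜ := fun a b =>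
    ((hη a b).ordBound.mul (hu.ordBound_formD _ _)).1
  have hFm : Measurable fun x => rd f x ^ k := (Profile.measurable_rd f).pow_const k
  have iD : ∀ a b, IntegrableOn (fun t => (((rd f t ^ k : ℝ) : ℂ) * (f t : ℂ)) *
      levelMean u (fun z => dz (I a) (dzbar (J b) χ) z *
        formD u (I ∘ a.succAbove) (J ∘ b.succAbove) z) t) (Set.Iio 0) := by
    intro a b
    obtain ⟨C, hC, hb⟩ := hf.exp_bound hε
    obtain ⟨D, hD, hb'⟩ := (hf.rcMono.pow k).exp_bound hε 1
    refine ((sD a b).integrableOn_mul (F := fun t => rd f t ^ k * f t) hu (s' := 1 / 2)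
      (by norm_num) (hu.continuous_levelMean (cD a b))
      (hFm.mul hf.meas) ?_).congr_fun (fun t _ => by push_cast; ring) measurableSet_Iio
    refine ⟨D * C, by positivity, fun t ht => ?_⟩
    have h1 : |rd f t ^ k| ≤ D := le_of_mul_le_mul_right (hb' t ht) (Real.exp_pos _)
    rw [abs_mul, mul_assoc, mul_assoc]
    exact mul_le_mul h1 (hb t ht) (by positivity) hD
  have eD := sum_integral_levelMean hu (fun a b : Fin (k + 1) => (-1 : ℂ) ^ ((a : ℕ) + (b : ℕ)))
    cD iD (H := formA u χ I J) fun z => sum_formD u χ I J z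
  have absEq : (∫ t in Set.Iio (0 : ℝ), ((rd f t ^ k : ℝ) : ℂ) *
      (f t * levelMean u (formA u χ I J) t))
      = ∑ a : Fin (k + 1), ∑ b : Fin (k + 1), (-1 : ℂ) ^ ((a : ℕ) + (b : ℕ)) *
        ∫ t in Set.Iio (0 : ℝ), ((rd f t ^ k : ℝ) : ℂ) *
          levelMean u (fun z => (f (u z) : ℂ) * (dz (I a) (dzbar (J b) χ) z *
            formD u (I ∘ a.succAbove) (J ∘ b.succAbove) z)) t := by
    simp only [levelMean_mul_comp hu f]
    simp only [mul_assoc] at eD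
    exact eD.symm
  cases k with
  | zero =>
    have hone : RCMono fun _ => (1 : ℝ) :=
      ⟨monotoneOn_const, fun _ _ => zero_le_one, fun _ _ => continuousWithinAt_const⟩
    simp only [pow_zero, RCMono.dMeas_const 1 zero_le_one, integral_zero_measure, add_zero]
    simp only [pow_zero] at absEq
    rw [absEq]
    refine Finset.sum_congr rfl fun a _ => Finset.sum_congr rfl fun b _ => ?_
    congr 1
    rw [powers, (volume_pair hu (by norm_num) hε (H.small_f hε (sD a b)) fun z hz => ?_).2]
    · simp
    · rw [H.toReal_mul (hηΩ a b) hz]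
      simp [formD, altSum]
  | succ k =>
    have hk2 : (k : ℝ) + 2 ≤ n := by exact_mod_cast hk
    have sB : ∀ a b, Small u 1 ε fun z => dz (I a) (dzbar (J b) χ) z *
        formB u (fun _ : Fin k => u) (I ∘ a.succAbove) (J ∘ b.succAbove) z := fun a b =>
      small_mul_formB hu (hηm a b) (hη a b).bounded (hη0 a b) hε hχε (by linarith) _ _
    have cB : ∀ a b, ContinuousOn (fun z => dz (I a) (dzbar (J b) χ) z *
        formB u (fun _ : Fin k => u) (I ∘ a.succAbove) (J ∘ b.succAbove) z) {0}ᶜ := fun a b =>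
      ((hη a b).ordBound.mul (hu.ordBound_formB _ _)).1
    have iB : ∀ a b, Integrable (fun t => (f t : ℂ) *
        levelMean u (fun z => dz (I a) (dzbar (J b) χ) z *
          formB u (fun _ : Fin k => u) (I ∘ a.succAbove) (J ∘ b.succAbove) z) t)
        (dMeas fun x => rd f x ^ (k + 1)) := by
      intro a b
      have hF := hf.rcMono.pow (k + 1)
      have sf := H.small_f hε (sB a b)
      obtain ⟨C, hC, hb⟩ := sf.norm_levelMean_le hu
      have hm : Measurable fun t => (f t : ℂ) *
        levelMean u (fun z => dz (I a) (dzbar (J b) χ) z *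
          formB u (fun _ : Fin k => u) (I ∘ a.succAbove) (J ∘ b.succAbove) z) t :=
        (Complex.measurable_ofReal.comp hf.meas).mul (hu.continuous_levelMean (cB a b)).measurable
      refine Integrable.mono' (g := (Set.Iic (-ε)).indicator fun _ => C) ?_
        hm.aestronglyMeasurable (ae_of_all _ fun t => ?_)
      · rw [integrable_indicator_iff measurableSet_Iic]
        refine integrableOn_const (hs := ?_)
        rw [hF.dMeas_Iic (neg_lt_zero.2 hε)]
        exact ENNReal.ofReal_ne_top
      · rw [← levelMean_mul_comp hu]
        by_cases ht : t ≤ -ε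
        · rw [Set.indicator_of_mem (Set.mem_Iic.2 ht)]
          refine (hb t).trans (mul_le_of_le_one_right hC (Real.exp_le_one_iff.2 ?_))
          linarith
        · rw [sf.levelMean_eq_zero hu (not_le.1 ht),
            Set.indicator_of_notMem (by simpa using ht), norm_zero]
    have eB := sum_integral_levelMean hu
      (fun a b : Fin (k + 2) => (-1 : ℂ) ^ ((a : ℕ) + (b : ℕ))) cB iB (H := formE u χ I J)
      fun z => sum_formB u χ I J z
    have singEq : ∫ t, (f t : ℂ) * levelMean u (formC u χ I J) t ∂(dMeas fun x => rd f x ^ (k + 1))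
        = ∑ a : Fin (k + 2), ∑ b : Fin (k + 2), (-1 : ℂ) ^ ((a : ℕ) + (b : ℕ)) *
          ∫ t, levelMean u (fun z => (f (u z) : ℂ) * (dz (I a) (dzbar (J b) χ) z *
            formB u (fun _ : Fin k => u) (I ∘ a.succAbove) (J ∘ b.succAbove) z)) t
              ∂(dMeas fun x => rd f x ^ (k + 1)) := by
      simp only [hu.levelMean_formC_eq hχ.1, levelMean_mul_comp hu f]
      exact eB.symm
    rw [absEq, singEq, ← Finset.sum_add_distrib]
    refine Finset.sum_congr rfl fun a _ => ?_
    rw [← Finset.sum_add_distrib]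
    refine Finset.sum_congr rfl fun b _ => ?_
    rw [H.powers_succ_pair (s := 1 / 2) (s' := 1 / 2) (by norm_num) (by norm_num) hε
      (H.small_f hε (sD a b))
      (fun z hz => by rw [H.toReal_mul (hηΩ a b) hz]; ring) (H.small_f hε (sB a b))
      (fun z hz => by rw [H.toReal_mul (hηΩ a b) hz]; ring), if_neg hk.ne]
    ring

theorem isDDbarPowers [NeZero n] (H : RadialData u f Ω φ) : IsDDbarPowers Ω φ (powers u f) where
  zero _ _ := rfl
  locallyFinite _ hk I J := H.locallyFinite hk I J
  mulLocallyFinite _ hk I J := H.mulLocallyFinite hk I J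
  succ _ hk := H.isDDbarMul hk

end RadialData

/-! ### The Monge-Ampère measure and its energy -/

section MongeAmpere

variable {m : ℕ} {u : Cn (m + 1) → ℝ} {f : ℝ → ℝ} {Ω : Set (Cn (m + 1))} {φ : Cn (m + 1) → EReal}

/-- The density of `(dd^c φ)^n`, `φ = f(u)`, with respect to the lift of `d((f')^n)`. -/
def maDensity (u : Cn (m + 1) → ℝ) (z : Cn (m + 1)) : ℝ :=
  (Real.pi ^ (m + 1))⁻¹ * (formB u (fun _ : Fin m => u) id id z).re

/-- The Monge-Ampère measure of `φ = f(u)`: there is no density part in top degree, and the point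
mass at the origin is `2^{-n}` times the limit of `(f')^n` at `-∞`. -/
def maMeasure (u : Cn (m + 1) → ℝ) (f : ℝ → ℝ) : Measure (Cn (m + 1)) :=
  (liftMeas u (dMeas fun x => rd f x ^ (m + 1))).withDensity
      (fun z => ENNReal.ofReal (maDensity u z))
    + ENNReal.ofReal ((2 ^ (m + 1))⁻¹ * limBot fun x => rd f x ^ (m + 1)) • Measure.dirac 0

theorem continuousOn_maDensity (hu : LogHom u) : ContinuousOn (maDensity u) {0}ᶜ :=
  continuousOn_const.mul (Complex.continuous_re.comp_continuousOn (hu.ordBound_formB id id).1)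

theorem measurable_maDensity (hu : LogHom u) : Measurable (maDensity u) :=
  measurable_of_continuousOn_compl_singleton 0 (continuousOn_maDensity hu)

theorem measurable_ofReal_maDensity (hu : LogHom u) :
    Measurable fun z => ENNReal.ofReal (maDensity u z) :=
  ENNReal.measurable_ofReal.comp (measurable_maDensity hu)

theorem integrable_mul_maDensity {M : Measure (Cn (m + 1))} {g : Cn (m + 1) → ℂ}
    (hB : ∀ᵐ z ∂M, ∃ r : ℝ, 0 ≤ r ∧ formB u (fun _ : Fin m => u) id id z = r) :
    (fun z => (ENNReal.ofReal (maDensity u z)).toReal • g z)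
      =ᵐ[M] fun z => ((Real.pi : ℂ) ^ (m + 1))⁻¹ * (g z * formB u (fun _ : Fin m => u) id id z) := by
  filter_upwards [hB] with z hz
  obtain ⟨r, hr, he⟩ := hz
  have hp : 0 ≤ (Real.pi ^ (m + 1))⁻¹ * r := by positivity
  rw [maDensity, he, Complex.ofReal_re, ENNReal.toReal_ofReal hp, Complex.real_smul]
  push_cast
  ring

namespace RadialData

theorem maMeasure_compl (H : RadialData u f Ω φ) : maMeasure u f Ωᶜ = 0 := by
  have hF := H.profile.rcMono.pow (m + 1)
  rw [maMeasure, Measure.add_apply, Measure.smul_apply,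
    Measure.dirac_apply' _ H.isOpen.measurableSet.compl,
    Set.indicator_of_notMem (not_not.2 ((H.mem_iff 0).2 (Or.inl rfl))), smul_zero, add_zero]
  refine withDensity_absolutelyContinuous _ _ ?_
  refine measure_mono_null (fun z hz => ?_) (H.logHom.liftMeas_preimage measurableSet_Ici
    hF.dMeas_Ici)
  by_contra h
  exact hz ((H.mem_iff z).2 (Or.inr (by simpa using h)))

theorem ae_nonneg (H : RadialData u f Ω φ)
    (hB : ∀ z, z ≠ 0 → ∃ r : ℝ, 0 ≤ r ∧ formB u (fun _ : Fin m => u) id id z = r) (M : Measure ℝ) :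
    ∀ᵐ z ∂(liftMeas u M), ∃ r : ℝ, 0 ≤ r ∧ formB u (fun _ : Fin m => u) id id z = r := by
  filter_upwards [H.logHom.ae_ne_zero M] with z hz using hB z hz

theorem maMeasure_compact (H : RadialData u f Ω φ) {K : Set (Cn (m + 1))} (hK : K ⊆ Ω)
    (hKc : IsCompact K) : maMeasure u f K < ⊤ := by
  have hu := H.logHom
  obtain ⟨ε, hε, hKε⟩ := H.exists_le_neg hKc hK
  have h1 := (singPart_pair hu H.profile le_rfl hε
    (H.small_ind_formB hKc hε hKε (s := 0) (by push_cast; linarith) id id) fun z _ => rfl).1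
  rw [maMeasure, Measure.add_apply, Measure.smul_apply, smul_eq_mul]
  refine ENNReal.add_lt_top.2 ⟨?_, ENNReal.mul_lt_top ENNReal.ofReal_lt_top (measure_lt_top _ _)⟩
  rw [withDensity_apply _ hKc.measurableSet, ← lintegral_indicator hKc.measurableSet]
  have h2 := (h1.const_mul (((Real.pi ^ (m + 1))⁻¹ : ℝ) : ℂ)).2
  refine lt_of_le_of_lt (lintegral_mono fun z => ?_) h2
  by_cases hz : z ∈ K
  · simp only [Set.indicator_of_mem hz, one_mul, ← ofReal_norm]
    refine ENNReal.ofReal_le_ofReal ?_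
    rw [norm_mul, Complex.norm_real, maDensity, Real.norm_of_nonneg (by positivity)]
    exact mul_le_mul_of_nonneg_left (Complex.re_le_norm _) (by positivity)
  · rw [Set.indicator_of_notMem hz]
    exact zero_le

theorem integral_maMeasure (H : RadialData u f Ω φ)
    (hB : ∀ z, z ≠ 0 → ∃ r : ℝ, 0 ≤ r ∧ formB u (fun _ : Fin m => u) id id z = r)
    {χ : Cn (m + 1) → ℂ} (hχ : IsTestFunction Ω χ) :
    ∫ z, χ z ∂(maMeasure u f)
      = ((Real.pi : ℂ) ^ (m + 1))⁻¹ * (powers u f (m + 1) id id).pair χ := by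
  have hu := H.logHom
  have hf := H.profile
  have hχm : Measurable χ := hχ.1.continuous.measurable
  have hχ0 : ∀ z ∉ tsupport χ, χ z = 0 := fun z hz => image_eq_zero_of_notMem_tsupport hz
  obtain ⟨ε, hε, hχε⟩ := H.exists_le_neg hχ.2.1 hχ.2.2
  have sB : Small u 0 ε fun z => χ z * formB u (fun _ : Fin m => u) id id z :=
    small_mul_formB hu hχm hχ.bounded hχ0 hε hχε (by push_cast; linarith) id id
  have hT := H.powers_succ_pair (g := χ) one_pos le_rfl hε (Small.zero u 1 ε)
    (fun z hz => by rw [hu.formD_eq_zero id id hz, mul_zero]) sB (fun z _ => rfl)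
  obtain ⟨hi, hp⟩ := singPart_pair hu hf le_rfl hε sB (fun z _ => rfl)
  have ae := integrable_mul_maDensity (g := χ)
    (H.ae_nonneg hB (dMeas fun x => rd f x ^ (m + 1)))
  have hi1 : Integrable χ ((liftMeas u (dMeas fun x => rd f x ^ (m + 1))).withDensity
      fun z => ENNReal.ofReal (maDensity u z)) := by
    rw [integrable_withDensity_iff_integrable_smul' (measurable_ofReal_maDensity hu) (by simp)]
    exact (hi.const_mul _).congr ae.symm
  have hL : 0 ≤ (2 ^ (m + 1))⁻¹ * limBot fun x => rd f x ^ (m + 1) :=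
    mul_nonneg (by positivity) (hf.rcMono.pow _).limBot_nonneg
  have hi2 : Integrable χ (ENNReal.ofReal ((2 ^ (m + 1))⁻¹ * limBot fun x => rd f x ^ (m + 1)) •
      Measure.dirac 0) :=
    (integrable_dirac (by simp)).smul_measure ENNReal.ofReal_ne_top
  rw [maMeasure, integral_add_measure hi1 hi2, integral_smul_measure, integral_dirac,
    integral_withDensity_eq_integral_toReal_smul (measurable_ofReal_maDensity hu) (by simp),
    integral_congr_ae ae, integral_const_mul, ENNReal.toReal_ofReal hL, hT, if_pos rfl,
    integral_formB m hu]
  have e0 : levelMean u (fun _ : Cn (m + 1) => (0 : ℂ)) = fun _ => 0 := by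
    funext t
    simp [levelMean]
  have e1 : ∫ z, χ z * formB u (fun _ : Fin m => u) id id z
      ∂(liftMeas u (dMeas fun x => rd f x ^ (m + 1)))
      = ∫ t, levelMean u (fun z => χ z * formB u (fun _ : Fin m => u) id id z) t
        ∂(dMeas fun x => rd f x ^ (m + 1)) := hp
  rw [e0, e1, Complex.real_smul]
  have hpi : (Real.pi : ℂ) ≠ 0 := by exact_mod_cast Real.pi_ne_zero
  simp only [mul_zero, integral_zero, zero_add]
  push_cast
  rw [div_pow]
  field_simp

theorem isMongeAmpereMeasure (H : RadialData u f Ω φ)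
    (hB : ∀ z, z ≠ 0 → ∃ r : ℝ, 0 ≤ r ∧ formB u (fun _ : Fin m => u) id id z = r) :
    IsMongeAmpereMeasure Ω φ (maMeasure u f) :=
  ⟨H.maMeasure_compl, fun _ hK hKc => H.maMeasure_compact hK hKc, powers u f, H.isDDbarPowers,
    fun _ hχ => H.integral_maMeasure hB hχ⟩

/-- The powers of `∂∂̄φ` are unique as distributions. -/
theorem pair_eq (H : RadialData u f Ω φ) {T : (k : ℕ) → Current (m + 1) k}
    (hT : IsDDbarPowers Ω φ T) {k : ℕ} (hk : k ≤ m + 1) :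
    ∀ (I J : Fin k → Fin (m + 1)) (χ : Cn (m + 1) → ℂ), IsTestFunction Ω χ →
      (T k I J).pair χ = (powers u f k I J).pair χ := by
  have hT' := H.isDDbarPowers
  induction k with
  | zero =>
    intro I J χ _
    rw [hT.zero, hT'.zero]
  | succ k ih =>
    intro I J χ hχ
    rw [hT.succ k hk I J χ hχ, hT'.succ k hk I J χ hχ]
    refine Finset.sum_congr rfl fun a _ => Finset.sum_congr rfl fun b _ => ?_
    congr 1
    have e : dz (I a) (dzbar (J b) χ) = wirt (-Complex.I) (I a) (wirt Complex.I (J b) χ) := by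
      funext z
      rw [dz_eq_wirt]
      congr 1
    have hη : IsTestFunction Ω (dz (I a) (dzbar (J b) χ)) := by
      rw [e]
      exact (hχ.wirt _ _).wirt _ _
    set η := dz (I a) (dzbar (J b) χ) with hηdef
    have hη0 : ∀ z ∉ tsupport η, η z = 0 := fun z hz => image_eq_zero_of_notMem_tsupport hz
    obtain ⟨C, hC⟩ := hη.bounded
    -- the product is integrable, since `φ T` has locally finite mass and `η` is bounded
    have int : ∀ c : Coeff (m + 1), c.MulLocallyFinite Ω φ →
        Integrable (fun z => ((φ z).toReal : ℂ) * η z * c.θ z) c.ν := by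
      intro c hc
      refine integrableOn_univ_of_support hη.2.1.measurableSet (K := tsupport η)
        (fun z hz => by rw [hη0 z hz, mul_zero]) ?_
      have h1 := (hc _ hη.2.2 hη.2.1).2
      have h2 := h1.bdd_mul (c := C) (f := η) hη.1.continuous.aestronglyMeasurable
        (Eventually.of_forall hC)
      refine h2.congr (ae_of_all _ fun z => ?_)
      simp only
      ring
    exact Coeff.pair_eq_of_test H.isOpen (hT.locallyFinite k (by omega) _ _)
      (hT'.locallyFinite k (by omega) _ _) (fun χ hχ => ih (by omega) _ _ χ hχ) hη.2.1 hη.2.2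
      (fun z hz => by rw [hη0 z hz, mul_zero]) (int _ (hT.mulLocallyFinite k hk _ _))
      (int _ (hT'.mulLocallyFinite k hk _ _))

theorem eq_maMeasure (H : RadialData u f Ω φ)
    (hB : ∀ z, z ≠ 0 → ∃ r : ℝ, 0 ≤ r ∧ formB u (fun _ : Fin m => u) id id z = r)
    {μ : Measure (Cn (m + 1))} (hμ : IsMongeAmpereMeasure Ω φ μ) : μ = maMeasure u f := by
  obtain ⟨h0, hK, T, hT, hχ⟩ := hμ
  refine measure_ext_of_test H.isOpen h0 H.maMeasure_compl hK
    (fun _ hK hKc => H.maMeasure_compact hK hKc) fun χ hχ' => ?_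
  rw [hχ χ hχ', H.integral_maMeasure hB hχ', H.pair_eq hT le_rfl _ _ χ hχ']

theorem mongeAmpere_eq (H : RadialData u f Ω φ)
    (hB : ∀ z, z ≠ 0 → ∃ r : ℝ, 0 ≤ r ∧ formB u (fun _ : Fin m => u) id id z = r) :
    mongeAmpere Ω φ = maMeasure u f := by
  have h : ∃ μ, IsMongeAmpereMeasure Ω φ μ := ⟨_, H.isMongeAmpereMeasure hB⟩
  rw [mongeAmpere, dif_pos h]
  exact H.eq_maMeasure hB h.choose_spec

theorem existsUnique_mongeAmpere (H : RadialData u f Ω φ)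
    (hB : ∀ z, z ≠ 0 → ∃ r : ℝ, 0 ≤ r ∧ formB u (fun _ : Fin m => u) id id z = r) :
    ∃! μ, IsMongeAmpereMeasure Ω φ μ :=
  ⟨_, H.isMongeAmpereMeasure hB, fun _ hμ => H.eq_maMeasure hB hμ⟩

theorem homDeg_maDensity (hu : LogHom u) {r : ℝ} (hr : 0 < r) {z : Cn (m + 1)} (hz : z ≠ 0) :
    r ^ (2 * (m + 1)) * maDensity u (r • z) = maDensity u z := by
  have h := homDeg_formB hu (fun _ : Fin m => hu) id id r hr z hz
  rw [maDensity, maDensity, ← h, ← Complex.ofReal_pow, Complex.re_mul_ofReal]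
  ring

/-- The total mass of the Monge-Ampère density on each level set. -/
theorem lintegral_maDensity (hu : LogHom u)
    (hB : ∀ z, z ≠ 0 → ∃ r : ℝ, 0 ≤ r ∧ formB u (fun _ : Fin m => u) id id z = r) :
    ∫⁻ ζ : Sph (m + 1), ENNReal.ofReal (maDensity u ζ) ∂(sphMeas (m + 1))
      = ENNReal.ofReal ((2 ^ (m + 1))⁻¹) := by
  have hc : Continuous fun ζ : Sph (m + 1) => formB u (fun _ : Fin m => u) id id ζ :=
    (hu.ordBound_formB id id).1.comp_continuous continuous_subtype_val fun ζ => sph_ne_zero ζ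
  have hi : Integrable (fun ζ : Sph (m + 1) => formB u (fun _ : Fin m => u) id id ζ)
      (sphMeas (m + 1)) := hc.integrable_of_hasCompactSupport (HasCompactSupport.of_compactSpace _)
  have hi' : Integrable (fun ζ : Sph (m + 1) => maDensity u ζ) (sphMeas (m + 1)) :=
    hi.re.const_mul _
  rw [← ofReal_integral_eq_lintegral_ofReal hi']
  · congr 1
    simp only [maDensity]
    rw [integral_const_mul]
    have h1 : ∫ ζ : Sph (m + 1), (formB u (fun _ : Fin m => u) id id (ζ : Cn (m + 1))).re
        ∂(sphMeas (m + 1)) = (Real.pi / 2) ^ (m + 1) := by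
      have := integral_re hi
      simp only [RCLike.re_to_complex] at this
      rw [this, integral_formB m hu, Complex.ofReal_re]
    rw [h1, div_pow]
    have := Real.pi_pos
    field_simp
  · refine ae_of_all _ fun ζ => ?_
    obtain ⟨r, hr, he⟩ := hB ζ (sph_ne_zero ζ)
    simp only [Pi.zero_apply, maDensity, he, Complex.ofReal_re]
    positivity

/-- The energy identity. The value of `φ` at the origin only matters if the measure charges the
origin, and then `f` is unbounded below. -/
theorem lintegral_mongeAmpere (H : RadialData u f Ω φ)
    (hB : ∀ z, z ≠ 0 → ∃ r : ℝ, 0 ≤ r ∧ formB u (fun _ : Fin m => u) id id z = r)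
    (h0 : φ 0 ≤ extendBot f ⊥) :
    ∫⁻ z in Ω, (-φ z).toENNReal ∂(mongeAmpere Ω φ)
      = (2 ^ (m + 1))⁻¹ * ∫⁻ t in Set.Iio (0 : ℝ), ENNReal.ofReal (deriv f t) ^ (m + 1 + 1) := by
  have hu := H.logHom
  have hf := H.profile
  set F := fun x => rd f x ^ (m + 1) with hFdef
  have hF : RCMono F := hf.rcMono.pow (m + 1)
  have hres : (maMeasure u f).restrict Ω = maMeasure u f := by
    rw [Measure.restrict_eq_self_of_ae_mem]
    exact H.maMeasure_compl
  have hm1 : Measurable fun z => ENNReal.ofReal (-f (u z)) :=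
    ENNReal.measurable_ofReal.comp (hf.meas.comp hu.measurable).neg
  have hm2 : Measurable fun t => ENNReal.ofReal (-f t) :=
    ENNReal.measurable_ofReal.comp hf.meas.neg
  -- the part carried by the level sets
  have e1 : ∫⁻ z, (-φ z).toENNReal ∂((liftMeas u (dMeas F)).withDensity
      fun z => ENNReal.ofReal (maDensity u z))
      = ENNReal.ofReal ((2 ^ (m + 1))⁻¹) * ∫⁻ t, ENNReal.ofReal (-f t) ∂(dMeas F) := by
    have a1 : ∀ᵐ z ∂(liftMeas u (dMeas F)), (-φ z).toENNReal = ENNReal.ofReal (-f (u z)) := by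
      have a2 : ∀ᵐ z ∂(liftMeas u (dMeas F)), ¬ (0 ≤ u z) := by
        rw [ae_iff]
        simp only [not_not]
        exact hu.liftMeas_preimage measurableSet_Ici hF.dMeas_Ici
      filter_upwards [hu.ae_ne_zero _, a2] with z hz hz'
      rw [H.apply_eq z ((H.mem_iff z).2 (Or.inr (not_le.1 hz'))) hz, ← EReal.coe_neg,
        EReal.real_coe_toENNReal]
    rw [lintegral_congr_ae ((withDensity_absolutelyContinuous _ _).ae_le a1),
      lintegral_withDensity_eq_lintegral_mul _ (measurable_ofReal_maDensity hu) hm1,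
      hu.lintegral_liftMeas _ ((measurable_ofReal_maDensity hu).mul hm1),
      ← lintegral_const_mul _ hm2]
    refine lintegral_congr fun t => ?_
    rw [← lintegral_maDensity hu hB, ← lintegral_mul_const']
    · refine lintegral_congr fun ζ => ?_
      rw [Pi.mul_apply, hu.apply_polarPt, ← mul_assoc]
      congr 1
      rw [← ENNReal.ofReal_mul (Real.exp_pos _).le,
        ← homDeg_maDensity hu (Real.exp_pos (t - u ζ)) (sph_ne_zero ζ), ← Real.exp_nat_mul, polarPt]
      push_cast
      rfl
    · exact ENNReal.ofReal_ne_top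
  have e2 : ENNReal.ofReal (limBot F) * (-φ 0).toENNReal
      = ENNReal.ofReal (limBot F) * ∫⁻ y in Set.Iio (0 : ℝ), ENNReal.ofReal (rd f y) := by
    rcases hF.limBot_nonneg.eq_or_lt with h | h
    · rw [← h, ENNReal.ofReal_zero, zero_mul, zero_mul]
    · rw [hf.extendBot_eq_bot (Nat.succ_ne_zero m) h, le_bot_iff] at h0
      rw [h0, EReal.neg_bot, EReal.toENNReal_top, hf.lintegral_rd_eq_top (Nat.succ_ne_zero m) h]
  rw [H.mongeAmpere_eq hB, hres, maMeasure, lintegral_add_measure, lintegral_smul_measure,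
    lintegral_dirac, e1, ENNReal.ofReal_mul (by positivity), smul_eq_mul, mul_assoc, e2, ← mul_add,
    hf.lintegral_neg hF]
  congr 1
  · rw [ENNReal.ofReal_inv_of_pos (by positivity), ENNReal.ofReal_pow (by norm_num)]
    simp
  · refine lintegral_congr_ae ?_
    filter_upwards [hf.ae_deriv_eq, ae_restrict_mem measurableSet_Iio] with t ht ht0
    rw [ht, hFdef, ENNReal.ofReal_pow (hf.rd_nonneg ht0), pow_succ' _ (m + 1)]

end RadialData

end MongeAmpere

/-! ### Defining functions of balanced domains -/

/-- `Ω` is given in the open set `U` as `{ρ < 0}`, with `ρ` smooth. Where `ρ = 0` and `dρ ≠ 0`, this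
makes `ρ` a local defining function of `Ω`. -/
structure DefinedBy (Ω U : Set (Cn n)) (ρ : Cn n → ℝ) : Prop where
  isOpen : IsOpen U
  smooth : ContDiffOn ℝ ∞ ρ U
  inter_eq : Ω ∩ U = {z | z ∈ U ∧ ρ z < 0}

/-- The implicit function theorem for one real unknown. -/
theorem exists_implicitFunction {E : Type*} [NormedAddCommGroup E] [NormedSpace ℝ E]
    [CompleteSpace E] {F : E × ℝ → ℝ} {a : E} (hF : ContDiffAt ℝ ∞ F (a, 0)) (h0 : F (a, 0) = 0)
    (hx : fderiv ℝ F (a, 0) (0, 1) ≠ 0) :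
    ∃ h : E → ℝ, ContDiffAt ℝ ∞ h a ∧ h a = 0 ∧ ∀ᶠ z in 𝓝 a, F (z, h z) = 0 := by
  have hi : (fderiv ℝ F (a, 0) ∘L .inr ℝ E ℝ).IsInvertible := by
    refine ⟨ContinuousLinearEquiv.unitsEquivAut ℝ (Units.mk0 _ hx), ?_⟩
    ext
    simp
  refine ⟨hF.implicitFunction (by simp) hi, hF.contDiffAt_implicitFunction (by simp) hi,
    hF.implicitFunction_apply_self (by simp) hi, ?_⟩
  filter_upwards [hF.eventually_apply_implicitFunction (by simp) hi] with z hz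
  rw [hz, h0]

theorem hasDerivAt_exp_smul (z : Cn n) (s : ℝ) :
    HasDerivAt (fun s : ℝ => Real.exp s • z) (Real.exp s • z) s :=
  (Real.hasDerivAt_exp s).smul_const z

theorem hasDerivAt_rotation (z : Cn n) (θ : ℝ) :
    HasDerivAt (fun θ : ℝ => Complex.exp (θ * Complex.I) • z)
      (Complex.I • Complex.exp (θ * Complex.I) • z) θ := by
  have h := ((((hasDerivAt_id θ).ofReal_comp).mul_const Complex.I).cexp).smul_const z
  convert! h using 1
  simp [smul_smul, mul_comm]

section Balanced

variable {Ω U : Set (Cn n)} {ρ : Cn n → ℝ} {q : Cn n}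

theorem zero_mem_of_balanced (hbal : Balanced ℂ Ω) (hne : Ω.Nonempty) : (0 : Cn n) ∈ Ω :=
  hbal.zero_mem hne

theorem smul_mem_of_balanced (hbal : Balanced ℂ Ω) {a : ℂ} (ha : ‖a‖ ≤ 1) (hq : q ∈ Ω) :
    a • q ∈ Ω := hbal a ha ⟨q, hq, rfl⟩

theorem exp_smul_mem (hbal : Balanced ℂ Ω) {s : ℝ} (hs : s ≤ 0) (hq : q ∈ Ω) :
    Real.exp s • q ∈ Ω := by
  have := smul_mem_of_balanced hbal (a := (Real.exp s : ℂ))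
    (by rw [Complex.norm_real, Real.norm_of_nonneg (Real.exp_pos s).le]; exact Real.exp_le_one_iff.2 hs) hq
  rwa [Complex.coe_smul] at this

theorem exp_smul_mem_closure (hbal : Balanced ℂ Ω) {s : ℝ} (hs : s ≤ 0) (hq : q ∈ closure Ω) :
    Real.exp s • q ∈ closure Ω :=
  map_mem_closure (continuous_const_smul _) hq fun _ h => exp_smul_mem hbal hs h

theorem mem_frontier_iff (hΩ : IsOpen Ω) : q ∈ frontier Ω ↔ q ∈ closure Ω ∧ q ∉ Ω := by
  rw [hΩ.frontier_eq]; rfl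

theorem rotation_mem_frontier (hΩ : IsOpen Ω) (hbal : Balanced ℂ Ω) (hq : q ∈ frontier Ω) (θ : ℝ) :
    Complex.exp (θ * Complex.I) • q ∈ frontier Ω := by
  rw [mem_frontier_iff hΩ] at hq ⊢
  refine ⟨map_mem_closure (continuous_const_smul _) hq.1 fun _ h =>
    smul_mem_of_balanced hbal (Complex.norm_exp_ofReal_mul_I θ).le h, fun h => hq.2 ?_⟩
  have := smul_mem_of_balanced hbal (a := Complex.exp ((-θ : ℝ) * Complex.I))
    (Complex.norm_exp_ofReal_mul_I (-θ)).le h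
  rwa [smul_smul, ← Complex.exp_add, Complex.ofReal_neg, neg_mul, neg_add_cancel, Complex.exp_zero,
    one_smul] at this

namespace DefinedBy

theorem contDiffAt (H : DefinedBy Ω U ρ) (hq : q ∈ U) : ContDiffAt ℝ ∞ ρ q :=
  H.smooth.contDiffAt (H.isOpen.mem_nhds hq)

theorem hasFDerivAt (H : DefinedBy Ω U ρ) (hq : q ∈ U) : HasFDerivAt ρ (fderiv ℝ ρ q) q :=
  ((H.contDiffAt hq).differentiableAt (by simp)).hasFDerivAt

theorem contDiffAt_fderiv (H : DefinedBy Ω U ρ) (hq : q ∈ U) : ContDiffAt ℝ ∞ (fderiv ℝ ρ) q :=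
  (H.contDiffAt hq).fderiv_right (by simp)

theorem hasFDerivAt_fderiv (H : DefinedBy Ω U ρ) (hq : q ∈ U) :
    HasFDerivAt (fderiv ℝ ρ) (fderiv ℝ (fderiv ℝ ρ) q) q :=
  ((H.contDiffAt_fderiv hq).differentiableAt (by simp)).hasFDerivAt

theorem mem_iff (H : DefinedBy Ω U ρ) (hq : q ∈ U) : q ∈ Ω ↔ ρ q < 0 := by
  have := Set.ext_iff.1 H.inter_eq q
  simpa [hq] using this

theorem nonpos_of_mem_closure (H : DefinedBy Ω U ρ) (hq : q ∈ U) (hc : q ∈ closure Ω) :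
    ρ q ≤ 0 := by
  by_contra! h
  have hev : ∀ᶠ z in 𝓝 q, 0 < ρ z ∧ z ∈ U :=
    ((H.contDiffAt hq).continuousAt.eventually (lt_mem_nhds h)).and (H.isOpen.mem_nhds hq)
  obtain ⟨z, hz, hzΩ⟩ := mem_closure_iff_nhds.1 hc _ hev
  exact lt_asymm hz.1 ((H.mem_iff hz.2).1 hzΩ)

theorem eq_zero_of_mem_frontier (H : DefinedBy Ω U ρ) (hΩ : IsOpen Ω) (hq : q ∈ U)
    (hf : q ∈ frontier Ω) : ρ q = 0 := by
  rw [mem_frontier_iff hΩ, H.mem_iff hq] at hf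
  exact le_antisymm (H.nonpos_of_mem_closure hq hf.1) (not_lt.1 hf.2)

theorem mem_frontier (H : DefinedBy Ω U ρ) (hΩ : IsOpen Ω) (hq : q ∈ U) (h0 : ρ q = 0)
    (hd : fderiv ℝ ρ q ≠ 0) : q ∈ frontier Ω := by
  rw [mem_frontier_iff hΩ, H.mem_iff hq, h0]
  refine ⟨?_, lt_irrefl _⟩
  obtain ⟨v, hv⟩ : ∃ v, fderiv ℝ ρ q v < 0 := by
    by_contra! h
    exact hd (ContinuousLinearMap.ext fun v => le_antisymm (by simpa using h (-v)) (h v))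
  have hl : HasDerivAt (fun t : ℝ => q + t • v) v 0 := by
    simpa using ((hasDerivAt_id (0 : ℝ)).smul_const v).const_add q
  have hc : HasDerivAt (fun t : ℝ => ρ (q + t • v)) (fderiv ℝ ρ q v) 0 :=
    HasFDerivAt.comp_hasDerivAt (f := fun t : ℝ => q + t • v) 0
      (by simpa using H.hasFDerivAt hq) hl
  have hs := (hasDerivAt_iff_tendsto_slope.1 hc).mono_left
    (nhdsWithin_mono 0 (show Set.Ioi (0 : ℝ) ⊆ {0}ᶜ from fun x hx => ne_of_gt hx))
  have hU : ∀ᶠ t in 𝓝[>] (0 : ℝ), q + t • v ∈ U :=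
    nhdsWithin_le_nhds (hl.continuousAt.eventually (by simpa using H.isOpen.mem_nhds hq))
  have ht : Tendsto (fun t : ℝ => q + t • v) (𝓝[>] 0) (𝓝 q) := by
    simpa using hl.continuousAt.tendsto.mono_left nhdsWithin_le_nhds
  refine mem_closure_of_tendsto ht ?_
  filter_upwards [hs.eventually (gt_mem_nhds hv), hU, self_mem_nhdsWithin] with t h1 h2 h3
  rw [H.mem_iff h2]
  simp only [slope, sub_zero, zero_smul, add_zero, h0, vsub_eq_sub, smul_eq_mul] at h1
  rw [inv_mul_eq_div] at h1
  exact (div_neg_iff.1 h1).elim (fun h => absurd h3 (not_lt.2 h.2.le)) fun h => h.1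

theorem isLocalDefiningFunction (H : DefinedBy Ω U ρ) (hq : q ∈ U) (hd : fderiv ℝ ρ q ≠ 0) :
    IsLocalDefiningFunction Ω q ρ := ⟨U, H.isOpen, hq, H.smooth, H.inter_eq, hd⟩

theorem eventually_mem_frontier (H : DefinedBy Ω U ρ) (hΩ : IsOpen Ω) {γ : ℝ → Cn n} {s : ℝ}
    (hγ : ContinuousAt γ s) (hU : γ s ∈ U) (hd : fderiv ℝ ρ (γ s) ≠ 0)
    (h0 : ∀ᶠ t in 𝓝 s, ρ (γ t) = 0) : ∀ᶠ t in 𝓝 s, γ t ∈ U ∧ γ t ∈ frontier Ω := by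
  have h1 := hγ.eventually (H.isOpen.mem_nhds hU)
  have h2 := hγ.eventually ((H.contDiffAt_fderiv hU).continuousAt.eventually_ne hd)
  filter_upwards [h0, h1, h2] with t h0 h1 h2 using ⟨h1, H.mem_frontier hΩ h1 h0 h2⟩

/-- The rotations `z ↦ e^{iθ} z` preserve the boundary. -/
theorem fderiv_I_smul_self (H : DefinedBy Ω U ρ) (hΩ : IsOpen Ω) (hbal : Balanced ℂ Ω)
    (hq : q ∈ U) (hf : q ∈ frontier Ω) : fderiv ℝ ρ q (Complex.I • q) = 0 := by
  have hr := hasDerivAt_rotation q 0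
  have hc := HasFDerivAt.comp_hasDerivAt (f := fun θ : ℝ => Complex.exp (θ * Complex.I) • q) 0
    (by simpa using H.hasFDerivAt hq) hr
  have hU : ∀ᶠ θ : ℝ in 𝓝 0, Complex.exp (θ * Complex.I) • q ∈ U :=
    hr.continuousAt.eventually (by simpa using H.isOpen.mem_nhds hq)
  have he : (ρ ∘ fun θ : ℝ => Complex.exp (θ * Complex.I) • q) =ᶠ[𝓝 0] fun _ => 0 := by
    filter_upwards [hU] with θ hθ
    exact H.eq_zero_of_mem_frontier hΩ hθ (rotation_mem_frontier hΩ hbal hf θ)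
  simpa using (hc.congr_of_eventuallyEq he.symm).unique (hasDerivAt_const _ _)

/-- The second derivative along the orbits of the rotations. -/
theorem fderiv_fderiv_I_smul_self (H : DefinedBy Ω U ρ) (hΩ : IsOpen Ω) (hbal : Balanced ℂ Ω)
    (hq : q ∈ U) (hf : q ∈ frontier Ω) :
    fderiv ℝ (fderiv ℝ ρ) q (Complex.I • q) (Complex.I • q) = fderiv ℝ ρ q q := by
  have hr := hasDerivAt_rotation q 0
  have hc := HasFDerivAt.comp_hasDerivAt (f := fun θ : ℝ => Complex.exp (θ * Complex.I) • q) 0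
    (by simpa using H.hasFDerivAt_fderiv hq) hr
  have hp := hc.clm_apply (hr.const_smul Complex.I)
  have hU : ∀ᶠ θ : ℝ in 𝓝 0, Complex.exp (θ * Complex.I) • q ∈ U :=
    hr.continuousAt.eventually (by simpa using H.isOpen.mem_nhds hq)
  have he : (fun θ : ℝ => (fderiv ℝ ρ ∘ fun θ : ℝ => Complex.exp (θ * Complex.I) • q) θ
      (Complex.I • Complex.exp (θ * Complex.I) • q)) =ᶠ[𝓝 0] fun _ => 0 := by
    filter_upwards [hU] with θ hθ
    exact H.fderiv_I_smul_self hΩ hbal hθ (rotation_mem_frontier hΩ hbal hf θ)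
  have := (hp.congr_of_eventuallyEq he.symm).unique (hasDerivAt_const _ _)
  simp [smul_smul] at this
  linarith

/-- `Ω` is star-shaped about the origin, so the radial direction does not point inwards. -/
theorem fderiv_self_nonneg (H : DefinedBy Ω U ρ) (hΩ : IsOpen Ω) (hbal : Balanced ℂ Ω)
    (hq : q ∈ U) (hf : q ∈ frontier Ω) : 0 ≤ fderiv ℝ ρ q q := by
  have hr := hasDerivAt_exp_smul q 0
  have hc := HasFDerivAt.comp_hasDerivAt (f := fun s : ℝ => Real.exp s • q) 0
    (by simpa using H.hasFDerivAt hq) hr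
  simp only [Real.exp_zero, one_smul] at hc
  have hs := (hasDerivAt_iff_tendsto_slope.1 hc).mono_left
    (nhdsWithin_mono 0 (show Set.Iio (0 : ℝ) ⊆ {0}ᶜ from fun x hx => ne_of_lt hx))
  have hU : ∀ᶠ s in 𝓝[<] (0 : ℝ), Real.exp s • q ∈ U :=
    nhdsWithin_le_nhds (hr.continuousAt.eventually (by simpa using H.isOpen.mem_nhds hq))
  refine ge_of_tendsto hs ?_
  filter_upwards [hU, self_mem_nhdsWithin] with s h1 h2
  have h3 := H.nonpos_of_mem_closure h1
    (exp_smul_mem_closure hbal (le_of_lt h2) (mem_frontier_iff hΩ |>.1 hf).1)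
  simp only [slope, Function.comp, Real.exp_zero, one_smul, vsub_eq_sub, sub_zero, smul_eq_mul,
    H.eq_zero_of_mem_frontier hΩ hq hf]
  exact mul_nonneg_of_nonpos_of_nonpos (inv_nonpos.2 (le_of_lt h2)) h3

end DefinedBy

/-- The real part of the Levi form is a quarter of the sum of the real second derivatives in the
directions `w` and `iw`. -/
theorem re_levi_eq (hρ : ContDiffAt ℝ ∞ ρ q) (w : Cn n) :
    (∑ j, ∑ k, dz j (dzbar k (fun z => (ρ z : ℂ))) q * w j * star (w k)).re
      = (fderiv ℝ (fderiv ℝ ρ) q w w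
        + fderiv ℝ (fderiv ℝ ρ) q (Complex.I • w) (Complex.I • w)) / 4 := by
  have hρc : ContDiffAt ℝ ∞ (fun z => (ρ z : ℂ)) q :=
    Complex.ofRealCLM.contDiff.contDiffAt.comp q hρ
  have hd : ∀ᶠ z in 𝓝 q, ∀ v, fderiv ℝ (fun z => (ρ z : ℂ)) z v = (fderiv ℝ ρ z v : ℂ) := by
    filter_upwards [(hρ.of_le (m := 1) (by simp)).eventually (by simp)] with z hz v
    have := (Complex.ofRealCLM.hasFDerivAt (x := ρ z)).comp z
      (hz.differentiableAt (by simp)).hasFDerivAt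
    have e := HasFDerivAt.fderiv (f := fun z => (ρ z : ℂ)) this
    rw [e]; rfl
  have hB : HasFDerivAt (fderiv ℝ ρ) (fderiv ℝ (fderiv ℝ ρ) q) q :=
    ((hρ.fderiv_right (m := ∞) (by simp)).differentiableAt (by simp)).hasFDerivAt
  have hv : ∀ v, HasFDerivAt (fun z => (fderiv ℝ ρ z v : ℂ))
      (Complex.ofRealCLM ∘L (fderiv ℝ (fderiv ℝ ρ) q).flip v) q := fun v => by
    have h1 : HasFDerivAt (fun z => fderiv ℝ ρ z v) ((fderiv ℝ (fderiv ℝ ρ) q).flip v) q := by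
      have := hB.clm_apply (hasFDerivAt_const v q)
      simpa using this
    exact (Complex.ofRealCLM.hasFDerivAt (x := fderiv ℝ ρ q v)).comp q h1
  -- contraction in the antiholomorphic index
  have hL : ∀ᶠ z in 𝓝 q, ∑ k, (starRingEnd ℂ) (w k) * wirt Complex.I k (fun z => (ρ z : ℂ)) z
      = ((fderiv ℝ ρ z w : ℂ) + Complex.I * (fderiv ℝ ρ z (Complex.I • w) : ℂ)) / 2 := by
    filter_upwards [hd] with z hz
    rw [sum_conj_mul_wirt, hz, hz]
  have hD : ∀ v, fderiv ℝ (fun z => ∑ k, (starRingEnd ℂ) (w k) *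
        wirt Complex.I k (fun z => (ρ z : ℂ)) z) q v
      = ((fderiv ℝ (fderiv ℝ ρ) q v w : ℂ)
        + Complex.I * (fderiv ℝ (fderiv ℝ ρ) q v (Complex.I • w) : ℂ)) / 2 := fun v => by
    rw [Filter.EventuallyEq.fderiv_eq hL]
    have := ((hv w).add ((hv (Complex.I • w)).const_mul Complex.I)).mul_const (2⁻¹ : ℂ)
    simp only [div_eq_mul_inv]
    have e := HasFDerivAt.fderiv (f := fun z => ((fderiv ℝ ρ z w : ℂ)
      + Complex.I * (fderiv ℝ ρ z (Complex.I • w) : ℂ)) * 2⁻¹) this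
    rw [e]
    simp [mul_comm]; ring
  have hs : ∑ j, ∑ k, dz j (dzbar k (fun z => (ρ z : ℂ))) q * w j * star (w k)
      = ∑ j, w j * wirt (-Complex.I) j (fun z => ∑ k, (starRingEnd ℂ) (w k) *
        wirt Complex.I k (fun z => (ρ z : ℂ)) z) q := by
    refine Finset.sum_congr rfl fun j _ => ?_
    have hdk : ∀ k, DifferentiableAt ℝ (wirt Complex.I k fun z => (ρ z : ℂ)) q :=
      fun k => (contDiffAt_wirt hρc).differentiableAt (by simp)
    rw [wirt_sum fun k _ => (hdk k).const_mul _, Finset.mul_sum]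
    refine Finset.sum_congr rfl fun k _ => ?_
    rw [wirt_mul (differentiableAt_const _) (hdk k), wirt_const, dz_eq_wirt, dzbar_eq_wirt]
    simp; ring
  rw [hs, sum_mul_wirt, hD, hD]
  rw [show ∀ a b c d : ℝ, (((a : ℂ) + Complex.I * b) / 2 - Complex.I * ((c + Complex.I * d) / 2)) / 2
    = (((a + d) / 4 : ℝ) : ℂ) + (((b - c) / 4 : ℝ) : ℂ) * Complex.I by
      intro a b c d; push_cast; linear_combination (-d / 4 : ℂ) * Complex.I_mul_I]
  simp

/-- Pseudoconvexity in real terms. -/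
theorem IsLeviPseudoconvex.levi_nonneg (hpsc : IsLeviPseudoconvex Ω)
    (H : DefinedBy Ω U ρ) (hq : q ∈ U) (hf : q ∈ frontier Ω) (hd : fderiv ℝ ρ q ≠ 0) {w : Cn n}
    (hw : fderiv ℝ ρ q w = 0) (hIw : fderiv ℝ ρ q (Complex.I • w) = 0) :
    0 ≤ fderiv ℝ (fderiv ℝ ρ) q w w
      + fderiv ℝ (fderiv ℝ ρ) q (Complex.I • w) (Complex.I • w) := by
  have hc : ∀ v, fderiv ℝ (fun z => (ρ z : ℂ)) q v = (fderiv ℝ ρ q v : ℂ) := fun v => by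
    have := (Complex.ofRealCLM.hasFDerivAt (x := ρ q)).comp q (H.hasFDerivAt hq)
    have e := HasFDerivAt.fderiv (f := fun z => (ρ z : ℂ)) this
    rw [e]; rfl
  have := hpsc q hf ρ (H.isLocalDefiningFunction hq hd) w (by
    simp only [dz_eq_wirt, mul_comm _ (w _)]
    rw [sum_mul_wirt, hc, hc, hw, hIw]; simp)
  rw [re_levi_eq (H.contDiffAt hq)] at this
  linarith

end Balanced

/-! ### Transversality of the dilations to the boundary -/

section Transversality

variable {Ω U : Set (Cn n)} {ρ : Cn n → ℝ} {p q : Cn n}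

namespace DefinedBy

/-- The Levi form, evaluated on the projection of the position vector `q` to the complex tangent
space of the boundary at `q`, controls the second derivative of `ρ` in the direction of `q` by the
transversality `dρ(q) q`. -/
theorem exists_levi_bound (H : DefinedBy Ω U ρ) (hΩ : IsOpen Ω) (hbal : Balanced ℂ Ω)
    (hpsc : IsLeviPseudoconvex Ω) (hp : p ∈ U) {N : Cn n} (hN : fderiv ℝ ρ p N ≠ 0) :
    ∃ K : Cn n → ℝ, ContinuousAt K p ∧ ∀ q ∈ U, q ∈ frontier Ω → fderiv ℝ ρ q N ≠ 0 →
      K q * fderiv ℝ ρ q q ≤ fderiv ℝ (fderiv ℝ ρ) q q q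
        - fderiv ℝ ρ q q / fderiv ℝ ρ q N * fderiv ℝ (fderiv ℝ ρ) q N q := by
  set D : Cn n → ℝ := fun q => fderiv ℝ ρ q N with hD
  set D' : Cn n → ℝ := fun q => fderiv ℝ ρ q (Complex.I • N) with hD'
  set B := fderiv ℝ (fderiv ℝ ρ) with hB
  -- `dρ(M) = 1` and `dρ(iM) = 0`
  set M : Cn n → Cn n := fun q => (D q / (D q ^ 2 + D' q ^ 2)) • N
    + (D' q / (D q ^ 2 + D' q ^ 2)) • (Complex.I • N) with hM
  have hc1 : ContinuousAt (fderiv ℝ ρ) p := (H.contDiffAt_fderiv hp).continuousAt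
  have hc2 : ContinuousAt B p := ((H.contDiffAt_fderiv hp).fderiv_right (m := ∞) (by simp)).continuousAt
  have hcD : ContinuousAt D p := hc1.clm_apply continuousAt_const
  have hcD' : ContinuousAt D' p := hc1.clm_apply continuousAt_const
  have hpos : D p ^ 2 + D' p ^ 2 ≠ 0 := by
    have : 0 < D p ^ 2 := by positivity
    positivity
  have hcM : ContinuousAt M p :=
    ((hcD.div ((hcD.pow 2).add (hcD'.pow 2)) hpos).smul continuousAt_const).add
      ((hcD'.div ((hcD.pow 2).add (hcD'.pow 2)) hpos).smul continuousAt_const)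
  have hcI : ContinuousAt (fun q : Cn n => Complex.I • q) p := (continuous_const_smul _).continuousAt
  have hcIM : ContinuousAt (fun q : Cn n => Complex.I • M q) p :=
    ContinuousAt.comp (g := fun v : Cn n => Complex.I • v) (continuous_const_smul _).continuousAt hcM
  have hid : ContinuousAt (fun q : Cn n => q) p := continuousAt_id
  refine ⟨fun q => B q q (M q) + B q (M q) q + B q (Complex.I • q) (Complex.I • M q)
    + B q (Complex.I • M q) (Complex.I • q)
    - fderiv ℝ ρ q q * (B q (M q) (M q) + B q (Complex.I • M q) (Complex.I • M q)) - 1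
    - B q N q / D q, ?_, fun q hq hf hDq => ?_⟩
  · have b : ∀ {v w : Cn n → Cn n}, ContinuousAt v p → ContinuousAt w p →
        ContinuousAt (fun q => B q (v q) (w q)) p := fun hv hw =>
      (hc2.clm_apply hv).clm_apply hw
    exact (((((b hid hcM).add (b hcM hid)).add (b hcI hcIM)).add (b hcIM hcI)).sub
      ((hc1.clm_apply hid).mul ((b hcM hcM).add (b hcIM hcIM)))).sub continuousAt_const |>.sub
      ((b continuousAt_const hid).div hcD hN)
  · have hpos : D q ^ 2 + D' q ^ 2 ≠ 0 := by
      have h : D q ≠ 0 := hDq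
      have : 0 < D q ^ 2 := by positivity
      positivity
    have hI : ∀ v : Cn n, Complex.I • Complex.I • v = -v := fun v => by simp [smul_smul]
    have hcomm : ∀ (r : ℝ) (v : Cn n), Complex.I • r • v = r • Complex.I • v := fun r v =>
      smul_comm _ _ _
    have hM1 : fderiv ℝ ρ q (M q) = 1 := by
      simp only [hM, map_add, map_smul, smul_eq_mul]
      change D q / _ * D q + D' q / _ * D' q = 1
      field_simp
    have hM2 : fderiv ℝ ρ q (Complex.I • M q) = 0 := by
      simp only [hM, smul_add, hcomm, hI, map_add, map_smul, map_neg, smul_eq_mul]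
      change D q / _ * D' q + D' q / _ * -D q = 0
      ring
    set G := fderiv ℝ ρ q q with hG
    have hd : fderiv ℝ ρ q ≠ 0 := fun h => hDq (by simp [h])
    have hL := hpsc.levi_nonneg H hq hf hd (w := q - G • M q)
      (by rw [map_sub, map_smul, hM1, smul_eq_mul, mul_one, sub_self])
      (by rw [smul_sub, hcomm, map_sub, map_smul _ G, hM2, H.fderiv_I_smul_self hΩ hbal hq hf]; simp)
    have hR := H.fderiv_fderiv_I_smul_self hΩ hbal hq hf
    rw [smul_sub, hcomm] at hL
    simp only [map_sub, map_smul, sub_apply, smul_apply, smul_eq_mul] at hL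
    rw [hR] at hL
    have e : G / D q * B q N q = G * (B q N q / D q) := by ring
    rw [e]
    linarith

/-- Where the dilations are tangent to the boundary, the backward orbit stays in the boundary. -/
theorem eventually_exp_smul_mem_frontier (H : DefinedBy Ω U ρ) (hΩ : IsOpen Ω)
    (hbal : Balanced ℂ Ω) (hpsc : IsLeviPseudoconvex Ω) (hp : p ∈ U) (hf : p ∈ frontier Ω)
    (hd : fderiv ℝ ρ p ≠ 0) (ht : fderiv ℝ ρ p p = 0) :
    ∀ᶠ s in 𝓝[≤] (0 : ℝ), Real.exp s • p ∈ frontier Ω := by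
  obtain ⟨N, hN⟩ : ∃ N, fderiv ℝ ρ p N ≠ 0 := by
    by_contra! h
    exact hd (ContinuousLinearMap.ext h)
  obtain ⟨K, hK, hKle⟩ := H.exists_levi_bound hΩ hbal hpsc hp hN
  -- a curve in the boundary that follows the dilations
  obtain ⟨h, hh, h0, hρ0⟩ : ∃ h : ℝ → ℝ, ContDiffAt ℝ ∞ h 0 ∧ h 0 = 0 ∧
      ∀ᶠ s in 𝓝 0, ρ (Real.exp s • p + h s • N) = 0 := by
    have hg : ContDiff ℝ ∞ fun x : ℝ × ℝ => Real.exp x.1 • p + x.2 • N := by fun_prop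
    have hρ : ContDiffAt ℝ ∞ ρ (Real.exp (0 : ℝ) • p + (0 : ℝ) • N) := by
      simpa using H.contDiffAt hp
    have hF : ContDiffAt ℝ ∞ (fun x : ℝ × ℝ => ρ (Real.exp x.1 • p + x.2 • N)) (0, 0) :=
      ContDiffAt.comp (g := ρ) (0, 0) hρ hg.contDiffAt
    refine exists_implicitFunction hF (by simpa using H.eq_zero_of_mem_frontier hΩ hp hf) ?_
    have hl : HasDerivAt (fun x : ℝ => ((0 : ℝ), x)) ((0 : ℝ), (1 : ℝ)) 0 :=
      (hasDerivAt_const _ _).prodMk (hasDerivAt_id _)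
    have h1 := HasFDerivAt.comp_hasDerivAt (f := fun x : ℝ => ((0 : ℝ), x)) 0
      (hF.differentiableAt (by simp)).hasFDerivAt hl
    have h2 : HasDerivAt (fun x : ℝ => Real.exp 0 • p + x • N) N 0 := by
      simpa using ((hasDerivAt_id (0 : ℝ)).smul_const N).const_add (Real.exp (0 : ℝ) • p)
    have h3 := HasFDerivAt.comp_hasDerivAt (f := fun x : ℝ => Real.exp 0 • p + x • N) 0
      (by simpa using H.hasFDerivAt hp) h2
    rwa [h1.unique h3]
  set c : ℝ → Cn n := fun s => Real.exp s • p + h s • N with hc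
  have hc0 : c 0 = p := by simp [hc, h0]
  have hcont : ContinuousAt c 0 :=
    (Real.continuous_exp.smul continuous_const).continuousAt.add
      (hh.continuousAt.smul continuousAt_const)
  have hdiff : ∀ᶠ s in 𝓝 0, HasDerivAt h (deriv h s) s := by
    filter_upwards [(hh.of_le (m := 1) (by simp)).eventually (by simp)] with s hs
    exact (hs.differentiableAt (by simp)).hasDerivAt
  have hbd := H.eventually_mem_frontier hΩ hcont (by rwa [hc0]) (by rwa [hc0]) hρ0
  have hDne : ∀ᶠ s in 𝓝 0, fderiv ℝ ρ (c s) N ≠ 0 := by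
    have : ContinuousAt (fun s => fderiv ℝ ρ (c s) N) 0 :=
      (ContinuousAt.comp (g := fderiv ℝ ρ) (by rw [hc0]; exact (H.contDiffAt_fderiv hp).continuousAt)
        hcont).clm_apply continuousAt_const
    exact this.eventually_ne (by rwa [hc0])
  have hKb : ∀ᶠ s in 𝓝 0, |K (c s)| < |K p| + 1 := by
    have : ContinuousAt (fun s => |K (c s)|) 0 :=
      (ContinuousAt.comp (g := K) (by rwa [hc0]) hcont).abs
    exact this.eventually (gt_mem_nhds (by
      change |K (c 0)| < _
      rw [hc0]; linarith))
  set C := |K p| + 1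
  set G : ℝ → ℝ := fun s => fderiv ℝ ρ (c s) (c s) with hG
  have hev : ∀ᶠ s in 𝓝 0, 0 ≤ G s ∧ HasDerivAt h (deriv h s) s ∧ c s ∈ frontier Ω ∧
      (G s = 0 → deriv h s = h s) ∧ ∃ G', HasDerivAt G G' s ∧ -C * G s ≤ G' := by
    filter_upwards [hdiff, hbd, hDne, hKb, hρ0.eventually_nhds] with s hds hs hD hKs h0s
    have hc' : HasDerivAt c (c s + (deriv h s - h s) • N) s := by
      convert! ((Real.hasDerivAt_exp s).smul_const p).add (hds.smul_const N) using 1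
      simp only [hc, sub_smul]; abel
    have hG0 : 0 ≤ G s := H.fderiv_self_nonneg hΩ hbal hs.1 hs.2
    have htan : fderiv ℝ ρ (c s) (c s + (deriv h s - h s) • N) = 0 := by
      have := (H.hasFDerivAt hs.1).comp_hasDerivAt s hc'
      exact (this.congr_of_eventuallyEq (f₁ := fun _ => (0 : ℝ))
        (by filter_upwards [h0s] with t ht using ht.symm)).unique (hasDerivAt_const _ _)
    have hrel : deriv h s - h s = -(G s / fderiv ℝ ρ (c s) N) := by
      rw [map_add, map_smul, smul_eq_mul] at htan
      rw [← neg_div, eq_div_iff hD]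
      linarith
    refine ⟨hG0, hds, hs.2, fun hz => by rw [hz] at hrel; simp at hrel; linarith, _,
      ((H.hasFDerivAt_fderiv hs.1).comp_hasDerivAt s hc').clm_apply hc', ?_⟩
    have hk := hKle (c s) hs.1 hs.2 hD
    have hCK : -C * G s ≤ K (c s) * G s :=
      mul_le_mul_of_nonneg_right (abs_lt.1 hKs).1.le hG0
    simp only [Function.comp]
    have hB : ∀ r : ℝ, fderiv ℝ (fderiv ℝ ρ) (c s) (c s + r • N) (c s)
        = fderiv ℝ (fderiv ℝ ρ) (c s) (c s) (c s)
          + r * fderiv ℝ (fderiv ℝ ρ) (c s) N (c s) := fun r => by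
      rw [map_add (fderiv ℝ (fderiv ℝ ρ) (c s)) (c s) (r • N), map_smul, add_apply, smul_apply,
        smul_eq_mul]
    rw [htan, hrel, add_zero, hB]
    linarith
  obtain ⟨δ, hδ, hball⟩ := Metric.eventually_nhds_iff.1 hev
  have hmem : ∀ s ∈ Set.Ioo (-δ) δ, dist s 0 < δ := fun s hs => by
    rw [Real.dist_eq, sub_zero]; exact abs_lt.2 hs
  -- `e^{Cs} G(s)` is increasing, so `G` vanishes to the left of `0`
  have hmono : MonotoneOn (fun s => Real.exp (C * s) * G s) (Set.Ioo (-δ) δ) := by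
    have hder : ∀ s ∈ Set.Ioo (-δ) δ, ∃ E, HasDerivAt (fun s => Real.exp (C * s) * G s) E s ∧
        0 ≤ E := fun s hs => by
      obtain ⟨hG0, -, -, -, G', hG', hle⟩ := hball (hmem s hs)
      refine ⟨_, (((hasDerivAt_id s).const_mul C).exp).mul hG', ?_⟩
      have := mul_nonneg (Real.exp_pos (C * s)).le (show 0 ≤ C * G s + G' by linarith)
      simp only [id, mul_one]
      linarith
    refine monotoneOn_of_deriv_nonneg (convex_Ioo _ _) (fun s hs => ?_) (fun s hs => ?_)
      fun s hs => ?_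
    · obtain ⟨E, hE, -⟩ := hder s hs
      exact hE.continuousAt.continuousWithinAt
    · rw [interior_Ioo] at hs
      obtain ⟨E, hE, -⟩ := hder s hs
      exact hE.differentiableAt.differentiableWithinAt
    · rw [interior_Ioo] at hs
      obtain ⟨E, hE, hE0⟩ := hder s hs
      rwa [hE.deriv]
  have hGz : ∀ s ∈ Set.Ioc (-δ) 0, G s = 0 := fun s hs => by
    have hs' : s ∈ Set.Ioo (-δ) δ := ⟨hs.1, hs.2.trans_lt hδ⟩
    have := hmono hs' ⟨by linarith, hδ⟩ hs.2
    simp only [hG, hc0, ht, mul_zero] at this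
    exact le_antisymm (nonpos_of_mul_nonpos_right this (Real.exp_pos _)) (hball (hmem s hs')).1
  have hhz : ∀ s ∈ Set.Ioc (-δ) 0, h s = 0 := fun s hs => by
    have hd' : ∀ x ∈ Set.Icc s 0, HasDerivAt (fun x => Real.exp (-x) * h x) 0 x := fun x hx => by
      have hx' : x ∈ Set.Ioc (-δ) 0 := ⟨hs.1.trans_le hx.1, hx.2⟩
      obtain ⟨-, h1, -, h2, -⟩ := hball (hmem x ⟨hx'.1, hx'.2.trans_lt hδ⟩)
      rw [h2 (hGz x hx')] at h1
      convert! ((hasDerivAt_id x).neg.exp).mul h1 using 1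
      simp
    have := constant_of_has_deriv_right_zero
      (fun x hx => (hd' x hx).continuousAt.continuousWithinAt)
      (fun x hx => (hd' x ⟨hx.1, hx.2.le⟩).hasDerivWithinAt) 0 ⟨hs.2, le_rfl⟩
    simp only [h0, mul_zero] at this
    exact (mul_eq_zero.1 this.symm).resolve_left (Real.exp_pos _).ne'
  filter_upwards [Ioc_mem_nhdsLE (show -δ < 0 by linarith)] with s hs
  have := (hball (hmem s ⟨hs.1, hs.2.trans_lt hδ⟩)).2.2.1
  simpa [hc, hhz s hs] using this

/-- The dilations are transversal to the boundary of a smoothly bounded balanced pseudoconvex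
domain: otherwise a whole orbit would lie in the boundary, and so would the origin. -/
theorem fderiv_self_pos (hs : IsSmoothlyBounded Ω) (hne : Ω.Nonempty) (hbal : Balanced ℂ Ω)
    (hpsc : IsLeviPseudoconvex Ω) (H : DefinedBy Ω U ρ) (hp : p ∈ U) (hf : p ∈ frontier Ω)
    (hd : fderiv ℝ ρ p ≠ 0) : 0 < fderiv ℝ ρ p p := by
  have hΩ := hs.isOpen
  refine lt_of_le_of_ne (H.fderiv_self_nonneg hΩ hbal hp hf) fun ht => ?_
  have ht : fderiv ℝ ρ p p = 0 := ht.symm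
  have h0 := zero_mem_of_balanced hbal hne
  -- some point of the orbit lies in `Ω`
  obtain ⟨b, hb0, hb⟩ : ∃ b : ℝ, 0 ≤ b ∧ Real.exp (-b) • p ∈ Ω := by
    have : Tendsto (fun b : ℝ => Real.exp (-b) • p) atTop (𝓝 0) := by
      simpa using (Real.tendsto_exp_neg_atTop_nhds_zero).smul_const p
    exact ((eventually_ge_atTop 0).and (this.eventually (hΩ.mem_nhds h0))).exists
  have hcl : IsClosed {x : ℝ | Real.exp (-x) • p ∈ frontier Ω} :=
    isClosed_frontier.preimage (by fun_prop)
  have hsub := (hcl.inter (isClosed_Icc (a := 0) (b := b))).Icc_subset_of_forall_mem_nhdsWithin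
    (a := 0) (b := b) (by simpa using hf) ?_
  · exact (mem_frontier_iff hΩ).1 (hsub ⟨hb0, le_rfl⟩) |>.2 hb
  · rintro x ⟨hx, hx0, hxb⟩
    have hx : Real.exp (-x) • p ∈ frontier Ω := hx
    set q := Real.exp (-x) • p with hq
    suffices hev : ∀ᶠ s in 𝓝[≤] (0 : ℝ), Real.exp s • q ∈ frontier Ω by
      have ht : Tendsto (fun y : ℝ => x - y) (𝓝[>] x) (𝓝[≤] 0) := by
        refine tendsto_nhdsWithin_iff.2 ⟨?_, ?_⟩
        · have : Tendsto (fun y : ℝ => x - y) (𝓝 x) (𝓝 (x - x)) :=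
            (continuous_const.sub continuous_id).tendsto x
          rw [sub_self] at this
          exact this.mono_left nhdsWithin_le_nhds
        · filter_upwards [self_mem_nhdsWithin] with y hy
          exact sub_nonpos.2 (le_of_lt (Set.mem_Ioi.1 hy))
      filter_upwards [ht.eventually hev] with y hy
      rw [hq, smul_smul, ← Real.exp_add] at hy
      simpa [sub_eq_add_neg] using hy
    rcases hx0.eq_or_lt with rfl | hx0
    · have : q = p := by simp [hq]
      rw [this]
      exact H.eventually_exp_smul_mem_frontier hΩ hbal hpsc hp hf hd ht
    · obtain ⟨σ, V, hVo, hqV, hσ, hV, hdσ⟩ := hs.smooth_boundary q hx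
      have HV : DefinedBy Ω V σ := ⟨hVo, hσ, hV⟩
      refine HV.eventually_exp_smul_mem_frontier hΩ hbal hpsc hqV hx hdσ ?_
      -- the orbit lies in the boundary between `q` and `p`
      have hseg : ∀ s ∈ Set.Icc 0 x, Real.exp s • q ∈ frontier Ω := fun s hs => by
        have e : Real.exp s • q = Real.exp (s - x) • p := by
          rw [hq, smul_smul, ← Real.exp_add, sub_eq_add_neg]
        rw [mem_frontier_iff hΩ] at hf hx ⊢
        refine ⟨e ▸ exp_smul_mem_closure hbal (by linarith [hs.2]) hf.1, fun h => hx.2 ?_⟩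
        have := exp_smul_mem hbal (s := -s) (by linarith [hs.1]) h
        rwa [smul_smul, ← Real.exp_add, neg_add_cancel, Real.exp_zero, one_smul] at this
      have hr := hasDerivAt_exp_smul q 0
      have hc := HasFDerivAt.comp_hasDerivAt (f := fun s : ℝ => Real.exp s • q) 0
        (by simpa using HV.hasFDerivAt hqV) hr
      simp only [Real.exp_zero, one_smul] at hc
      have hU : ∀ᶠ s in 𝓝 (0 : ℝ), Real.exp s • q ∈ V :=
        hr.continuousAt.eventually (by simpa using hVo.mem_nhds hqV)
      have he : (σ ∘ fun s : ℝ => Real.exp s • q) =ᶠ[𝓝[≥] 0] fun _ => 0 := by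
        filter_upwards [nhdsWithin_le_nhds hU, Icc_mem_nhdsGE hx0] with s h1 h2
        exact HV.eq_zero_of_mem_frontier hΩ h1 (hseg s h2)
      have h1 := (hc.hasDerivWithinAt (s := Set.Ici 0)).congr_of_eventuallyEq he.symm
        (by simpa using (HV.eq_zero_of_mem_frontier hΩ hqV hx).symm)
      exact (uniqueDiffOn_Ici (0 : ℝ) 0 Set.self_mem_Ici).eq_deriv _ h1
        (hasDerivWithinAt_const _ _ _)

end DefinedBy

end Transversality

/-! ### The logarithm of the Minkowski functional -/

/-- The logarithm of the Minkowski functional as a real-valued function, with junk value `0` at the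
origin. -/
def logGauge (Ω : Set (Cn n)) (z : Cn n) : ℝ := Real.log (gauge Ω z)

section Gauge

variable {Ω : Set (Cn n)} {p q z : Cn n}

theorem gauge_pos_of_ne_zero (hs : IsSmoothlyBounded Ω) (h0 : (0 : Cn n) ∈ Ω) (hz : z ≠ 0) :
    0 < gauge Ω z :=
  (gauge_pos (absorbent_nhds_zero (hs.isOpen.mem_nhds h0))
    ((NormedSpace.isVonNBounded_iff ℝ).2 hs.bounded)).2 hz

theorem gauge_exp_smul (s : ℝ) (z : Cn n) : gauge Ω (Real.exp s • z) = Real.exp s * gauge Ω z := by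
  rw [gauge_smul_of_nonneg (Real.exp_pos s).le, smul_eq_mul]

theorem gauge_lt_one_iff (hΩ : IsOpen Ω) (hbal : Balanced ℂ Ω) (h0 : (0 : Cn n) ∈ Ω) :
    gauge Ω z < 1 ↔ z ∈ Ω := by
  refine ⟨fun h => ?_, fun h => gauge_lt_one_of_mem_of_isOpen hΩ h⟩
  obtain ⟨b, hb0, hb1, w, hw, rfl⟩ :=
    exists_lt_of_gauge_lt (absorbent_nhds_zero (hΩ.mem_nhds h0)) h
  have := smul_mem_of_balanced hbal (a := (b : ℂ))
    (by rw [Complex.norm_real, Real.norm_of_nonneg hb0.le]; exact hb1.le) hw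
  rwa [Complex.coe_smul] at this

theorem mem_iff_logGauge_neg (hs : IsSmoothlyBounded Ω) (hbal : Balanced ℂ Ω)
    (h0 : (0 : Cn n) ∈ Ω) : z ∈ Ω ↔ z = 0 ∨ logGauge Ω z < 0 := by
  by_cases hz : z = 0
  · simp [hz, h0]
  · rw [← gauge_lt_one_iff hs.isOpen hbal h0, logGauge,
      Real.log_neg_iff (gauge_pos_of_ne_zero hs h0 hz)]
    simp [hz]

theorem logGauge_smul (hs : IsSmoothlyBounded Ω) (hbal : Balanced ℂ Ω) (h0 : (0 : Cn n) ∈ Ω)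
    {a : ℂ} (ha : a ≠ 0) (hz : z ≠ 0) :
    logGauge Ω (a • z) = Real.log ‖a‖ + logGauge Ω z := by
  rw [logGauge, gauge_smul hbal, Real.log_mul (norm_ne_zero_iff.2 ha)
    (gauge_pos_of_ne_zero hs h0 hz).ne', logGauge]

/-- By transversality the points on the orbit just before a boundary point belong to `Ω`. -/
theorem gauge_eq_one_iff (hs : IsSmoothlyBounded Ω) (hbal : Balanced ℂ Ω) (h0 : (0 : Cn n) ∈ Ω)
    (hpsc : IsLeviPseudoconvex Ω) : gauge Ω q = 1 ↔ q ∈ frontier Ω := by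
  have hΩ := hs.isOpen
  refine ⟨fun h => ?_, fun hf => ?_⟩
  · rw [mem_frontier_iff hΩ, ← gauge_lt_one_iff hΩ hbal h0, h]
    refine ⟨?_, lt_irrefl _⟩
    have ht : Tendsto (fun s : ℝ => Real.exp s • q) (𝓝[<] 0) (𝓝 q) := by
      simpa using (hasDerivAt_exp_smul q 0).continuousAt.tendsto.mono_left nhdsWithin_le_nhds
    refine mem_closure_of_tendsto ht ?_
    filter_upwards [self_mem_nhdsWithin] with s hs
    rw [← gauge_lt_one_iff hΩ hbal h0, gauge_exp_smul, h, mul_one]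
    exact (Real.exp_lt_exp.2 hs).trans_eq Real.exp_zero
  · obtain ⟨ρ, U, hU, hq, hρ, hUΩ, hd⟩ := hs.smooth_boundary q hf
    have H : DefinedBy Ω U ρ := ⟨hU, hρ, hUΩ⟩
    have hpos := H.fderiv_self_pos hs ⟨0, h0⟩ hbal hpsc hq hf hd
    have h1 : 1 ≤ gauge Ω q :=
      not_lt.1 fun h => ((mem_frontier_iff hΩ).1 hf).2 ((gauge_lt_one_iff hΩ hbal h0).1 h)
    refine le_antisymm ?_ h1
    have hr := hasDerivAt_exp_smul q 0
    have hc := HasFDerivAt.comp_hasDerivAt (f := fun s : ℝ => Real.exp s • q) 0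
      (by simpa using H.hasFDerivAt hq) hr
    simp only [Real.exp_zero, one_smul] at hc
    have hsl := (hasDerivAt_iff_tendsto_slope.1 hc).mono_left
      (nhdsWithin_mono 0 (show Set.Iio (0 : ℝ) ⊆ {0}ᶜ from fun x hx => ne_of_lt hx))
    have hU' : ∀ᶠ s in 𝓝[<] (0 : ℝ), Real.exp s • q ∈ U :=
      nhdsWithin_le_nhds (hr.continuousAt.eventually (by simpa using hU.mem_nhds hq))
    have ht : Tendsto (fun s : ℝ => Real.exp s * gauge Ω q) (𝓝[<] 0) (𝓝 (gauge Ω q)) := by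
      have : Tendsto (fun s : ℝ => Real.exp s * gauge Ω q) (𝓝 0) (𝓝 (Real.exp 0 * gauge Ω q)) :=
        (Real.continuous_exp.mul continuous_const).tendsto 0
      rw [Real.exp_zero, one_mul] at this
      exact this.mono_left nhdsWithin_le_nhds
    refine le_of_tendsto ht ?_
    filter_upwards [hsl.eventually (lt_mem_nhds hpos), hU', self_mem_nhdsWithin] with s h2 h3 h4
    rw [← gauge_exp_smul]
    refine ((gauge_lt_one_iff hΩ hbal h0).2 ((H.mem_iff h3).2 ?_)).le
    simp only [slope, Function.comp, Real.exp_zero, one_smul, vsub_eq_sub, sub_zero, smul_eq_mul,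
      H.eq_zero_of_mem_frontier hΩ hq hf] at h2
    rw [inv_mul_eq_div] at h2
    exact (div_pos_iff.1 h2).elim (fun h => absurd h4 (not_lt.2 h.2.le)) fun h => h.1

/-- Near a boundary point the logarithm of the Minkowski functional solves `ρ(e^{-s} z) = 0` for
`s`. -/
theorem contDiffAt_logGauge_of_mem_frontier (hs : IsSmoothlyBounded Ω) (hbal : Balanced ℂ Ω)
    (h0 : (0 : Cn n) ∈ Ω) (hpsc : IsLeviPseudoconvex Ω) (hp : p ∈ frontier Ω) :
    ContDiffAt ℝ ∞ (logGauge Ω) p := by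
  have hΩ := hs.isOpen
  obtain ⟨ρ, U, hU, hpU, hρ, hUΩ, hd⟩ := hs.smooth_boundary p hp
  have H : DefinedBy Ω U ρ := ⟨hU, hρ, hUΩ⟩
  have hpos := H.fderiv_self_pos hs ⟨0, h0⟩ hbal hpsc hpU hp hd
  obtain ⟨S, hS, hS0, hSρ⟩ : ∃ S : Cn n → ℝ, ContDiffAt ℝ ∞ S p ∧ S p = 0 ∧
      ∀ᶠ z in 𝓝 p, ρ (Real.exp (-S z) • z) = 0 := by
    have hg : ContDiff ℝ ∞ fun x : Cn n × ℝ => Real.exp (-x.2) • x.1 := by fun_prop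
    have hρ' : ContDiffAt ℝ ∞ ρ (Real.exp (-(0 : ℝ)) • p) := by simpa using H.contDiffAt hpU
    have hF : ContDiffAt ℝ ∞ (fun x : Cn n × ℝ => ρ (Real.exp (-x.2) • x.1)) (p, 0) :=
      ContDiffAt.comp (g := ρ) (p, 0) hρ' hg.contDiffAt
    refine exists_implicitFunction hF (by simpa using H.eq_zero_of_mem_frontier hΩ hpU hp) ?_
    have hl : HasDerivAt (fun x : ℝ => (p, x)) ((0 : Cn n), (1 : ℝ)) 0 :=
      (hasDerivAt_const _ _).prodMk (hasDerivAt_id _)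
    have h1 := HasFDerivAt.comp_hasDerivAt (f := fun x : ℝ => (p, x)) 0
      (hF.differentiableAt (by simp)).hasFDerivAt hl
    have h2 : HasDerivAt (fun x : ℝ => Real.exp (-x) • p) (-p) 0 := by
      simpa using ((hasDerivAt_id (0 : ℝ)).neg.exp).smul_const p
    have h3 := HasFDerivAt.comp_hasDerivAt (f := fun x : ℝ => Real.exp (-x) • p) 0
      (by simpa using H.hasFDerivAt hpU) h2
    rw [h1.unique h3, map_neg]
    exact (neg_neg_of_pos hpos).ne
  refine hS.congr_of_eventuallyEq ?_
  have hc : ContinuousAt (fun z => Real.exp (-S z) • z) p :=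
    (hS.continuousAt.neg.rexp).smul continuousAt_id
  have hcp : Real.exp (-S p) • p = p := by simp [hS0]
  have hcU : ∀ᶠ z in 𝓝 p, Real.exp (-S z) • z ∈ U :=
    hc.eventually_mem (by simpa only [hcp] using H.isOpen.mem_nhds hpU)
  have hcd := hc.eventually (by
    simpa only [hcp] using (H.contDiffAt_fderiv hpU).continuousAt.eventually_ne hd)
  filter_upwards [hSρ, hcU, hcd] with z h1 h2 h3
  have := (gauge_eq_one_iff hs hbal h0 hpsc).2 (H.mem_frontier hΩ h2 h1 h3)
  rw [gauge_exp_smul, Real.exp_neg, inv_mul_eq_one₀ (Real.exp_pos _).ne'] at this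
  rw [logGauge, ← this, Real.log_exp]

theorem inv_gauge_smul_mem_frontier (hs : IsSmoothlyBounded Ω) (hbal : Balanced ℂ Ω)
    (h0 : (0 : Cn n) ∈ Ω) (hpsc : IsLeviPseudoconvex Ω) (hz : z ≠ 0) :
    (gauge Ω z)⁻¹ • z ∈ frontier Ω := by
  have h := gauge_pos_of_ne_zero hs h0 hz
  rw [← gauge_eq_one_iff hs hbal h0 hpsc, gauge_smul_of_nonneg (inv_nonneg.2 h.le), smul_eq_mul,
    inv_mul_cancel₀ h.ne']

theorem logHom_logGauge (hs : IsSmoothlyBounded Ω) (hbal : Balanced ℂ Ω)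
    (h0 : (0 : Cn n) ∈ Ω) (hpsc : IsLeviPseudoconvex Ω) : LogHom (logGauge Ω) where
  smooth := fun z hz => by
    have hr := gauge_pos_of_ne_zero hs h0 hz
    have h1 := contDiffAt_logGauge_of_mem_frontier hs hbal h0 hpsc
      (inv_gauge_smul_mem_frontier hs hbal h0 hpsc hz)
    have h2 : ContDiffAt ℝ ∞ (fun w => Real.log (gauge Ω z) + logGauge Ω ((gauge Ω z)⁻¹ • w)) z :=
      contDiffAt_const.add (ContDiffAt.comp (g := logGauge Ω) z h1
        (contDiff_const_smul (gauge Ω z)⁻¹).contDiffAt)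
    refine (h2.congr_of_eventuallyEq ?_).contDiffWithinAt
    filter_upwards [isOpen_compl_singleton.mem_nhds (show z ∈ ({0}ᶜ : Set (Cn n)) from hz)] with w hw
    have := logGauge_smul hs hbal h0 (a := (((gauge Ω z)⁻¹ : ℝ) : ℂ))
      (by exact_mod_cast (inv_pos.2 hr).ne') (show w ≠ 0 from hw)
    rw [Complex.coe_smul, Complex.norm_real, Real.norm_of_nonneg (inv_nonneg.2 hr.le),
      Real.log_inv] at this
    linarith
  hom := fun _ _ ha hz => logGauge_smul hs hbal h0 ha hz

open scoped ComplexOrder in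
/-- The logarithm of the Minkowski functional is plurisubharmonic: it is a defining function at the
boundary points, and the radial direction is in the kernel of its Levi form. -/
theorem posSemidef_hess_logGauge (hs : IsSmoothlyBounded Ω) (hbal : Balanced ℂ Ω)
    (h0 : (0 : Cn n) ∈ Ω) (hpsc : IsLeviPseudoconvex Ω) (hz : z ≠ 0) :
    (Matrix.of fun p q => hess (logGauge Ω) p q z).PosSemidef := by
  have hu := logHom_logGauge hs hbal h0 hpsc
  have hΩ := hs.isOpen
  -- the Levi form at a boundary point
  have hlevi : ∀ p ∈ frontier Ω, ∀ w : Fin n → ℂ,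
      0 ≤ (∑ j, ∑ k, hess (logGauge Ω) j k p * w j * star (w k)).re := by
    intro p hp w
    have hp0 : p ≠ 0 := fun h => ((mem_frontier_iff hΩ).1 hp).2 (h ▸ h0)
    have H : DefinedBy Ω {0}ᶜ (logGauge Ω) :=
      ⟨isOpen_compl_singleton, hu.smooth, by
        ext z
        simp only [Set.mem_inter_iff, mem_iff_logGauge_neg hs hbal h0 (z := z), Set.mem_compl_iff,
          Set.mem_singleton_iff, Set.mem_ofPred]
        tauto⟩
    have hd : fderiv ℝ (logGauge Ω) p ≠ 0 := fun h => by
      have h1 := (Complex.ofRealCLM.hasFDerivAt (x := logGauge Ω p)).comp p (H.hasFDerivAt hp0)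
      have e := HasFDerivAt.fderiv (f := fun z => (logGauge Ω z : ℂ)) h1
      have := hu.fderiv_self hp0
      rw [e, h] at this
      simp at this
    set c : ℂ := 2 * ∑ j, gradL (logGauge Ω) j p * w j with hc
    have hw0 : ∑ j, gradL (logGauge Ω) j p * (w j - c * p j) = 0 := by
      simp only [mul_sub, Finset.sum_sub_distrib]
      have : ∑ j, gradL (logGauge Ω) j p * (c * p j) = c * ∑ j, gradL (logGauge Ω) j p * p j := by
        rw [Finset.mul_sum]; exact Finset.sum_congr rfl fun j _ => by ring
      rw [this, hu.sum_mul_gradL hp0, hc]; ring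
    have h1 := hpsc p hp _ (H.isLocalDefiningFunction hp0 hd) (fun j => w j - c * p j) (by
      simp only [dz_eq_wirt]
      exact hw0)
    simp only [dz_eq_wirt, dzbar_eq_wirt] at h1
    change 0 ≤ (∑ j, ∑ k, hess (logGauge Ω) j k p * (w j - c * p j) * star (w k - c * p k)).re at h1
    have e : ∑ j, ∑ k, hess (logGauge Ω) j k p * (w j - c * p j) * star (w k - c * p k)
        = ∑ j, ∑ k, hess (logGauge Ω) j k p * w j * star (w k) := by
      have e1 : ∀ j k, hess (logGauge Ω) j k p * (w j - c * p j) * star (w k - c * p k)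
          = hess (logGauge Ω) j k p * w j * star (w k)
            - w j * star c * (hess (logGauge Ω) j k p * (starRingEnd ℂ) (p k))
            - c * star (w k - c * p k) * (hess (logGauge Ω) j k p * p j) := fun j k => by
        simp only [star_sub, star_mul']
        rw [starRingEnd_apply]; ring
      have z1 : ∑ j, ∑ k, w j * star c * (hess (logGauge Ω) j k p * (starRingEnd ℂ) (p k)) = 0 := by
        simp only [← Finset.mul_sum, hu.sum_conj_mul_hess _ hp0, mul_zero, Finset.sum_const_zero]
      have z2 : ∑ j, ∑ k, c * star (w k - c * p k) * (hess (logGauge Ω) j k p * p j) = 0 := by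
        rw [Finset.sum_comm]
        simp only [← Finset.mul_sum, hu.sum_mul_hess _ hp0, mul_zero, Finset.sum_const_zero]
      simp only [e1, Finset.sum_sub_distrib, z1, z2, sub_zero]
    rwa [e] at h1
  have hr := gauge_pos_of_ne_zero hs h0 hz
  have hherm : (Matrix.of fun p q => hess (logGauge Ω) p q z).IsHermitian := by
    ext p q
    simp only [Matrix.conjTranspose_apply, Matrix.of_apply]
    rw [← starRingEnd_apply, hess, conj_wirt, map_neg, Complex.conj_I, neg_neg, hu.hess_eq p q hz]
    congr 1
    funext w
    rw [← conj_gradL, Complex.conj_conj]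
  refine .of_dotProduct_mulVec_nonneg hherm fun x => ?_
  have him := hherm.im_star_dotProduct_mulVec_self x
  refine Complex.nonneg_iff.2 ⟨?_, him.symm⟩
  have h1 := hlevi _ (inv_gauge_smul_mem_frontier hs hbal h0 hpsc hz) (star x)
  have e : star x ⬝ᵥ (Matrix.of fun p q => hess (logGauge Ω) p q z).mulVec x
      = (((gauge Ω z)⁻¹ ^ 2 : ℝ) : ℂ) * ∑ j, ∑ k,
        hess (logGauge Ω) j k ((gauge Ω z)⁻¹ • z) * star x j * star (star x k) := by
    simp only [dotProduct, Matrix.mulVec, Matrix.of_apply, Finset.mul_sum]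
    refine Finset.sum_congr rfl fun j _ => Finset.sum_congr rfl fun k _ => ?_
    rw [← hu.homDeg_hess j k _ (inv_pos.2 hr) z hz]
    simp only [Pi.star_apply, star_star]
    push_cast; ring
  rw [e, Complex.re_ofReal_mul]
  exact mul_nonneg (by positivity) h1

theorem formB_logGauge_nonneg {m : ℕ} {Ω : Set (Cn (m + 1))} (hs : IsSmoothlyBounded Ω)
    (hbal : Balanced ℂ Ω) (h0 : (0 : Cn (m + 1)) ∈ Ω) (hpsc : IsLeviPseudoconvex Ω)
    {z : Cn (m + 1)} (hz : z ≠ 0) :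
    ∃ r : ℝ, 0 ≤ r ∧ formB (logGauge Ω) (fun _ : Fin m => logGauge Ω) id id z = r :=
  formB_nonneg (posSemidef_hess_logGauge hs hbal h0 hpsc hz) id

open scoped Pointwise in
/-- The sublevel sets of `log` of the gauge are the dilates of `Ω`. -/
theorem volume_logGauge_lt (hs : IsSmoothlyBounded Ω) (hbal : Balanced ℂ Ω) (h0 : (0 : Cn n) ∈ Ω)
    (s : ℝ) : volume {z | z = 0 ∨ logGauge Ω z < s}
      = ENNReal.ofReal (Real.exp (2 * n * s)) * volume Ω := by
  have e : {z | z = 0 ∨ logGauge Ω z < s} = Real.exp s • Ω := by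
    ext z
    rw [Set.mem_smul_set_iff_inv_smul_mem₀ (Real.exp_pos s).ne', mem_iff_logGauge_neg hs hbal h0,
      Set.mem_ofPred]
    by_cases hz : z = 0
    · simp [hz]
    · have h := gauge_pos_of_ne_zero hs h0 hz
      rw [logGauge, logGauge, ← Real.exp_neg, gauge_exp_smul,
        Real.log_mul (Real.exp_pos _).ne' h.ne', Real.log_exp]
      simp [hz, neg_add_lt_iff_lt_add]
  rw [e, Measure.addHaar_smul, finrank_Cn, abs_of_pos (by positivity), ← Real.exp_nat_mul]
  push_cast
  ring_nf

end Gauge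

/-! ### Schwarz symmetrization -/

/-- The logarithm of the Minkowski functional of the ball of radius `R`. -/
def logBall (R : ℝ) (z : Cn n) : ℝ := logNorm z - Real.log R

theorem logHom_logBall (R : ℝ) : LogHom (logBall R : Cn n → ℝ) where
  smooth := logHom_logNorm.smooth.sub contDiffOn_const
  hom := fun a z ha hz => by
    simp only [logBall, logHom_logNorm.hom a z ha hz]; ring

theorem formB_logBall_nonneg {m : ℕ} (R : ℝ) {z : Cn (m + 1)} (hz : z ≠ 0) :
    ∃ r : ℝ, 0 ≤ r ∧ formB (logBall R) (fun _ : Fin m => logBall R) id id z = r := by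
  have hw : ∀ (c : ℂ) (p : Fin (m + 1)), wirt c p (fun z : Cn (m + 1) => (logBall R z : ℂ))
      = wirt c p (fun z => (logNorm z : ℂ)) := fun c p => by
    funext z
    simp only [wirt, logBall, Complex.ofReal_sub, fderiv_sub_const]
  have hL : ∀ p : Fin (m + 1), gradL (logBall R) p = gradL logNorm p := fun p => hw _ p
  have hR : ∀ p : Fin (m + 1), gradR (logBall R) p = gradR logNorm p := fun p => hw _ p
  have hH : ∀ p q : Fin (m + 1), hess (logBall R) p q = hess logNorm p q := fun p q => by
    rw [hess, hess, hR]
  have e : formB (logBall R) (fun _ : Fin m => logBall R) id id z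
      = formB logNorm (fun _ : Fin m => logNorm) id id z := by
    simp only [formB, hL, hR, hH]
  rw [e, formB_logNorm hz]
  exact ⟨_, by positivity, rfl⟩

theorem logBall_lt_iff {R : ℝ} (hR : 0 < R) {z : Cn n} (hz : z ≠ 0) (s : ℝ) :
    logBall R z < s ↔ ‖z‖ < Real.exp s * R := by
  have h := norm_pos_iff.2 hz
  rw [logBall, logNorm, ← Real.log_div h.ne' hR.ne', Real.log_lt_iff_lt_exp (by positivity),
    div_lt_iff₀ hR]

theorem setOf_logBall_lt {R : ℝ} (hR : 0 < R) (s : ℝ) :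
    {z : Cn n | z = 0 ∨ logBall R z < s} = Metric.ball 0 (Real.exp s * R) := by
  ext z
  rw [Set.mem_ofPred, mem_ball_zero_iff]
  by_cases hz : z = 0
  · simp only [hz, true_or, norm_zero, true_iff]; positivity
  · simp [hz, logBall_lt_iff hR hz]

theorem volume_logBall_lt {R : ℝ} (hR : 0 < R) (s : ℝ) :
    volume {z : Cn n | z = 0 ∨ logBall R z < s}
      = ENNReal.ofReal (Real.exp (2 * n * s)) * volume (Metric.ball (0 : Cn n) R) := by
  rw [setOf_logBall_lt hR, Measure.addHaar_ball_mul_of_pos _ _ (Real.exp_pos s), finrank_Cn,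
    ← Real.exp_nat_mul]
  push_cast
  ring_nf

namespace RadialData

variable {u v : Cn n → ℝ} {f : ℝ → ℝ} {Ω Ω' : Set (Cn n)} {φ ψ : Cn n → EReal} {V : ℝ≥0∞}

/-- The sublevel set `{φ < t}` contains `{u < s}`, up to the origin, for every level `s` with
`f s < t`. -/
theorem le_volume_lt [NeZero n] (H : RadialData u f Ω φ)
    (hV : ∀ s, volume {z | z = 0 ∨ u z < s} = ENNReal.ofReal (Real.exp (2 * n * s)) * V)
    {s t : ℝ} (hs : s < 0) (ht : f s < t) :
    ENNReal.ofReal (Real.exp (2 * n * s)) * V ≤ volume {z | z ∈ Ω ∧ φ z < t} := by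
  rw [← hV, ← measure_sdiff_null (measure_singleton (0 : Cn n))]
  refine measure_mono fun z hz => ?_
  have hz0 : z ≠ 0 := hz.2
  have hzs : u z < s := hz.1.resolve_left hz0
  have hzΩ : z ∈ Ω := (H.mem_iff z).2 (Or.inr (hzs.trans hs))
  refine ⟨hzΩ, ?_⟩
  rw [H.apply_eq z hzΩ hz0, EReal.coe_lt_coe_iff]
  exact (H.profile.mono (hzs.trans hs) hs hzs.le).trans_lt ht

theorem volume_lt_le (H : RadialData u f Ω φ)
    (hV : ∀ s, volume {z | z = 0 ∨ u z < s} = ENNReal.ofReal (Real.exp (2 * n * s)) * V)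
    {s t : ℝ} (hs : s < 0) (ht : t ≤ f s) :
    volume {z | z ∈ Ω ∧ φ z < t} ≤ ENNReal.ofReal (Real.exp (2 * n * s)) * V := by
  rw [← hV]
  refine measure_mono fun z hz => ?_
  refine or_iff_not_imp_left.2 fun hz0 => ?_
  have h := hz.2
  rw [H.apply_eq z hz.1 hz0, EReal.coe_lt_coe_iff] at h
  by_contra! hsu
  exact absurd (H.profile.mono hs (((H.mem_iff z).1 hz.1).resolve_left hz0) hsu)
    (not_le.2 (h.trans_le ht))

/-- The volume of `{φ < t}` is determined by `f` and by the volume of the domain. -/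
theorem volume_lt_le_of_volume_eq [NeZero n] (H : RadialData u f Ω φ) (H' : RadialData v f Ω' ψ)
    (hVt : V ≠ ⊤)
    (hu : ∀ s, volume {z | z = 0 ∨ u z < s} = ENNReal.ofReal (Real.exp (2 * n * s)) * V)
    (hv : ∀ s, volume {z | z = 0 ∨ v z < s} = ENNReal.ofReal (Real.exp (2 * n * s)) * V)
    (t : ℝ) : volume {z | z ∈ Ω ∧ φ z < t} ≤ volume {z | z ∈ Ω' ∧ ψ z < t} := by
  by_contra! hlt
  obtain ⟨c, hc1, hc2⟩ := ENNReal.lt_iff_exists_nnreal_btwn.1 hlt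
  have hn : (0 : ℝ) < 2 * n := by
    have : (0 : ℝ) < n := by exact_mod_cast Nat.pos_of_ne_zero (NeZero.ne n)
    positivity
  have hVΩ : volume {z | z ∈ Ω ∧ φ z < t} ≤ V := by
    have h0 := hu 0
    rw [mul_zero, Real.exp_zero, ENNReal.ofReal_one, one_mul] at h0
    rw [← h0]
    exact measure_mono fun z hz => (H.mem_iff z).1 hz.1
  have hcV := hc2.trans_le hVΩ
  lift V to NNReal using hVt
  have hc0 : (0 : ℝ) < c := by
    have : (0 : ℝ≥0∞) < c := bot_le.trans_lt hc1
    exact_mod_cast this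
  have hcV' : (c : ℝ) < V := by exact_mod_cast hcV
  -- the level at which the sublevel sets have volume `c`
  set s := Real.log (c / V) / (2 * n) with hs
  have hs0 : s < 0 :=
    div_neg_of_neg_of_pos (Real.log_neg (div_pos hc0 (hc0.trans hcV'))
      ((div_lt_one (hc0.trans hcV')).2 hcV')) hn
  have he : ENNReal.ofReal (Real.exp (2 * n * s)) * V = c := by
    rw [hs, mul_div_cancel₀ _ hn.ne', Real.exp_log (div_pos hc0 (hc0.trans hcV')),
      ← ENNReal.ofReal_coe_nnreal (p := V), ← ENNReal.ofReal_mul (by positivity),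
      div_mul_cancel₀ _ (hc0.trans hcV').ne', ENNReal.ofReal_coe_nnreal]
  rcases lt_or_ge (f s) t with h | h
  · have := H'.le_volume_lt hv hs0 h
    rw [he] at this
    exact absurd hc1 (not_lt.2 this)
  · have := H.volume_lt_le hu hs0 h
    rw [he] at this
    exact absurd hc2 (not_lt.2 this)

/-- The radial model `f (log (|z| / R))` on the ball. -/
theorem logBall (hf : Profile f) {R : ℝ} (hR : 0 < R)
    (hψ : ∀ z ∈ Metric.ball (0 : Cn n) R, z ≠ 0 → ψ z = ((f (logBall R z) : ℝ) : EReal)) :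
    RadialData (Pluripotential.logBall R) f (Metric.ball (0 : Cn n) R) ψ where
  logHom := logHom_logBall R
  profile := hf
  isOpen := Metric.isOpen_ball
  mem_iff := fun z => by
    have := Set.ext_iff.1 (setOf_logBall_lt (n := n) hR 0) z
    rw [Real.exp_zero, one_mul] at this
    exact this.symm
  apply_eq := hψ

/-- The radial model on the ball with the volume of `Ω` is a Schwarz symmetrization. -/
theorem exists_isSchwarzSymmetrization [NeZero n] (H : RadialData u f Ω φ)
    (hV : ∀ s, volume {z | z = 0 ∨ u z < s} = ENNReal.ofReal (Real.exp (2 * n * s)) * volume Ω)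
    (hfin : volume Ω ≠ ⊤) (h0 : (0 : Cn n) ∈ Ω) : ∃ R ψ, IsSchwarzSymmetrization Ω φ R ψ := by
  have hb0 : 0 < (volume (Metric.ball (0 : Cn n) 1)).toReal :=
    ENNReal.toReal_pos (Metric.measure_ball_pos _ _ one_pos).ne' measure_ball_lt_top.ne
  have hΩ0 : 0 < (volume Ω).toReal :=
    ENNReal.toReal_pos (H.isOpen.measure_pos _ ⟨0, h0⟩).ne' hfin
  set R : ℝ := ((volume Ω).toReal / (volume (Metric.ball (0 : Cn n) 1)).toReal)
    ^ (((2 * n : ℕ) : ℝ)⁻¹) with hRdef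
  have hR : 0 < R := Real.rpow_pos_of_pos (div_pos hΩ0 hb0) _
  have hvol : volume (Metric.ball (0 : Cn n) R) = volume Ω := by
    rw [Measure.addHaar_ball_of_pos _ _ hR, finrank_Cn, hRdef,
      Real.rpow_inv_natCast_pow (div_pos hΩ0 hb0).le (mul_ne_zero two_ne_zero (NeZero.ne n)),
      ← ENNReal.ofReal_toReal (measure_ball_lt_top (μ := volume) (x := (0 : Cn n)) (r := 1)).ne,
      ← ENNReal.ofReal_mul (by positivity), ENNReal.toReal_ofReal hb0.le,
      div_mul_cancel₀ _ hb0.ne', ENNReal.ofReal_toReal hfin]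
  set g : ℝ → EReal := fun r =>
    if r = 0 then extendBot f ⊥ else ((f (Real.log r - Real.log R) : ℝ) : EReal) with hg
  have hneg : ∀ r, 0 < r → r < R → Real.log r - Real.log R < 0 := fun r h1 h2 =>
    sub_neg.2 (Real.log_lt_log h1 h2)
  have hgm : MonotoneOn g (Set.Ico 0 R) := by
    intro a ha b hb hab
    rcases ha.1.eq_or_lt with rfl | ha0
    · rcases hb.1.eq_or_lt with rfl | hb0
      · exact le_rfl
      · simp only [hg, if_pos rfl, if_neg hb0.ne', extendBot]
        exact iInf_le_of_le ⟨_, hneg b hb0 hb.2⟩ le_rfl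
    · have hb0 := ha0.trans_le hab
      simp only [hg, if_neg ha0.ne', if_neg hb0.ne']
      exact EReal.coe_le_coe_iff.2 (H.profile.mono (hneg a ha0 ha.2) (hneg b hb0 hb.2)
        (sub_le_sub_right (Real.log_le_log ha0 hab) _))
  have H' : RadialData (Pluripotential.logBall R) f (Metric.ball (0 : Cn n) R) fun z => g ‖z‖ :=
    RadialData.logBall H.profile hR fun z _ hz => by
      simp only [hg, if_neg (norm_ne_zero_iff.2 hz)]; rfl
  have hV' := volume_logBall_lt (n := n) hR
  rw [hvol] at hV'
  exact ⟨R, fun z => g ‖z‖, hR, hvol, ⟨g, hgm, fun _ _ => rfl⟩, fun t =>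
    le_antisymm (H'.volume_lt_le_of_volume_eq H hfin hV' hV t)
      (H.volume_lt_le_of_volume_eq H' hfin hV hV' t)⟩

/-- Every Schwarz symmetrization is the radial model, except that its value at the origin may be
smaller. -/
theorem of_isSchwarzSymmetrization [NeZero n] (H : RadialData u f Ω φ)
    (hV : ∀ s, volume {z | z = 0 ∨ u z < s} = ENNReal.ofReal (Real.exp (2 * n * s)) * volume Ω)
    (hfin : volume Ω ≠ ⊤) (h0 : (0 : Cn n) ∈ Ω) {R : ℝ} (hψ : IsSchwarzSymmetrization Ω φ R ψ) :
    RadialData (Pluripotential.logBall R) f (Metric.ball (0 : Cn n) R) ψ ∧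
      ψ 0 ≤ extendBot f ⊥ := by
  obtain ⟨hR, hvol, ⟨g, hgm, hg⟩, heq⟩ := hψ
  have hn : (0 : ℝ) < 2 * n := by
    have : (0 : ℝ) < n := by exact_mod_cast Nat.pos_of_ne_zero (NeZero.ne n)
    positivity
  have hΩ0 : volume Ω ≠ 0 := (H.isOpen.measure_pos _ ⟨0, h0⟩).ne'
  have hlt : ∀ a b : ℝ, a < b → ENNReal.ofReal (Real.exp (2 * n * a)) * volume Ω
      < ENNReal.ofReal (Real.exp (2 * n * b)) * volume Ω := fun a b hab => by
    refine ENNReal.mul_lt_mul_left hΩ0 hfin ?_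
    exact (ENNReal.ofReal_lt_ofReal_iff (Real.exp_pos _)).2
      (Real.exp_lt_exp.2 (mul_lt_mul_of_pos_left hab hn))
  have hball : ∀ s : ℝ, volume (Metric.ball (0 : Cn n) (Real.exp s * R))
      = ENNReal.ofReal (Real.exp (2 * n * s)) * volume Ω := fun s => by
    rw [← setOf_logBall_lt hR, volume_logBall_lt hR, hvol]
  have hmem : ∀ s < 0, Real.exp s * R ∈ Set.Ico 0 R := fun s hs =>
    ⟨by positivity, mul_lt_of_lt_one_left hR ((Real.exp_lt_exp.2 hs).trans_eq Real.exp_zero)⟩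
  have key : ∀ s < 0, g (Real.exp s * R) = ((f s : ℝ) : EReal) := fun s hs => by
    have hcont : ContinuousAt f s := H.profile.continuousOn.continuousAt (Iio_mem_nhds hs)
    refine le_antisymm ?_ ?_ <;> by_contra! h
    · -- a level between, attained by `f` slightly to the right of `s`
      obtain ⟨t, ht1, ht2⟩ := EReal.lt_iff_exists_real_btwn.1 h
      rw [EReal.coe_lt_coe_iff] at ht1
      have hev : ∀ᶠ s' in 𝓝[>] s, f s' < t ∧ s' < 0 :=
        nhdsWithin_le_nhds ((hcont.eventually (gt_mem_nhds ht1)).and (gt_mem_nhds hs))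
      obtain ⟨s', ⟨hft, hs'0⟩, hss'⟩ := (hev.and self_mem_nhdsWithin).exists
      have h1 := H.le_volume_lt hV hs'0 hft
      rw [← heq] at h1
      refine absurd (h1.trans (measure_mono (t := Metric.ball 0 (Real.exp s * R)) ?_)) ?_
      · rintro z ⟨hzR, hzt⟩
        rw [mem_ball_zero_iff] at hzR ⊢
        by_contra! hz
        rw [hg z (mem_ball_zero_iff.2 hzR)] at hzt
        exact absurd (ht2.trans_le (hgm (hmem s hs) ⟨norm_nonneg z, hzR⟩ hz)) (not_lt.2 hzt.le)
      · rw [hball, not_le]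
        exact hlt s s' hss'
    · -- a level between, exceeded by `f` slightly to the left of `s`
      obtain ⟨t, ht1, ht2⟩ := EReal.lt_iff_exists_real_btwn.1 h
      rw [EReal.coe_lt_coe_iff] at ht2
      have hev : ∀ᶠ s' in 𝓝[<] s, t < f s' :=
        nhdsWithin_le_nhds (hcont.eventually (lt_mem_nhds ht2))
      obtain ⟨s', hft, hss'⟩ := (hev.and self_mem_nhdsWithin).exists
      have hss' : s' < s := hss'
      have h1 := H.volume_lt_le hV (hss'.trans hs) (le_of_lt hft)
      rw [← heq] at h1
      refine absurd ((measure_mono (s := Metric.ball 0 (Real.exp s * R)) ?_).trans h1) ?_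
      · intro z hz
        rw [mem_ball_zero_iff] at hz
        have hzR : z ∈ Metric.ball (0 : Cn n) R := mem_ball_zero_iff.2 (hz.trans (hmem s hs).2)
        refine ⟨hzR, ?_⟩
        rw [hg z hzR]
        exact (hgm ⟨norm_nonneg z, mem_ball_zero_iff.1 hzR⟩ (hmem s hs) hz.le).trans_lt ht1
      · rw [hball, not_le]
        exact hlt s' s hss'
  refine ⟨RadialData.logBall H.profile hR fun z hz hz0 => ?_, ?_⟩
  · have hl : Pluripotential.logBall R z < 0 := by
      rw [logBall_lt_iff hR hz0, Real.exp_zero, one_mul]; exact mem_ball_zero_iff.1 hz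
    rw [← key _ hl, hg z hz]
    congr 1
    rw [Pluripotential.logBall, Real.exp_sub, logNorm, Real.exp_log (norm_pos_iff.2 hz0),
      Real.exp_log hR, div_mul_cancel₀ _ hR.ne']
  · rw [hg 0 (Metric.mem_ball_self hR), extendBot, if_pos rfl, norm_zero]
    refine le_iInf fun t => ?_
    rw [← key t t.2]
    exact hgm ⟨le_rfl, hR⟩ (hmem t t.2) (by positivity)

end RadialData

/-! ### Reduction of the data to the radial setting -/

/-- The values of `f` outside of `(-∞, 0)` are irrelevant, and may be taken to be zero. -/
theorem profile_indicator {f : ℝ → ℝ} (hconv : ConvexOn ℝ (Set.Iio 0) f)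
    (hmono : MonotoneOn f (Set.Iio 0)) (hzero : Tendsto f (𝓝[<] 0) (𝓝 0)) :
    Profile ((Set.Iio 0).indicator f) where
  convex := hconv.congr fun _ ht => (Set.indicator_of_mem ht f).symm
  mono := hmono.congr fun _ ht => (Set.indicator_of_mem ht f).symm
  lim := hzero.congr' (by
    filter_upwards [self_mem_nhdsWithin] with t ht using (Set.indicator_of_mem ht f).symm)
  meas := by
    have hc : ContinuousOn f (Set.Iio 0) := by simpa using hconv.continuousOn_interior
    exact hc.measurable_piecewise continuousOn_const measurableSet_Iio

theorem extendBot_logMinkowski {f : ℝ → ℝ} {Ω : Set (Cn n)} {z : Cn n} (hz : 0 < gauge Ω z) :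
    extendBot f (logMinkowski Ω z) = ((f (logGauge Ω z) : ℝ) : EReal) := by
  rw [logMinkowski, ENNReal.log_ofReal_of_pos hz, extendBot, if_neg (EReal.coe_ne_bot _),
    EReal.toReal_coe, logGauge]

theorem logMinkowski_zero (Ω : Set (Cn n)) : logMinkowski Ω 0 = ⊥ := by
  simp [logMinkowski]

end Pluripotential

end

open Pluripotential
theorem proposition2p8 (n : ℕ) (hn : 1 ≤ n) (Ω : Set (Cn n)) (hne : Ω.Nonempty)
    (hΩ : IsSmoothlyBounded Ω) (hbal : Balanced ℂ Ω) (hpsc : IsLeviPseudoconvex Ω)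
    (f : ℝ → ℝ) (hconv : ConvexOn ℝ (Set.Iio 0) f) (hmono : MonotoneOn f (Set.Iio 0))
    (hzero : Filter.Tendsto f (nhdsWithin 0 (Set.Iio 0)) (nhds 0))
    (φ : Cn n → EReal) (hφ : ∀ z ∈ Ω, φ z = extendBot f (logMinkowski Ω z)) :
    (∃! μ, IsMongeAmpereMeasure Ω φ μ) ∧
    ∫⁻ z in Ω, (-φ z).toENNReal ∂(mongeAmpere Ω φ)
      = (2 ^ n)⁻¹ * ∫⁻ t in Set.Iio (0 : ℝ), ENNReal.ofReal (deriv f t) ^ (n + 1) ∧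
    (∃ R ψ, IsSchwarzSymmetrization Ω φ R ψ) ∧
    ∀ R ψ, IsSchwarzSymmetrization Ω φ R ψ →
      (∃! ν, IsMongeAmpereMeasure (Metric.ball 0 R) ψ ν) ∧
      energy (Metric.ball 0 R) ψ = energy Ω φ := by
  obtain ⟨m, rfl⟩ : ∃ m, n = m + 1 := ⟨n - 1, by omega⟩
  have h0 := zero_mem_of_balanced hbal hne
  -- only the values of `f` on `(-∞, 0)` matter; `F` is measurable on the whole line
  set F := (Set.Iio (0 : ℝ)).indicator f with hF
  have hFf : ∀ t < 0, F t = f t := fun t ht => Set.indicator_of_mem (Set.mem_Iio.2 ht) f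
  have H : RadialData (logGauge Ω) F Ω φ :=
    { logHom := logHom_logGauge hΩ hbal h0 hpsc
      profile := profile_indicator hconv hmono hzero
      isOpen := hΩ.isOpen
      mem_iff := fun _ => mem_iff_logGauge_neg hΩ hbal h0
      apply_eq := fun z hz hz0 => by
        rw [hφ z hz, extendBot_logMinkowski (gauge_pos_of_ne_zero hΩ h0 hz0),
          hFf _ (((mem_iff_logGauge_neg hΩ hbal h0).1 hz).resolve_left hz0)] }
  have hbot : φ 0 ≤ extendBot F ⊥ := by
    rw [hφ 0 h0, logMinkowski_zero, extendBot, extendBot, if_pos rfl, if_pos rfl]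
    exact le_of_eq (iInf_congr fun t => by rw [hFf t t.2])
  have hder : ∫⁻ t in Set.Iio (0 : ℝ), ENNReal.ofReal (deriv F t) ^ (m + 1 + 1)
      = ∫⁻ t in Set.Iio (0 : ℝ), ENNReal.ofReal (deriv f t) ^ (m + 1 + 1) := by
    refine MeasureTheory.setLIntegral_congr_fun measurableSet_Iio fun t ht => ?_
    have : F =ᶠ[nhds t] f := by
      filter_upwards [Iio_mem_nhds ht] with s hs using hFf s hs
    simp only [this.deriv_eq]
  have hB : ∀ z, z ≠ 0 →
      ∃ r : ℝ, 0 ≤ r ∧ formB (logGauge Ω) (fun _ : Fin m => logGauge Ω) id id z = r :=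
    fun z hz => formB_logGauge_nonneg hΩ hbal h0 hpsc hz
  have hvol := volume_logGauge_lt hΩ hbal h0
  have hfin : MeasureTheory.volume Ω ≠ ⊤ := hΩ.bounded.measure_lt_top.ne
  have hint := H.lintegral_mongeAmpere hB hbot
  refine ⟨H.existsUnique_mongeAmpere hB, by rw [hint, hder],
    H.exists_isSchwarzSymmetrization hvol hfin h0, fun R ψ hψ => ?_⟩
  obtain ⟨H', hbot'⟩ := H.of_isSchwarzSymmetrization hvol hfin h0 hψ
  have hB' : ∀ z, z ≠ 0 →
      ∃ r : ℝ, 0 ≤ r ∧ formB (logBall R) (fun _ : Fin m => logBall R) id id z = r :=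
    fun z hz => formB_logBall_nonneg R hz
  refine ⟨H'.existsUnique_mongeAmpere hB', ?_⟩
  rw [energy, energy, H'.lintegral_mongeAmpere hB' hbot', hint]
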